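/- **Symmetric polycategories.** A symmetric polycategory $\mathbf P$ consists of objects; for all finite strings $\Gamma,\Delta$ of objects a set $\mathbf P(\Gamma;\Delta)$ of polymorphisms $\Gamma\to\Delta$; an identity $1_x\in\mathbf P(x;x)$ for each object $x$; an action of the permutations of the domain and of the codomain, $\mathbf P(\Gamma;\Delta)\to\mathbf P(\sigma\Gamma;\tau\Delta)$; and a cut operation $\mathbf P(\Gamma;\Delta,x)\times\mathbf P(x,\Gamma';\Delta')\to\mathbf P(\Gamma,\Gamma';\Delta,\Delta')$, $(f,g)\mapsto f;_x g$ (cuts at other positions are obtained by first permuting). The axioms are: the action is functorial; cutting and then permuting $\Gamma,\Gamma',\Delta,\Delta'$ equals permuting and then cutting; identities are units for cut; cut is associative, $(f;_xg);_yh=f;_x(g;_yh)$ for $f:\Gamma\to\Delta,x$, $g:x,\Gamma'\to\Delta',y$ and $h:y,\Gamma''\to\Delta''$; and cut satisfies the interchange laws $(f;_xg);_yh=(f;_yh);_xg$ for $f:\Gamma\to\Delta,x,y$, $g:x,\Gamma'\to\Delta'$, $h:y,\Gamma''\to\Delta''$, and $f;_x(g;_yh)=g;_y(f;_xh)$ for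 $f:\Gamma\to\Delta,x$, $g:\Gamma'\to\Delta',y$, $h:x,y,\Gamma''\to\Delta''$ (equations hold up to the evident permutations of strings). **The logic.** Let $\mathbf A$ be a symmetric polycategory. Formulas are generated from the objects of $\mathbf A$ (the atoms) by sums $\sum_{i\in I}X_i$ and products $\prod_{i\in I}X_i$ over finite, possibly empty, sets $I$. Derivations of sequents $\Gamma\vdash\Delta$, where $\Gamma$ and $\Delta$ are strings of formulas regarded as unordered (their positions are named channels, and rules may be applied at any channel), are generated by the following rules. - Axiom: every $f:A_1,\dots,A_m\to B_1,\dots,B_n$ in $\mathbf A$ is a derivation of $A_1,\dots,A_m\vdash B_1,\dots,B_n$; in particular $1_A$ derives $A\vdash A$. - Cotuple: from $\Gamma,X_i\vdash\Delta$ for all $i\in I$, infer $\Gamma,\sum_iX_i\vdash\Delta$. Tuple: from $\Gamma\vdash Y_i,\Delta$ for all $i\in I$, infer $\Gamma\vdash\prod_iY_i,\Delta$. - Projection: from $\Gamma,X_k\vdash\Delta$ with $k\in I$, infer $\Gamma,\prod_iX_i\vdash\Delta$. Injection: from $\Gamma\vdash Y_k,\Delta$ with $k\in I$, infer $\Gamma\vdash\sum_iY_i,\Delta$.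 - Cut: from $\Gamma\vdash\Delta,Z$ and $Z,\Gamma'\vdash\Delta'$, infer $\Gamma,\Gamma'\vdash\Delta,\Delta'$. The identity derivation $\iota_X$ of $X\vdash X$ is defined by recursion: $\iota_A=1_A$ for an atom $A$; $\iota_{\sum X_i}$ is the cotuple of the injections of the $\iota_{X_i}$; and $\iota_{\prod X_i}$ is the tuple of the projections of the $\iota_{X_i}$. **The relation $\sim$.** For channels write $\alpha\{f_i\}_i$ (cotuple), $\alpha(f_i)_i$ (tuple), $\overleftarrow\alpha[k](f)$ (projection), $\overrightarrow\alpha[k](f)$ (injection) and $f;_\gamma g$ (cut). Let $\sim$ be the least family of equivalence relations on the derivations of each sequent that is compatible with all the rules and with renaming of channels (the naming of the channels of the premises of an axiom or cut being immaterial), that identifies a cut between two axioms $f,g$ of $\mathbf A$ with the axiom given by their cut in $\mathbf A$, and that contains - the cut-elimination reductions: $f;_\gamma 1_A\sim f$ and $1_A;_\gamma f\sim f$ for atoms $A$; if the last rule of one premise of a cut does not act on the cut channel, the cut may be moved above that rule, e.g. $\alpha\{f_i\}_i;_\gamma g\sim\alpha\{f_i;_\gamma g\}_i$ and $\overrightarrow\alpha[k](f);_\gamma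 g\sim\overrightarrow\alpha[k](f;_\gamma g)$, and likewise for each of the four non-cut logical rules in each of the two premises; $\overrightarrow\gamma[k](f);_\gamma\gamma\{g_i\}_i\sim f;_\gamma g_k$; and $\gamma(f_i)_i;_\gamma\overleftarrow\gamma[k](g)\sim f_k;_\gamma g$; - the permuting conversions: any two consecutive inferences, each one a cotuple, tuple, projection or injection, that act on different channels $\alpha\ne\beta$ may be interchanged (including empty cotuples and tuples), e.g. $\alpha\{\beta\{f_{ij}\}_j\}_i\sim\beta\{\alpha\{f_{ij}\}_i\}_j$, $\alpha\{\overrightarrow\beta[k](f_i)\}_i\sim\overrightarrow\beta[k](\alpha\{f_i\}_i)$ and $\overrightarrow\alpha[k](\overleftarrow\beta[l](f))\sim\overleftarrow\beta[l](\overrightarrow\alpha[k](f))$. **Theorem.** For every symmetric polycategory $\mathbf A$, the following data form a symmetric polycategory $\Sigma\Pi_{\mathbf A}$: the objects are the formulas; the polymorphisms $\Gamma\to\Delta$ are the $\sim$-equivalence classes of derivations of $\Gamma\vdash\Delta$; the identity of $X$ is the class of $\iota_X$; composition is given by the cut rule; and permutations act by renaming of channels. In particular identity derivations are units for cut, and cut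 is associative and satisfies both interchange laws, up to $\sim$. -/

import Mathlib

universe u w

/-- A string `x₁, …, xₙ` of elements of `O`. -/
@[ext]
structure Ctx (O : Type u) where
  /-- the length of the string -/
  len : ℕ
  /-- the entries of the string -/
  ty : Fin len → O

namespace Ctx

/-- The positions ("channels") of a string. -/
abbrev Chan {O : Type u} (Γ : Ctx O) : Type := Fin Γ.len

/-- The empty string. -/
abbrev nil {O : Type u} : Ctx O := ⟨0, Fin.elim0⟩

/-- The string of length one with entry `x`. -/
abbrev single {O : Type u} (x : O) : Ctx O := ⟨1, fun _ => x⟩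

/-- The concatenation `Γ, Δ` of two strings. -/
def append {O : Type u} (Γ Δ : Ctx O) : Ctx O := ⟨Γ.len + Δ.len, Fin.append Γ.ty Δ.ty⟩

/-- Replace the entry at the channel `a` by `x`; all other channels are left alone. -/
abbrev set {O : Type u} (Γ : Ctx O) (a : Γ.Chan) (x : O) : Ctx O :=
  ⟨Γ.len, Function.update Γ.ty a x⟩

/-- Apply a function to all the entries of a string. -/
abbrev map {O : Type u} {O' : Type w} (F : O → O') (Γ : Ctx O) : Ctx O' := ⟨Γ.len, F ∘ Γ.ty⟩

end Ctx

infixl:65 " ⊹ " => Ctx.append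

namespace Ctx

/-- A channel of `Γ`, as a channel of `Γ, Δ`. -/
def inl {O : Type u} {Γ : Ctx O} (Δ : Ctx O) (a : Γ.Chan) : (Γ ⊹ Δ).Chan := Fin.castAdd Δ.len a

/-- A channel of `Δ`, as a channel of `Γ, Δ`. -/
def inr {O : Type u} (Γ : Ctx O) {Δ : Ctx O} (b : Δ.Chan) : (Γ ⊹ Δ).Chan := Fin.natAdd Γ.len b

/-- The only channel of a string of length one. -/
def pt {O : Type u} (x : O) : (single x).Chan := (0 : Fin 1)

/-- The channels of `Γ, Δ` are those of `Γ` together with those of `Δ`. -/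
def sumEquiv {O : Type u} (Γ Δ : Ctx O) : Γ.Chan ⊕ Δ.Chan ≃ (Γ ⊹ Δ).Chan := finSumFinEquiv

@[simp] theorem sumEquiv_inl {O : Type u} (Γ Δ : Ctx O) (a : Γ.Chan) :
    sumEquiv Γ Δ (Sum.inl a) = inl Δ a := rfl

@[simp] theorem sumEquiv_inr {O : Type u} (Γ Δ : Ctx O) (b : Δ.Chan) :
    sumEquiv Γ Δ (Sum.inr b) = inr Γ b := rfl

@[simp] theorem sumEquiv_symm_inl {O : Type u} (Γ Δ : Ctx O) (a : Γ.Chan) :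
    (sumEquiv Γ Δ).symm (inl Δ a) = Sum.inl a := by
  rw [← sumEquiv_inl, Equiv.symm_apply_apply]

@[simp] theorem sumEquiv_symm_inr {O : Type u} (Γ Δ : Ctx O) (b : Δ.Chan) :
    (sumEquiv Γ Δ).symm (inr Γ b) = Sum.inr b := by
  rw [← sumEquiv_inr, Equiv.symm_apply_apply]

/-- Every channel of `Γ, Δ` is a channel of `Γ` or a channel of `Δ`. -/
theorem append_cases {O : Type u} {Γ Δ : Ctx O} {p : (Γ ⊹ Δ).Chan → Prop}
    (hl : ∀ a, p (inl Δ a)) (hr : ∀ b, p (inr Γ b)) (c : (Γ ⊹ Δ).Chan) : p c := by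
  obtain ⟨s, rfl⟩ := (sumEquiv Γ Δ).surjective c
  cases s with
  | inl a => exact hl a
  | inr b => exact hr b

theorem inl_ne_inr {O : Type u} {Γ Δ : Ctx O} (a : Γ.Chan) (b : Δ.Chan) : inl Δ a ≠ inr Γ b := by
  intro h
  have := congrArg (sumEquiv Γ Δ).symm h
  simp at this

theorem inl_injective {O : Type u} {Γ Δ : Ctx O} {a a' : Γ.Chan} (h : inl Δ a = inl Δ a') :
    a = a' := by
  have := congrArg (sumEquiv Γ Δ).symm h
  simpa using this

theorem inr_injective {O : Type u} {Γ Δ : Ctx O} {b b' : Δ.Chan} (h : inr Γ b = inr Γ b') :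
    b = b' := by
  have := congrArg (sumEquiv Γ Δ).symm h
  simpa using this

@[simp] theorem append_ty_inl {O : Type u} (Γ Δ : Ctx O) (a : Γ.Chan) :
    (Γ ⊹ Δ).ty (inl Δ a) = Γ.ty a := Fin.append_left _ _ _

@[simp] theorem append_ty_inr {O : Type u} (Γ Δ : Ctx O) (b : Δ.Chan) :
    (Γ ⊹ Δ).ty (inr Γ b) = Δ.ty b := Fin.append_right _ _ _

@[simp] theorem single_ty {O : Type u} (x : O) (c : (single x).Chan) : (single x).ty c = x := rfl

@[simp] theorem set_ty_self {O : Type u} (Γ : Ctx O) (a : Γ.Chan) (x : O) :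
    (Γ.set a x).ty a = x := Function.update_self _ _ _

theorem set_ty_ne {O : Type u} (Γ : Ctx O) {a b : Γ.Chan} (h : b ≠ a) (x : O) :
    (Γ.set a x).ty b = Γ.ty b := Function.update_of_ne h _ _

@[simp] theorem map_ty {O : Type u} {O' : Type w} (F : O → O') (Γ : Ctx O) (c : Γ.Chan) :
    (Γ.map F).ty c = F (Γ.ty c) := rfl

/-- A permutation taking the string `Γ` to the string `Δ`: a bijection between the channels
that preserves the entries. (It exists only if the two lengths agree.) -/
@[ext]
structure Iso {O : Type u} (Γ Δ : Ctx O) where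
  /-- the underlying bijection -/
  equiv : Γ.Chan ≃ Δ.Chan
  /-- corresponding channels carry the same object -/
  ty_eq : ∀ c, Δ.ty (equiv c) = Γ.ty c

namespace Iso

/-- The identity permutation. -/
def refl {O : Type u} (Γ : Ctx O) : Iso Γ Γ := ⟨Equiv.refl _, fun _ => rfl⟩

/-- The inverse of a permutation. -/
def symm {O : Type u} {Γ Δ : Ctx O} (σ : Iso Γ Δ) : Iso Δ Γ :=
  ⟨σ.equiv.symm, fun c => by rw [← σ.ty_eq, Equiv.apply_symm_apply]⟩

/-- First `σ`, then `τ`. -/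
def trans {O : Type u} {Γ Δ Θ : Ctx O} (σ : Iso Γ Δ) (τ : Iso Δ Θ) : Iso Γ Θ :=
  ⟨σ.equiv.trans τ.equiv, fun c => by rw [Equiv.trans_apply, τ.ty_eq, σ.ty_eq]⟩

/-- The permutation `σ | τ` of a concatenation that acts as `σ` on the first part and as `τ` on
the second part. -/
def append {O : Type u} {Γ Γ' Δ Δ' : Ctx O} (σ : Iso Γ Γ') (τ : Iso Δ Δ') :
    Iso (Γ ⊹ Δ) (Γ' ⊹ Δ') :=
  ⟨(sumEquiv Γ Δ).symm.trans ((Equiv.sumCongr σ.equiv τ.equiv).trans (sumEquiv Γ' Δ')), by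
    intro c
    induction c using append_cases with
    | hl a => simp [σ.ty_eq]
    | hr b => simp [τ.ty_eq]⟩

/-- Re-bracketing of concatenations. -/
def assoc {O : Type u} (Γ Δ Θ : Ctx O) : Iso (Γ ⊹ Δ ⊹ Θ) (Γ ⊹ (Δ ⊹ Θ)) :=
  ⟨(sumEquiv (Γ ⊹ Δ) Θ).symm.trans
      (((Equiv.sumCongr (sumEquiv Γ Δ).symm (Equiv.refl _)).trans
        (Equiv.sumAssoc Γ.Chan Δ.Chan Θ.Chan)).trans
      ((Equiv.sumCongr (Equiv.refl _) (sumEquiv Δ Θ)).trans (sumEquiv Γ (Δ ⊹ Θ)))), by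
    intro c
    induction c using append_cases with
    | hl c =>
      induction c using append_cases with
      | hl a => simp
      | hr b => simp
    | hr c => simp⟩

/-- The block exchange `Γ, Δ ≅ Δ, Γ`. -/
def comm {O : Type u} (Γ Δ : Ctx O) : Iso (Γ ⊹ Δ) (Δ ⊹ Γ) :=
  ⟨(sumEquiv Γ Δ).symm.trans ((Equiv.sumComm _ _).trans (sumEquiv Δ Γ)), by
    intro c
    induction c using append_cases with
    | hl a => simp
    | hr b => simp⟩

/-- The empty string is a left unit for concatenation. -/
def nilAppend {O : Type u} (Γ : Ctx O) : Iso (nil ⊹ Γ) Γ :=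
  ⟨(sumEquiv nil Γ).symm.trans (Equiv.emptySum (Fin 0) Γ.Chan), by
    intro c
    induction c using append_cases with
    | hl a => exact Fin.elim0 a
    | hr b => rw [Equiv.trans_apply, sumEquiv_symm_inr, append_ty_inr]; rfl⟩

/-- The empty string is a right unit for concatenation. -/
def appendNil {O : Type u} (Γ : Ctx O) : Iso (Γ ⊹ nil) Γ :=
  ⟨(sumEquiv Γ nil).symm.trans (Equiv.sumEmpty Γ.Chan (Fin 0)), by
    intro c
    induction c using append_cases with
    | hl a => rw [Equiv.trans_apply, sumEquiv_symm_inl, append_ty_inl]; rfl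
    | hr b => exact Fin.elim0 b⟩

/-- The exchange `Γ, Δ, Θ ≅ Γ, Θ, Δ`. -/
def rightComm {O : Type u} (Γ Δ Θ : Ctx O) : Iso (Γ ⊹ Δ ⊹ Θ) (Γ ⊹ Θ ⊹ Δ) :=
  (assoc Γ Δ Θ).trans (((refl Γ).append (comm Δ Θ)).trans (assoc Γ Θ Δ).symm)

/-- The exchange `Γ, Δ, Θ ≅ Δ, Γ, Θ`. -/
def leftComm {O : Type u} (Γ Δ Θ : Ctx O) : Iso (Γ ⊹ (Δ ⊹ Θ)) (Δ ⊹ (Γ ⊹ Θ)) :=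
  (assoc Γ Δ Θ).symm.trans (((comm Γ Δ).append (refl Θ)).trans (assoc Δ Γ Θ))

/-- A permutation of a string is also one of its image under a function. -/
def map {O : Type u} {O' : Type w} (F : O → O') {Γ Δ : Ctx O} (σ : Iso Γ Δ) :
    Iso (Γ.map F) (Δ.map F) :=
  ⟨σ.equiv, fun c => congrArg F (σ.ty_eq c)⟩

/-- A permutation, after the entries at two corresponding channels were both replaced by `x`. -/
def set {O : Type u} {Γ Δ : Ctx O} (σ : Iso Γ Δ) (a : Γ.Chan) (x : O) :
    Iso (Γ.set a x) (Δ.set (σ.equiv a) x) :=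
  ⟨σ.equiv, fun c => by
    by_cases h : c = a
    · rw [h]; exact (set_ty_self Δ _ x).trans (set_ty_self Γ a x).symm
    · exact (set_ty_ne Δ (fun h' => h (σ.equiv.injective h')) x).trans
        ((σ.ty_eq c).trans (set_ty_ne Γ h x).symm)⟩

/- The permutations below are identities on positions; they only record that two descriptions
of a string agree. -/

/-- `F(x) = F(x)`, for strings of length one. -/
def mapSingle {O : Type u} {O' : Type w} (F : O → O') (x : O) :
    Iso ((Ctx.single x).map F) (Ctx.single (F x)) :=
  ⟨Equiv.refl _, fun _ => rfl⟩

/-- `F(Γ, Δ) = F(Γ), F(Δ)`. -/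
def mapAppend {O : Type u} {O' : Type w} (F : O → O') (Γ Δ : Ctx O) :
    Iso ((Γ ⊹ Δ).map F) (Γ.map F ⊹ Δ.map F) :=
  ⟨(sumEquiv Γ Δ).symm.trans (sumEquiv (Γ.map F) (Δ.map F)), fun c => by
    induction c using append_cases (Γ := Γ) (Δ := Δ) with
    | hl a =>
      rw [Equiv.trans_apply, sumEquiv_symm_inl]
      exact (append_ty_inl (Γ.map F) (Δ.map F) a).trans (congrArg F (append_ty_inl Γ Δ a).symm)
    | hr b =>
      rw [Equiv.trans_apply, sumEquiv_symm_inr]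
      exact (append_ty_inr (Γ.map F) (Δ.map F) b).trans (congrArg F (append_ty_inr Γ Δ b).symm)⟩

/-- Replacing an entry of `Γ` is replacing an entry in the first part of `Γ, Δ`. -/
def setAppendLeft {O : Type u} (Γ Δ : Ctx O) (a : Γ.Chan) (x : O) :
    Iso (Γ.set a x ⊹ Δ) ((Γ ⊹ Δ).set (inl Δ a) x) :=
  ⟨(sumEquiv (Γ.set a x) Δ).symm.trans (sumEquiv Γ Δ), by
    intro c
    induction c using append_cases with
    | hl c =>
      rw [Equiv.trans_apply, sumEquiv_symm_inl, append_ty_inl]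
      by_cases h : c = a
      · rw [h]; exact (set_ty_self _ _ _).trans (set_ty_self _ _ _).symm
      · exact (set_ty_ne (Γ ⊹ Δ) (fun h' => h (inl_injective h')) x).trans
          ((append_ty_inl Γ Δ c).trans (set_ty_ne Γ h x).symm)
    | hr d =>
      rw [Equiv.trans_apply, sumEquiv_symm_inr, append_ty_inr]
      exact (set_ty_ne (Γ ⊹ Δ) (fun h' => inl_ne_inr a d h'.symm) x).trans (append_ty_inr Γ Δ d)⟩

/-- Replacing an entry of `Δ` is replacing an entry in the second part of `Γ, Δ`. -/
def setAppendRight {O : Type u} (Γ Δ : Ctx O) (b : Δ.Chan) (x : O) :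
    Iso (Γ ⊹ Δ.set b x) ((Γ ⊹ Δ).set (inr Γ b) x) :=
  ⟨(sumEquiv Γ (Δ.set b x)).symm.trans (sumEquiv Γ Δ), by
    intro c
    induction c using append_cases with
    | hr c =>
      rw [Equiv.trans_apply, sumEquiv_symm_inr, append_ty_inr]
      by_cases h : c = b
      · rw [h]; exact (set_ty_self _ _ _).trans (set_ty_self _ _ _).symm
      · exact (set_ty_ne (Γ ⊹ Δ) (fun h' => h (inr_injective h')) x).trans
          ((append_ty_inr Γ Δ c).trans (set_ty_ne Δ h x).symm)
    | hl d =>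
      rw [Equiv.trans_apply, sumEquiv_symm_inl, append_ty_inl]
      exact (set_ty_ne (Γ ⊹ Δ) (fun h' => inl_ne_inr d b h') x).trans (append_ty_inl Γ Δ d)⟩

/-- Replacing the only entry of a string of length one. -/
def setSingle {O : Type u} (z x : O) : Iso ((single z).set (pt z) x) (single x) :=
  ⟨Equiv.refl _, fun c => by
    have h : c = pt z := Subsingleton.elim (α := Fin 1) _ _
    subst h
    exact (set_ty_self _ _ _).symm⟩

/-- Replacing the last entry of `Δ, z`. -/
def setLast {O : Type u} (Δ : Ctx O) (z x : O) :
    Iso ((Δ ⊹ single z).set (inr Δ (pt z)) x) (Δ ⊹ single x) :=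
  (setAppendRight Δ (single z) (pt z) x).symm.trans ((refl Δ).append (setSingle z x))

/-- Replacing the first entry of `z, Γ`. -/
def setFirst {O : Type u} (Γ : Ctx O) (z x : O) :
    Iso ((single z ⊹ Γ).set (inl Γ (pt z)) x) (single x ⊹ Γ) :=
  (setAppendLeft (single z) Γ (pt z) x).symm.trans ((setSingle z x).append (refl Γ))

/-- Replacements at different channels commute. -/
def setComm {O : Type u} (Γ : Ctx O) {a b : Γ.Chan} (h : a ≠ b) (x y : O) :
    Iso ((Γ.set a x).set b y) ((Γ.set b y).set a x) :=
  ⟨Equiv.refl _, fun c =>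
    congrFun (Function.update_comm (f := Γ.ty) h x y).symm c⟩

end Iso

end Ctx

/-- The data of a symmetric polycategory: objects, polymorphisms `Γ → Δ` between strings of
objects, identities, the action of the permutations, and cut. -/
structure PolyData where
  /-- the objects -/
  Obj : Type u
  /-- the polymorphisms `Γ → Δ` -/
  Hom : Ctx Obj → Ctx Obj → Type w
  /-- the identity `x → x` -/
  id : ∀ x : Obj, Hom (Ctx.single x) (Ctx.single x)
  /-- the action of the permutations of the domain and of the codomain -/
  act : ∀ {Γ Γ' Δ Δ' : Ctx Obj}, Γ.Iso Γ' → Δ.Iso Δ' → Hom Γ Δ → Hom Γ' Δ'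
  /-- the cut of `Γ → Δ, x` with `x, Γ' → Δ'`; cuts at other positions are obtained from this
  one by means of the action of the permutations -/
  cut : ∀ {Γ Γ' Δ Δ' : Ctx Obj} {x : Obj},
    Hom Γ (Δ ⊹ Ctx.single x) → Hom (Ctx.single x ⊹ Γ') Δ' → Hom (Γ ⊹ Γ') (Δ ⊹ Δ')

open Ctx in
/-- The axioms of a symmetric polycategory. The permutations `Iso.assoc`, `Iso.nilAppend`,
`Iso.appendNil` only re-bracket strings; `Iso.rightComm` and `Iso.leftComm` exchange two blocks. -/
structure PolyData.IsSymPolycategory (P : PolyData.{u, w}) : Prop where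
  act_refl : ∀ {Γ Δ : Ctx P.Obj} (f : P.Hom Γ Δ), P.act (Iso.refl Γ) (Iso.refl Δ) f = f
  act_act : ∀ {Γ Γ' Γ'' Δ Δ' Δ'' : Ctx P.Obj} (σ : Γ.Iso Γ') (σ' : Γ'.Iso Γ'')
    (τ : Δ.Iso Δ') (τ' : Δ'.Iso Δ'') (f : P.Hom Γ Δ),
    P.act σ' τ' (P.act σ τ f) = P.act (σ.trans σ') (τ.trans τ') f
  /-- permuting and then cutting is cutting and then permuting -/
  cut_act : ∀ {Γ₁ Γ₁' Γ₂ Γ₂' Δ₁ Δ₁' Δ₂ Δ₂' : Ctx P.Obj} {x : P.Obj}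
    (σ₁ : Γ₁.Iso Γ₁') (τ₁ : Δ₁.Iso Δ₁') (σ₂ : Γ₂.Iso Γ₂') (τ₂ : Δ₂.Iso Δ₂')
    (f : P.Hom Γ₁ (Δ₁ ⊹ single x)) (g : P.Hom (single x ⊹ Γ₂) Δ₂),
    P.cut (P.act σ₁ (τ₁.append (Iso.refl (single x))) f)
        (P.act ((Iso.refl (single x)).append σ₂) τ₂ g) =
      P.act (σ₁.append σ₂) (τ₁.append τ₂) (P.cut f g)
  /-- `1 ; f = f` -/
  id_cut : ∀ {Γ Δ : Ctx P.Obj} {x : P.Obj} (f : P.Hom (single x ⊹ Γ) Δ),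
    P.act (Iso.refl _) (Iso.nilAppend Δ)
      (P.cut (P.act (Iso.refl _) (Iso.nilAppend (single x)).symm (P.id x)) f) = f
  /-- `f ; 1 = f` -/
  cut_id : ∀ {Γ Δ : Ctx P.Obj} {x : P.Obj} (f : P.Hom Γ (Δ ⊹ single x)),
    P.act (Iso.appendNil Γ) (Iso.refl _)
      (P.cut f (P.act (Iso.appendNil (single x)).symm (Iso.refl _) (P.id x))) = f
  /-- `(f ; g) ; h = f ; (g ; h)`, for `f : Γ₁ → Δ₁, x` and `g : x, Γ₂ → Δ₂, y` and
  `h : y, Γ₃ → Δ₃` -/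
  assoc : ∀ {Γ₁ Γ₂ Γ₃ Δ₁ Δ₂ Δ₃ : Ctx P.Obj} {x y : P.Obj} (f : P.Hom Γ₁ (Δ₁ ⊹ single x))
    (g : P.Hom (single x ⊹ Γ₂) (Δ₂ ⊹ single y)) (h : P.Hom (single y ⊹ Γ₃) Δ₃),
    P.act (Iso.assoc Γ₁ Γ₂ Γ₃) (Iso.assoc Δ₁ Δ₂ Δ₃)
      (P.cut (P.act (Iso.refl _) (Iso.assoc Δ₁ Δ₂ (single y)).symm (P.cut f g)) h) =
    P.cut f (P.act (Iso.assoc (single x) Γ₂ Γ₃) (Iso.refl _) (P.cut g h))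
  /-- `(f ;ₓ g) ;_y h = (f ;_y h) ;ₓ g`, for `f : Γ₁ → Δ₁, x, y` and `g : x, Γ₂ → Δ₂` and
  `h : y, Γ₃ → Δ₃` -/
  interchange_cod : ∀ {Γ₁ Γ₂ Γ₃ Δ₁ Δ₂ Δ₃ : Ctx P.Obj} {x y : P.Obj}
    (f : P.Hom Γ₁ (Δ₁ ⊹ single x ⊹ single y))
    (g : P.Hom (single x ⊹ Γ₂) Δ₂) (h : P.Hom (single y ⊹ Γ₃) Δ₃),
    P.act (Iso.rightComm Γ₁ Γ₂ Γ₃) (Iso.rightComm Δ₁ Δ₂ Δ₃)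
      (P.cut (P.act (Iso.refl _) (Iso.rightComm Δ₁ (single y) Δ₂)
        (P.cut (P.act (Iso.refl _) (Iso.rightComm Δ₁ (single x) (single y)) f) g)) h) =
    P.cut (P.act (Iso.refl _) (Iso.rightComm Δ₁ (single x) Δ₃) (P.cut f h)) g
  /-- `f ;ₓ (g ;_y h) = g ;_y (f ;ₓ h)`, for `f : Γ₁ → Δ₁, x` and `g : Γ₂ → Δ₂, y` and
  `h : x, y, Γ₃ → Δ₃` -/
  interchange_dom : ∀ {Γ₁ Γ₂ Γ₃ Δ₁ Δ₂ Δ₃ : Ctx P.Obj} {x y : P.Obj}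
    (f : P.Hom Γ₁ (Δ₁ ⊹ single x)) (g : P.Hom Γ₂ (Δ₂ ⊹ single y))
    (h : P.Hom (single x ⊹ (single y ⊹ Γ₃)) Δ₃),
    P.act (Iso.leftComm Γ₁ Γ₂ Γ₃) (Iso.leftComm Δ₁ Δ₂ Δ₃)
      (P.cut f (P.act (Iso.leftComm Γ₂ (single x) Γ₃) (Iso.refl _)
        (P.cut g (P.act (Iso.leftComm (single x) (single y) Γ₃) (Iso.refl _) h)))) =
    P.cut g (P.act (Iso.leftComm Γ₁ (single y) Γ₃) (Iso.refl _) (P.cut f h))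

/-- A symmetric polycategory. -/
structure SymPolycategory extends PolyData.{u, w} where
  /-- the axioms hold -/
  isSymPolycategory : toPolyData.IsSymPolycategory

/-- The formulas of the logic: atoms, and sums and products of finite (possibly empty)
families of formulas. -/
inductive Formula (O : Type u) : Type (max u 1)
  | atom (A : O) : Formula O
  | sum {I : Type} [Finite I] (X : I → Formula O) : Formula O
  | prod {I : Type} [Finite I] (X : I → Formula O) : Formula O

open Ctx in
/-- The derivations of a sequent `Γ ⊢ Δ` in the logic over `𝒜`. The strings are regarded as
unordered: a rule may be applied to any channel, and the strings in the conclusion of an axiom or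
of a cut may be permuted arbitrarily. The identity rule `A ⊢ A` is the axiom rule for
the identity of `A` in `𝒜`. -/
inductive Der (𝒜 : SymPolycategory.{u, w}) :
    Ctx (Formula 𝒜.Obj) → Ctx (Formula 𝒜.Obj) → Type (max u w 1)
  | ax {Γ Δ : Ctx (Formula 𝒜.Obj)} {A B : Ctx 𝒜.Obj} (f : 𝒜.Hom A B)
      (σ : (A.map Formula.atom).Iso Γ) (τ : (B.map Formula.atom).Iso Δ) : Der 𝒜 Γ Δ
  | cotuple {Γ Δ : Ctx (Formula 𝒜.Obj)} (a : Γ.Chan) {I : Type} [Finite I]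
      (X : I → Formula 𝒜.Obj) (ha : Γ.ty a = Formula.sum X)
      (f : ∀ i, Der 𝒜 (Γ.set a (X i)) Δ) : Der 𝒜 Γ Δ
  | tuple {Γ Δ : Ctx (Formula 𝒜.Obj)} (b : Δ.Chan) {I : Type} [Finite I]
      (Y : I → Formula 𝒜.Obj) (hb : Δ.ty b = Formula.prod Y)
      (f : ∀ i, Der 𝒜 Γ (Δ.set b (Y i))) : Der 𝒜 Γ Δ
  | proj {Γ Δ : Ctx (Formula 𝒜.Obj)} (a : Γ.Chan) {I : Type} [Finite I]
      (X : I → Formula 𝒜.Obj) (ha : Γ.ty a = Formula.prod X) (k : I)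
      (f : Der 𝒜 (Γ.set a (X k)) Δ) : Der 𝒜 Γ Δ
  | inj {Γ Δ : Ctx (Formula 𝒜.Obj)} (b : Δ.Chan) {I : Type} [Finite I]
      (Y : I → Formula 𝒜.Obj) (hb : Δ.ty b = Formula.sum Y) (k : I)
      (f : Der 𝒜 Γ (Δ.set b (Y k))) : Der 𝒜 Γ Δ
  | cut {Γ Δ Γ₁ Γ₂ Δ₁ Δ₂ : Ctx (Formula 𝒜.Obj)} {Z : Formula 𝒜.Obj}
      (σ : (Γ₁ ⊹ Γ₂).Iso Γ) (τ : (Δ₁ ⊹ Δ₂).Iso Δ)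
      (f : Der 𝒜 Γ₁ (Δ₁ ⊹ single Z)) (g : Der 𝒜 (single Z ⊹ Γ₂) Δ₂) : Der 𝒜 Γ Δ

namespace Der

open Ctx

/-- Renaming of the channels of a derivation. -/
def ren {𝒜 : SymPolycategory.{u, w}} : ∀ {Γ Δ Γ' Δ' : Ctx (Formula 𝒜.Obj)},
    Γ.Iso Γ' → Δ.Iso Δ' → Der 𝒜 Γ Δ → Der 𝒜 Γ' Δ'
  | _, _, _, _, σ, τ, ax f σ' τ' => ax f (σ'.trans σ) (τ'.trans τ)
  | _, _, _, _, σ, τ, cotuple a X ha f =>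
      cotuple (σ.equiv a) X ((σ.ty_eq a).trans ha) fun i => ren (σ.set a (X i)) τ (f i)
  | _, _, _, _, σ, τ, tuple b Y hb f =>
      tuple (τ.equiv b) Y ((τ.ty_eq b).trans hb) fun i => ren σ (τ.set b (Y i)) (f i)
  | _, _, _, _, σ, τ, proj a X ha k f =>
      proj (σ.equiv a) X ((σ.ty_eq a).trans ha) k (ren (σ.set a (X k)) τ f)
  | _, _, _, _, σ, τ, inj b Y hb k f =>
      inj (τ.equiv b) Y ((τ.ty_eq b).trans hb) k (ren σ (τ.set b (Y k)) f)
  | _, _, _, _, σ, τ, cut σ' τ' f g => cut (σ'.trans σ) (τ'.trans τ) f g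

/-- Renaming in the antecedent only. -/
def renL {𝒜 : SymPolycategory.{u, w}} {Γ Γ' Δ : Ctx (Formula 𝒜.Obj)}
    (σ : Γ.Iso Γ') (f : Der 𝒜 Γ Δ) : Der 𝒜 Γ' Δ := ren σ (Iso.refl Δ) f

/-- Renaming in the succedent only. -/
def renR {𝒜 : SymPolycategory.{u, w}} {Γ Δ Δ' : Ctx (Formula 𝒜.Obj)}
    (τ : Δ.Iso Δ') (f : Der 𝒜 Γ Δ) : Der 𝒜 Γ Δ' := ren (Iso.refl Γ) τ f

/-- The cut of `Γ₁ ⊢ Δ₁, Z` and `Z, Γ₂ ⊢ Δ₂`, with conclusion exactly `Γ₁, Γ₂ ⊢ Δ₁, Δ₂`. -/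
def comp {𝒜 : SymPolycategory.{u, w}} {Γ₁ Γ₂ Δ₁ Δ₂ : Ctx (Formula 𝒜.Obj)} {Z : Formula 𝒜.Obj}
    (f : Der 𝒜 Γ₁ (Δ₁ ⊹ single Z)) (g : Der 𝒜 (single Z ⊹ Γ₂) Δ₂) :
    Der 𝒜 (Γ₁ ⊹ Γ₂) (Δ₁ ⊹ Δ₂) :=
  cut (Iso.refl _) (Iso.refl _) f g

/-- The identity derivations, by recursion on the formula. -/
def iota {𝒜 : SymPolycategory.{u, w}} : ∀ X : Formula 𝒜.Obj, Der 𝒜 (single X) (single X)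
  | .atom A => ax (𝒜.id A) (Iso.mapSingle _ A) (Iso.mapSingle _ A)
  | @Formula.sum _ _ _ X => cotuple (pt _) X rfl fun i => inj (pt _) X rfl i
      (ren (Iso.setSingle _ _).symm (Iso.setSingle _ _).symm (iota (X i)))
  | @Formula.prod _ _ _ X => tuple (pt _) X rfl fun i => proj (pt _) X rfl i
      (ren (Iso.setSingle _ _).symm (Iso.setSingle _ _).symm (iota (X i)))

/-- The equivalence relation `∼` on the derivations of a sequent that is generated by
the cut-elimination reductions and the permuting conversions (and by the identification of
derivations that differ only in the arrangement of the channels above an axiom or a cut):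
the least family of equivalence relations that contains these and is compatible with all
the rules and with renaming. -/
inductive Conv {𝒜 : SymPolycategory.{u, w}} :
    ∀ {Γ Δ : Ctx (Formula 𝒜.Obj)}, Der 𝒜 Γ Δ → Der 𝒜 Γ Δ → Prop
  /- equivalence relation -/
  | refl {Γ Δ : Ctx (Formula 𝒜.Obj)} (f : Der 𝒜 Γ Δ) : Conv f f
  | symm {Γ Δ : Ctx (Formula 𝒜.Obj)} {f g : Der 𝒜 Γ Δ} : Conv f g → Conv g f
  | trans {Γ Δ : Ctx (Formula 𝒜.Obj)} {f g h : Der 𝒜 Γ Δ} : Conv f g → Conv g h → Conv f h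
  /- compatibility with the rules and with renaming -/
  | congr_cotuple {Γ Δ : Ctx (Formula 𝒜.Obj)} (a : Γ.Chan) {I : Type} [Finite I]
      (X : I → Formula 𝒜.Obj) (ha : Γ.ty a = .sum X) {f f' : ∀ i, Der 𝒜 (Γ.set a (X i)) Δ}
      (hf : ∀ i, Conv (f i) (f' i)) : Conv (cotuple a X ha f) (cotuple a X ha f')
  | congr_tuple {Γ Δ : Ctx (Formula 𝒜.Obj)} (b : Δ.Chan) {I : Type} [Finite I]
      (Y : I → Formula 𝒜.Obj) (hb : Δ.ty b = .prod Y) {f f' : ∀ i, Der 𝒜 Γ (Δ.set b (Y i))}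
      (hf : ∀ i, Conv (f i) (f' i)) : Conv (tuple b Y hb f) (tuple b Y hb f')
  | congr_proj {Γ Δ : Ctx (Formula 𝒜.Obj)} (a : Γ.Chan) {I : Type} [Finite I]
      (X : I → Formula 𝒜.Obj) (ha : Γ.ty a = .prod X) (k : I) {f f' : Der 𝒜 (Γ.set a (X k)) Δ}
      (hf : Conv f f') : Conv (proj a X ha k f) (proj a X ha k f')
  | congr_inj {Γ Δ : Ctx (Formula 𝒜.Obj)} (b : Δ.Chan) {I : Type} [Finite I]
      (Y : I → Formula 𝒜.Obj) (hb : Δ.ty b = .sum Y) (k : I) {f f' : Der 𝒜 Γ (Δ.set b (Y k))}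
      (hf : Conv f f') : Conv (inj b Y hb k f) (inj b Y hb k f')
  | congr_cut {Γ Δ Γ₁ Γ₂ Δ₁ Δ₂ : Ctx (Formula 𝒜.Obj)} {Z : Formula 𝒜.Obj}
      (σ : (Γ₁ ⊹ Γ₂).Iso Γ) (τ : (Δ₁ ⊹ Δ₂).Iso Δ)
      {f f' : Der 𝒜 Γ₁ (Δ₁ ⊹ single Z)} {g g' : Der 𝒜 (single Z ⊹ Γ₂) Δ₂}
      (hf : Conv f f') (hg : Conv g g') : Conv (cut σ τ f g) (cut σ τ f' g')
  | congr_ren {Γ Γ' Δ Δ' : Ctx (Formula 𝒜.Obj)} (σ : Γ.Iso Γ') (τ : Δ.Iso Δ')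
      {f f' : Der 𝒜 Γ Δ} (hf : Conv f f') : Conv (ren σ τ f) (ren σ τ f')
  /- the arrangement of the channels above an axiom or a cut is immaterial -/
  | ax_act {Γ Δ : Ctx (Formula 𝒜.Obj)} {A A' B B' : Ctx 𝒜.Obj} (f : 𝒜.Hom A B)
      (σ : A.Iso A') (τ : B.Iso B')
      (σ' : (A'.map Formula.atom).Iso Γ) (τ' : (B'.map Formula.atom).Iso Δ) :
      Conv (ax (𝒜.act σ τ f) σ' τ')
        (ax f ((σ.map Formula.atom).trans σ') ((τ.map Formula.atom).trans τ'))
  | cut_ren {Γ Δ Γ₁ Γ₁' Γ₂ Γ₂' Δ₁ Δ₁' Δ₂ Δ₂' : Ctx (Formula 𝒜.Obj)} {Z : Formula 𝒜.Obj}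
      (σ : (Γ₁' ⊹ Γ₂').Iso Γ) (τ : (Δ₁' ⊹ Δ₂').Iso Δ)
      (σ₁ : Γ₁.Iso Γ₁') (τ₁ : Δ₁.Iso Δ₁') (σ₂ : Γ₂.Iso Γ₂') (τ₂ : Δ₂.Iso Δ₂')
      (f : Der 𝒜 Γ₁ (Δ₁ ⊹ single Z)) (g : Der 𝒜 (single Z ⊹ Γ₂) Δ₂) :
      Conv (cut σ τ (ren σ₁ (τ₁.append (Iso.refl _)) f) (ren ((Iso.refl _).append σ₂) τ₂ g))
        (cut ((σ₁.append σ₂).trans σ) ((τ₁.append τ₂).trans τ) f g)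
  /- a cut between two axioms is given by the cut of `𝒜` -/
  | essential {A A' B B' : Ctx 𝒜.Obj} {C : 𝒜.Obj}
      (f : 𝒜.Hom A (B ⊹ single C)) (g : 𝒜.Hom (single C ⊹ A') B') :
      Conv
        (comp
          (ax f (Iso.refl _)
            ((Iso.mapAppend _ B (single C)).trans ((Iso.refl _).append (Iso.mapSingle _ C))))
          (ax g ((Iso.mapAppend _ (single C) A').trans
            ((Iso.mapSingle _ C).append (Iso.refl _))) (Iso.refl _)))
        (ax (𝒜.cut f g) (Iso.mapAppend _ A A') (Iso.mapAppend _ B B'))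
  /- reductions: cut against an atomic identity -/
  | cut_one {Γ Δ : Ctx (Formula 𝒜.Obj)} {A : 𝒜.Obj} (f : Der 𝒜 Γ (Δ ⊹ single (.atom A))) :
      Conv (comp f (renL (Iso.appendNil _).symm
          (ax (𝒜.id A) (Iso.mapSingle _ A) (Iso.mapSingle _ A))))
        (renL (Iso.appendNil Γ).symm f)
  | one_cut {Γ Δ : Ctx (Formula 𝒜.Obj)} {A : 𝒜.Obj} (f : Der 𝒜 (single (.atom A) ⊹ Γ) Δ) :
      Conv (comp (renR (Iso.nilAppend _).symm
          (ax (𝒜.id A) (Iso.mapSingle _ A) (Iso.mapSingle _ A))) f)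
        (renR (Iso.nilAppend Δ).symm f)
  /- reductions: the last rule of the left premise does not act on the cut channel -/
  | cotuple_cut {Γ₁ Γ₂ Δ₁ Δ₂ : Ctx (Formula 𝒜.Obj)} {Z : Formula 𝒜.Obj} (a : Γ₁.Chan)
      {I : Type} [Finite I] (X : I → Formula 𝒜.Obj) (ha : Γ₁.ty a = .sum X)
      (f : ∀ i, Der 𝒜 (Γ₁.set a (X i)) (Δ₁ ⊹ single Z)) (g : Der 𝒜 (single Z ⊹ Γ₂) Δ₂) :
      Conv (comp (cotuple a X ha f) g)
        (cotuple (inl Γ₂ a) X ((append_ty_inl _ _ _).trans ha) fun i =>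
          renL (Iso.setAppendLeft Γ₁ Γ₂ a (X i)) (comp (f i) g))
  | proj_cut {Γ₁ Γ₂ Δ₁ Δ₂ : Ctx (Formula 𝒜.Obj)} {Z : Formula 𝒜.Obj} (a : Γ₁.Chan)
      {I : Type} [Finite I] (X : I → Formula 𝒜.Obj) (ha : Γ₁.ty a = .prod X) (k : I)
      (f : Der 𝒜 (Γ₁.set a (X k)) (Δ₁ ⊹ single Z)) (g : Der 𝒜 (single Z ⊹ Γ₂) Δ₂) :
      Conv (comp (proj a X ha k f) g)
        (proj (inl Γ₂ a) X ((append_ty_inl _ _ _).trans ha) k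
          (renL (Iso.setAppendLeft Γ₁ Γ₂ a (X k)) (comp f g)))
  | tuple_cut {Γ₁ Γ₂ Δ₁ Δ₂ : Ctx (Formula 𝒜.Obj)} {Z : Formula 𝒜.Obj} (b : Δ₁.Chan)
      {I : Type} [Finite I] (Y : I → Formula 𝒜.Obj) (hb : Δ₁.ty b = .prod Y)
      (f : ∀ i, Der 𝒜 Γ₁ ((Δ₁ ⊹ single Z).set (inl _ b) (Y i)))
      (g : Der 𝒜 (single Z ⊹ Γ₂) Δ₂) :
      Conv (comp (tuple (inl _ b) Y ((append_ty_inl _ _ _).trans hb) f) g)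
        (tuple (inl Δ₂ b) Y ((append_ty_inl _ _ _).trans hb) fun i =>
          renR (Iso.setAppendLeft Δ₁ Δ₂ b (Y i))
            (comp (renR (Iso.setAppendLeft Δ₁ (single Z) b (Y i)).symm (f i)) g))
  | inj_cut {Γ₁ Γ₂ Δ₁ Δ₂ : Ctx (Formula 𝒜.Obj)} {Z : Formula 𝒜.Obj} (b : Δ₁.Chan)
      {I : Type} [Finite I] (Y : I → Formula 𝒜.Obj) (hb : Δ₁.ty b = .sum Y) (k : I)
      (f : Der 𝒜 Γ₁ ((Δ₁ ⊹ single Z).set (inl _ b) (Y k)))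
      (g : Der 𝒜 (single Z ⊹ Γ₂) Δ₂) :
      Conv (comp (inj (inl _ b) Y ((append_ty_inl _ _ _).trans hb) k f) g)
        (inj (inl Δ₂ b) Y ((append_ty_inl _ _ _).trans hb) k
          (renR (Iso.setAppendLeft Δ₁ Δ₂ b (Y k))
            (comp (renR (Iso.setAppendLeft Δ₁ (single Z) b (Y k)).symm f) g)))
  /- reductions: the last rule of the right premise does not act on the cut channel -/
  | cut_tuple {Γ₁ Γ₂ Δ₁ Δ₂ : Ctx (Formula 𝒜.Obj)} {Z : Formula 𝒜.Obj} (b : Δ₂.Chan)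
      {I : Type} [Finite I] (Y : I → Formula 𝒜.Obj) (hb : Δ₂.ty b = .prod Y)
      (f : Der 𝒜 Γ₁ (Δ₁ ⊹ single Z)) (g : ∀ i, Der 𝒜 (single Z ⊹ Γ₂) (Δ₂.set b (Y i))) :
      Conv (comp f (tuple b Y hb g))
        (tuple (inr Δ₁ b) Y ((append_ty_inr _ _ _).trans hb) fun i =>
          renR (Iso.setAppendRight Δ₁ Δ₂ b (Y i)) (comp f (g i)))
  | cut_inj {Γ₁ Γ₂ Δ₁ Δ₂ : Ctx (Formula 𝒜.Obj)} {Z : Formula 𝒜.Obj} (b : Δ₂.Chan)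
      {I : Type} [Finite I] (Y : I → Formula 𝒜.Obj) (hb : Δ₂.ty b = .sum Y) (k : I)
      (f : Der 𝒜 Γ₁ (Δ₁ ⊹ single Z)) (g : Der 𝒜 (single Z ⊹ Γ₂) (Δ₂.set b (Y k))) :
      Conv (comp f (inj b Y hb k g))
        (inj (inr Δ₁ b) Y ((append_ty_inr _ _ _).trans hb) k
          (renR (Iso.setAppendRight Δ₁ Δ₂ b (Y k)) (comp f g)))
  | cut_cotuple {Γ₁ Γ₂ Δ₁ Δ₂ : Ctx (Formula 𝒜.Obj)} {Z : Formula 𝒜.Obj} (a : Γ₂.Chan)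
      {I : Type} [Finite I] (X : I → Formula 𝒜.Obj) (ha : Γ₂.ty a = .sum X)
      (f : Der 𝒜 Γ₁ (Δ₁ ⊹ single Z))
      (g : ∀ i, Der 𝒜 ((single Z ⊹ Γ₂).set (inr _ a) (X i)) Δ₂) :
      Conv (comp f (cotuple (inr _ a) X ((append_ty_inr _ _ _).trans ha) g))
        (cotuple (inr Γ₁ a) X ((append_ty_inr _ _ _).trans ha) fun i =>
          renL (Iso.setAppendRight Γ₁ Γ₂ a (X i))
            (comp f (renL (Iso.setAppendRight (single Z) Γ₂ a (X i)).symm (g i))))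
  | cut_proj {Γ₁ Γ₂ Δ₁ Δ₂ : Ctx (Formula 𝒜.Obj)} {Z : Formula 𝒜.Obj} (a : Γ₂.Chan)
      {I : Type} [Finite I] (X : I → Formula 𝒜.Obj) (ha : Γ₂.ty a = .prod X) (k : I)
      (f : Der 𝒜 Γ₁ (Δ₁ ⊹ single Z))
      (g : Der 𝒜 ((single Z ⊹ Γ₂).set (inr _ a) (X k)) Δ₂) :
      Conv (comp f (proj (inr _ a) X ((append_ty_inr _ _ _).trans ha) k g))
        (proj (inr Γ₁ a) X ((append_ty_inr _ _ _).trans ha) k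
          (renL (Iso.setAppendRight Γ₁ Γ₂ a (X k))
            (comp f (renL (Iso.setAppendRight (single Z) Γ₂ a (X k)).symm g))))
  /- reductions: both premises act on the cut channel -/
  | inj_cut_cotuple {Γ₁ Γ₂ Δ₁ Δ₂ : Ctx (Formula 𝒜.Obj)} {I : Type} [Finite I]
      (X : I → Formula 𝒜.Obj) (k : I)
      (f : Der 𝒜 Γ₁ ((Δ₁ ⊹ single (.sum X)).set (inr Δ₁ (pt _)) (X k)))
      (g : ∀ i, Der 𝒜 ((single (.sum X) ⊹ Γ₂).set (inl Γ₂ (pt _)) (X i)) Δ₂) :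
      Conv (comp (inj (inr Δ₁ (pt _)) X (append_ty_inr _ _ _) k f)
          (cotuple (inl Γ₂ (pt _)) X (append_ty_inl _ _ _) g))
        (comp (renR (Iso.setLast Δ₁ _ (X k)) f) (renL (Iso.setFirst Γ₂ _ (X k)) (g k)))
  | tuple_cut_proj {Γ₁ Γ₂ Δ₁ Δ₂ : Ctx (Formula 𝒜.Obj)} {I : Type} [Finite I]
      (X : I → Formula 𝒜.Obj) (k : I)
      (f : ∀ i, Der 𝒜 Γ₁ ((Δ₁ ⊹ single (.prod X)).set (inr Δ₁ (pt _)) (X i)))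
      (g : Der 𝒜 ((single (.prod X) ⊹ Γ₂).set (inl Γ₂ (pt _)) (X k)) Δ₂) :
      Conv (comp (tuple (inr Δ₁ (pt _)) X (append_ty_inr _ _ _) f)
          (proj (inl Γ₂ (pt _)) X (append_ty_inl _ _ _) k g))
        (comp (renR (Iso.setLast Δ₁ _ (X k)) (f k)) (renL (Iso.setFirst Γ₂ _ (X k)) g))
  /- permuting conversions -/
  | cotuple_cotuple {Γ Δ : Ctx (Formula 𝒜.Obj)} {a b : Γ.Chan} (hab : a ≠ b)
      {I J : Type} [Finite I] [Finite J] (X : I → Formula 𝒜.Obj) (Y : J → Formula 𝒜.Obj)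
      (ha : Γ.ty a = .sum X) (hb : Γ.ty b = .sum Y)
      (f : ∀ i j, Der 𝒜 ((Γ.set a (X i)).set b (Y j)) Δ) :
      Conv (cotuple a X ha fun i => cotuple b Y ((set_ty_ne _ hab.symm _).trans hb) (f i))
        (cotuple b Y hb fun j => cotuple a X ((set_ty_ne _ hab _).trans ha) fun i =>
          renL (Iso.setComm Γ hab (X i) (Y j)) (f i j))
  | tuple_tuple {Γ Δ : Ctx (Formula 𝒜.Obj)} {a b : Δ.Chan} (hab : a ≠ b)
      {I J : Type} [Finite I] [Finite J] (X : I → Formula 𝒜.Obj) (Y : J → Formula 𝒜.Obj)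
      (ha : Δ.ty a = .prod X) (hb : Δ.ty b = .prod Y)
      (f : ∀ i j, Der 𝒜 Γ ((Δ.set a (X i)).set b (Y j))) :
      Conv (tuple a X ha fun i => tuple b Y ((set_ty_ne _ hab.symm _).trans hb) (f i))
        (tuple b Y hb fun j => tuple a X ((set_ty_ne _ hab _).trans ha) fun i =>
          renR (Iso.setComm Δ hab (X i) (Y j)) (f i j))
  | cotuple_inj {Γ Δ : Ctx (Formula 𝒜.Obj)} (a : Γ.Chan) (b : Δ.Chan)
      {I J : Type} [Finite I] [Finite J] (X : I → Formula 𝒜.Obj) (Y : J → Formula 𝒜.Obj)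
      (ha : Γ.ty a = .sum X) (hb : Δ.ty b = .sum Y) (k : J)
      (f : ∀ i, Der 𝒜 (Γ.set a (X i)) (Δ.set b (Y k))) :
      Conv (cotuple a X ha fun i => inj b Y hb k (f i)) (inj b Y hb k (cotuple a X ha f))
  | proj_tuple {Γ Δ : Ctx (Formula 𝒜.Obj)} (a : Γ.Chan) (b : Δ.Chan)
      {I J : Type} [Finite I] [Finite J] (X : I → Formula 𝒜.Obj) (Y : J → Formula 𝒜.Obj)
      (ha : Γ.ty a = .prod X) (hb : Δ.ty b = .prod Y) (k : I)
      (f : ∀ j, Der 𝒜 (Γ.set a (X k)) (Δ.set b (Y j))) :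
      Conv (proj a X ha k (tuple b Y hb f)) (tuple b Y hb fun j => proj a X ha k (f j))
  | cotuple_proj {Γ Δ : Ctx (Formula 𝒜.Obj)} {a b : Γ.Chan} (hab : a ≠ b)
      {I J : Type} [Finite I] [Finite J] (X : I → Formula 𝒜.Obj) (Y : J → Formula 𝒜.Obj)
      (ha : Γ.ty a = .sum X) (hb : Γ.ty b = .prod Y) (k : J)
      (f : ∀ i, Der 𝒜 ((Γ.set a (X i)).set b (Y k)) Δ) :
      Conv (cotuple a X ha fun i => proj b Y ((set_ty_ne _ hab.symm _).trans hb) k (f i))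
        (proj b Y hb k (cotuple a X ((set_ty_ne _ hab _).trans ha) fun i =>
          renL (Iso.setComm Γ hab (X i) (Y k)) (f i)))
  | inj_tuple {Γ Δ : Ctx (Formula 𝒜.Obj)} {a b : Δ.Chan} (hab : a ≠ b)
      {I J : Type} [Finite I] [Finite J] (X : I → Formula 𝒜.Obj) (Y : J → Formula 𝒜.Obj)
      (ha : Δ.ty a = .sum X) (hb : Δ.ty b = .prod Y) (k : I)
      (f : ∀ j, Der 𝒜 Γ ((Δ.set a (X k)).set b (Y j))) :
      Conv (inj a X ha k (tuple b Y ((set_ty_ne _ hab.symm _).trans hb) f))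
        (tuple b Y hb fun j => inj a X ((set_ty_ne _ hab _).trans ha) k
          (renR (Iso.setComm Δ hab (X k) (Y j)) (f j)))
  | cotuple_tuple {Γ Δ : Ctx (Formula 𝒜.Obj)} (a : Γ.Chan) (b : Δ.Chan)
      {I J : Type} [Finite I] [Finite J] (X : I → Formula 𝒜.Obj) (Y : J → Formula 𝒜.Obj)
      (ha : Γ.ty a = .sum X) (hb : Δ.ty b = .prod Y)
      (f : ∀ i j, Der 𝒜 (Γ.set a (X i)) (Δ.set b (Y j))) :
      Conv (cotuple a X ha fun i => tuple b Y hb fun j => f i j)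
        (tuple b Y hb fun j => cotuple a X ha fun i => f i j)
  | inj_inj {Γ Δ : Ctx (Formula 𝒜.Obj)} {a b : Δ.Chan} (hab : a ≠ b)
      {I J : Type} [Finite I] [Finite J] (X : I → Formula 𝒜.Obj) (Y : J → Formula 𝒜.Obj)
      (ha : Δ.ty a = .sum X) (hb : Δ.ty b = .sum Y) (k : I) (l : J)
      (f : Der 𝒜 Γ ((Δ.set a (X k)).set b (Y l))) :
      Conv (inj a X ha k (inj b Y ((set_ty_ne _ hab.symm _).trans hb) l f))
        (inj b Y hb l (inj a X ((set_ty_ne _ hab _).trans ha) k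
          (renR (Iso.setComm Δ hab (X k) (Y l)) f)))
  | proj_proj {Γ Δ : Ctx (Formula 𝒜.Obj)} {a b : Γ.Chan} (hab : a ≠ b)
      {I J : Type} [Finite I] [Finite J] (X : I → Formula 𝒜.Obj) (Y : J → Formula 𝒜.Obj)
      (ha : Γ.ty a = .prod X) (hb : Γ.ty b = .prod Y) (k : I) (l : J)
      (f : Der 𝒜 ((Γ.set a (X k)).set b (Y l)) Δ) :
      Conv (proj a X ha k (proj b Y ((set_ty_ne _ hab.symm _).trans hb) l f))
        (proj b Y hb l (proj a X ((set_ty_ne _ hab _).trans ha) k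
          (renL (Iso.setComm Γ hab (X k) (Y l)) f)))
  | proj_inj {Γ Δ : Ctx (Formula 𝒜.Obj)} (a : Γ.Chan) (b : Δ.Chan)
      {I J : Type} [Finite I] [Finite J] (X : I → Formula 𝒜.Obj) (Y : J → Formula 𝒜.Obj)
      (ha : Γ.ty a = .prod X) (hb : Δ.ty b = .sum Y) (k : I) (l : J)
      (f : Der 𝒜 (Γ.set a (X k)) (Δ.set b (Y l))) :
      Conv (proj a X ha k (inj b Y hb l f)) (inj b Y hb l (proj a X ha k f))

/-- `∼` as a setoid. -/
def convSetoid (𝒜 : SymPolycategory.{u, w}) (Γ Δ : Ctx (Formula 𝒜.Obj)) : Setoid (Der 𝒜 Γ Δ) :=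
  ⟨Conv, ⟨Conv.refl, Conv.symm, Conv.trans⟩⟩

end Der

/-- `ΣΠ_𝒜`: objects are the formulas, morphisms are the `∼`-equivalence classes of derivations,
identities are the classes of the identity derivations, composition is the cut rule, and
the permutations act by renaming of channels. -/
def SigmaPi (𝒜 : SymPolycategory.{u, w}) : PolyData.{max u 1, max u w 1} where
  Obj := Formula 𝒜.Obj
  Hom Γ Δ := Quotient (Der.convSetoid 𝒜 Γ Δ)
  id X := Quotient.mk _ (Der.iota X)
  act σ τ := Quotient.map (Der.ren σ τ) fun _ _ h => Der.Conv.congr_ren σ τ h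
  cut := Quotient.map₂ Der.comp fun _ _ hf _ _ hg => Der.Conv.congr_cut _ _ hf hg

/-!
The proof separates the permutations from the logic.

*Permutations.* A polymorphism is considered on a one-sided sequent, a finite set of channels with
polarities and objects (`Sequent`), as a family of values for all arrangements of the channels into
a domain and a codomain (`PolyData.Mor`). Once the action is functorial and the cut is equivariant,
such a family is given by one value, and cuts can be made at any channel. In this form associativity
and the two interchange laws are one law, `Mor.AssocAt`: the cuts of `y` with `x` and with `v` at
two different channels can be made in either order. The four choices of the polarities of these
channels give associativity (twice) and the two interchange laws. The two unit laws are likewise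
one law, `Mor.UnitAt`, and `Equivariant.isSymPolycategory` translates the two laws back.

*Logic.* On one-sided sequents there are two kinds of logical rules (`Move`): those with a premise
for each component (cotuple, tuple) and those that choose a component (projection, injection).
The cut-elimination reductions say that a rule away from the cut moves below it (`scut_rule_left`,
`scut_rule_right`), and that two rules that meet in a cut cancel (`scut_principal`); cuts of
axioms are computed in `𝒜` (`ofBase_scut`). Hence every class of derivations has a cut-free
representative (`cutElim`), and the laws need only be shown for cut-free morphisms.

For `AssocAt` this is an induction on the sum of the heights (`CutFree.assocAt`). If one of `x`,
`y`, `v` ends with a rule away from its cuts, both sides of the law commute with this rule. If the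
rules of `y` and `x`, or of `y` and `v`, meet, both sides reduce to matching premises. Otherwise all
three are axioms, since the principal formula of a rule is not an atom, and the law is that of `𝒜`.
As it is symmetric in `x` and `v`, half of these cases suffice.

For `UnitAt` the induction is on the formula and then on the height (`unitAt`). The identity of a
sum or product consists of two rules; against a rule at the cut channel one of them
cancels, the other reproduces that rule, and identities of components remain (`unitAt_rule_none`).
-/

/-! ### Permutations of contexts, on channels -/

namespace Ctx

variable {O : Type u} {O' : Type w}

namespace Iso

@[simp] theorem refl_equiv (Γ : Ctx O) (c : Γ.Chan) : (refl Γ).equiv c = c := rfl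

@[simp] theorem symm_equiv {Γ Δ : Ctx O} (σ : Iso Γ Δ) : σ.symm.equiv = σ.equiv.symm := rfl

@[simp] theorem trans_equiv {Γ Δ Θ : Ctx O} (σ : Iso Γ Δ) (τ : Iso Δ Θ) (c : Γ.Chan) :
    (σ.trans τ).equiv c = τ.equiv (σ.equiv c) := rfl

@[simp] theorem append_equiv_inl {Γ Γ' Δ Δ' : Ctx O} (σ : Iso Γ Γ') (τ : Iso Δ Δ') (a : Γ.Chan) :
    (σ.append τ).equiv (inl Δ a) = inl Δ' (σ.equiv a) := by
  simp [Iso.append]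

@[simp] theorem append_equiv_inr {Γ Γ' Δ Δ' : Ctx O} (σ : Iso Γ Γ') (τ : Iso Δ Δ') (b : Δ.Chan) :
    (σ.append τ).equiv (inr Γ b) = inr Γ' (τ.equiv b) := by
  simp [Iso.append]

@[simp] theorem assoc_equiv_inl_inl (Γ Δ Θ : Ctx O) (a : Γ.Chan) :
    (assoc Γ Δ Θ).equiv (inl Θ (inl Δ a)) = inl (Δ ⊹ Θ) a := by
  simp [Iso.assoc]

@[simp] theorem assoc_equiv_inl_inr (Γ Δ Θ : Ctx O) (a : Δ.Chan) :
    (assoc Γ Δ Θ).equiv (inl Θ (inr Γ a)) = inr Γ (inl Θ a) := by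
  simp [Iso.assoc]

@[simp] theorem assoc_equiv_inr (Γ Δ Θ : Ctx O) (a : Θ.Chan) :
    (assoc Γ Δ Θ).equiv (inr (Γ ⊹ Δ) a) = inr Γ (inr Δ a) := by
  simp [Iso.assoc]

@[simp] theorem assoc_symm_inl (Γ Δ Θ : Ctx O) (a : Γ.Chan) :
    (assoc Γ Δ Θ).equiv.symm (inl (Δ ⊹ Θ) a) = inl Θ (inl Δ a) := by
  rw [Equiv.symm_apply_eq, assoc_equiv_inl_inl]

@[simp] theorem assoc_symm_inr_inl (Γ Δ Θ : Ctx O) (a : Δ.Chan) :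
    (assoc Γ Δ Θ).equiv.symm (inr Γ (inl Θ a)) = inl Θ (inr Γ a) := by
  rw [Equiv.symm_apply_eq, assoc_equiv_inl_inr]

@[simp] theorem assoc_symm_inr_inr (Γ Δ Θ : Ctx O) (a : Θ.Chan) :
    (assoc Γ Δ Θ).equiv.symm (inr Γ (inr Δ a)) = inr (Γ ⊹ Δ) a := by
  rw [Equiv.symm_apply_eq, assoc_equiv_inr]

@[simp] theorem comm_equiv_inl (Γ Δ : Ctx O) (a : Γ.Chan) :
    (comm Γ Δ).equiv (inl Δ a) = inr Δ a := by
  simp [Iso.comm]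

@[simp] theorem comm_equiv_inr (Γ Δ : Ctx O) (a : Δ.Chan) :
    (comm Γ Δ).equiv (inr Γ a) = inl Γ a := by
  simp [Iso.comm]

@[simp] theorem rightComm_equiv_inl_inl (Γ Δ Θ : Ctx O) (a : Γ.Chan) :
    (rightComm Γ Δ Θ).equiv (inl Θ (inl Δ a)) = inl Δ (inl Θ a) := by
  simp [Iso.rightComm]

@[simp] theorem rightComm_equiv_inl_inr (Γ Δ Θ : Ctx O) (a : Δ.Chan) :
    (rightComm Γ Δ Θ).equiv (inl Θ (inr Γ a)) = inr (Γ ⊹ Θ) a := by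
  simp [Iso.rightComm]

@[simp] theorem rightComm_equiv_inr (Γ Δ Θ : Ctx O) (a : Θ.Chan) :
    (rightComm Γ Δ Θ).equiv (inr (Γ ⊹ Δ) a) = inl Δ (inr Γ a) := by
  simp [Iso.rightComm]

@[simp] theorem leftComm_equiv_inl (Γ Δ Θ : Ctx O) (a : Γ.Chan) :
    (leftComm Γ Δ Θ).equiv (inl (Δ ⊹ Θ) a) = inr Δ (inl Θ a) := by
  simp [Iso.leftComm]

@[simp] theorem leftComm_equiv_inr_inl (Γ Δ Θ : Ctx O) (a : Δ.Chan) :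
    (leftComm Γ Δ Θ).equiv (inr Γ (inl Θ a)) = inl (Γ ⊹ Θ) a := by
  simp [Iso.leftComm]

@[simp] theorem leftComm_equiv_inr_inr (Γ Δ Θ : Ctx O) (a : Θ.Chan) :
    (leftComm Γ Δ Θ).equiv (inr Γ (inr Δ a)) = inr Δ (inr Γ a) := by
  simp [Iso.leftComm]

@[simp] theorem nilAppend_equiv_inr (Γ : Ctx O) (a : Γ.Chan) :
    (nilAppend Γ).equiv (inr nil a) = a := by
  rw [nilAppend, Equiv.trans_apply, sumEquiv_symm_inr]; rfl

@[simp] theorem nilAppend_symm (Γ : Ctx O) (a : Γ.Chan) :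
    (nilAppend Γ).equiv.symm a = inr nil a := by
  rw [Equiv.symm_apply_eq, nilAppend_equiv_inr]

@[simp] theorem appendNil_equiv_inl (Γ : Ctx O) (a : Γ.Chan) :
    (appendNil Γ).equiv (inl nil a) = a := by
  rw [appendNil, Equiv.trans_apply, sumEquiv_symm_inl]; rfl

@[simp] theorem appendNil_symm (Γ : Ctx O) (a : Γ.Chan) :
    (appendNil Γ).equiv.symm a = inl nil a := by
  rw [Equiv.symm_apply_eq, appendNil_equiv_inl]

@[simp] theorem mapAppend_equiv_inl (F : O → O') (Γ Δ : Ctx O) (a : Γ.Chan) :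
    (mapAppend F Γ Δ).equiv (inl Δ a) = inl (Δ.map F) (Γ := Γ.map F) a := by
  rw [mapAppend, Equiv.trans_apply, sumEquiv_symm_inl]; rfl

@[simp] theorem mapAppend_equiv_inr (F : O → O') (Γ Δ : Ctx O) (a : Δ.Chan) :
    (mapAppend F Γ Δ).equiv (inr Γ a) = inr (Γ.map F) (Δ := Δ.map F) a := by
  rw [mapAppend, Equiv.trans_apply, sumEquiv_symm_inr]; rfl

@[simp] theorem setAppendLeft_equiv (Γ Δ : Ctx O) (a : Γ.Chan) (x : O)
    (c : (Γ.set a x ⊹ Δ).Chan) : (setAppendLeft Γ Δ a x).equiv c = c := by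
  induction c using append_cases with
  | hl c => rw [setAppendLeft, Equiv.trans_apply, sumEquiv_symm_inl]; rfl
  | hr c => rw [setAppendLeft, Equiv.trans_apply, sumEquiv_symm_inr]; rfl

@[simp] theorem setAppendRight_equiv (Γ Δ : Ctx O) (a : Δ.Chan) (x : O)
    (c : (Γ ⊹ Δ.set a x).Chan) : (setAppendRight Γ Δ a x).equiv c = c := by
  induction c using append_cases with
  | hl c => rw [setAppendRight, Equiv.trans_apply, sumEquiv_symm_inl]; rfl
  | hr c => rw [setAppendRight, Equiv.trans_apply, sumEquiv_symm_inr]; rfl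

@[simp] theorem setLast_equiv (Δ : Ctx O) (z x : O)
    (c : ((Δ ⊹ Ctx.single z).set (inr Δ (pt z)) x).Chan) : (setLast Δ z x).equiv c = c := by
  have h : ∀ c : (Δ ⊹ (Ctx.single z).set (pt z) x).Chan,
      ((refl Δ).append (setSingle z x)).equiv c = c := by
    intro c
    induction c using append_cases with
    | hl a => exact append_equiv_inl _ _ _
    | hr a => exact append_equiv_inr _ _ _
  exact (h _).trans ((Equiv.symm_apply_eq _).2 (setAppendRight_equiv _ _ _ _ _).symm)

@[simp] theorem setFirst_equiv (Γ : Ctx O) (z x : O)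
    (c : ((Ctx.single z ⊹ Γ).set (inl Γ (pt z)) x).Chan) : (setFirst Γ z x).equiv c = c := by
  have h : ∀ c : ((Ctx.single z).set (pt z) x ⊹ Γ).Chan,
      ((setSingle z x).append (refl Γ)).equiv c = c := by
    intro c
    induction c using append_cases with
    | hl a => exact append_equiv_inl _ _ _
    | hr a => exact append_equiv_inr _ _ _
  exact (h _).trans ((Equiv.symm_apply_eq _).2 (setAppendLeft_equiv _ _ _ _ _).symm)

/-- Replacing the last entry of `Δ, z` by `x` gives `Δ, y`, for `x = y`. -/
def setLastOfEq (Δ : Ctx O) (z : O) {x y : O} (h : x = y) :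
    Iso ((Δ ⊹ Ctx.single z).set (inr Δ (pt z)) x) (Δ ⊹ Ctx.single y) :=
  ⟨Equiv.refl _, fun c => by
    subst h
    have := (setLast Δ z x).ty_eq c
    rwa [setLast_equiv] at this⟩

/-- Replacing the first entry of `z, Γ` by `x` gives `y, Γ`, for `x = y`. -/
def setFirstOfEq (Γ : Ctx O) (z : O) {x y : O} (h : x = y) :
    Iso ((Ctx.single z ⊹ Γ).set (inl Γ (pt z)) x) (Ctx.single y ⊹ Γ) :=
  ⟨Equiv.refl _, fun c => by
    subst h
    have := (setFirst Γ z x).ty_eq c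
    rwa [setFirst_equiv] at this⟩

theorem ext_apply {Γ Δ : Ctx O} {σ τ : Iso Γ Δ} (h : ∀ c, σ.equiv c = τ.equiv c) : σ = τ :=
  Iso.ext (Equiv.ext h)

end Iso

end Ctx

/-! ### One-sided sequents -/

/-- A sequent in one-sided form: a finite set of channels without an order, each with a polarity
(`false` for the domain, `true` for the codomain) and an object. -/
structure Sequent (O : Type u) where
  Chan : Type
  [finite : Finite Chan]
  pol : Chan → Bool
  ty : Chan → O

namespace Sequent

variable {O : Type u}

attribute [instance] Sequent.finite

/-- A renaming of channels, preserving polarities and objects. -/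
@[ext]
structure Iso (S T : Sequent O) where
  equiv : S.Chan ≃ T.Chan
  pol_eq : ∀ c, T.pol (equiv c) = S.pol c
  ty_eq : ∀ c, T.ty (equiv c) = S.ty c

attribute [simp] Iso.pol_eq Iso.ty_eq

/-- The sequent `S` with a new channel `none`, of polarity `b` and object `x`. -/
abbrev cons (b : Bool) (x : O) (S : Sequent O) : Sequent O :=
  ⟨Option S.Chan, fun c => c.elim b S.pol, fun c => c.elim x S.ty⟩

/-- The channels of `S` together with those of `T`. -/
abbrev append (S T : Sequent O) : Sequent O :=
  ⟨S.Chan ⊕ T.Chan, Sum.elim S.pol T.pol, Sum.elim S.ty T.ty⟩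

/-- The sequent with one channel. -/
abbrev single (b : Bool) (x : O) : Sequent O := ⟨Unit, fun _ => b, fun _ => x⟩

open Classical in
/-- Replacement of the object at a channel; the channels stay the same. -/
noncomputable abbrev set (S : Sequent O) (c : S.Chan) (x : O) : Sequent O :=
  ⟨S.Chan, S.pol, Function.update S.ty c x⟩

/-- The image of a sequent under a map of objects. -/
abbrev map {O' : Type w} (F : O → O') (S : Sequent O) : Sequent O' := ⟨S.Chan, S.pol, F ∘ S.ty⟩

open Classical in
theorem set_ty_self (S : Sequent O) (c : S.Chan) (x : O) : (S.set c x).ty c = x :=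
  Function.update_self c x S.ty

open Classical in
theorem set_ty_ne (S : Sequent O) {c d : S.Chan} (h : d ≠ c) (x : O) :
    (S.set c x).ty d = S.ty d :=
  Function.update_of_ne h x S.ty

namespace Iso

/-- The identity renaming. -/
def refl (S : Sequent O) : Iso S S := ⟨Equiv.refl _, fun _ => rfl, fun _ => rfl⟩

/-- The inverse renaming. -/
def symm {S T : Sequent O} (i : Iso S T) : Iso T S :=
  ⟨i.equiv.symm, fun c => by rw [← i.pol_eq, Equiv.apply_symm_apply],
    fun c => by rw [← i.ty_eq, Equiv.apply_symm_apply]⟩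

/-- The composite renaming. -/
def trans {S T U : Sequent O} (i : Iso S T) (j : Iso T U) : Iso S U :=
  ⟨i.equiv.trans j.equiv, fun c => by simp, fun c => by simp⟩

@[simp] theorem refl_equiv (S : Sequent O) (c : S.Chan) : (refl S).equiv c = c := rfl

@[simp] theorem symm_equiv {S T : Sequent O} (i : Iso S T) : i.symm.equiv = i.equiv.symm := rfl

@[simp] theorem trans_equiv {S T U : Sequent O} (i : Iso S T) (j : Iso T U) (c : S.Chan) :
    (i.trans j).equiv c = j.equiv (i.equiv c) := rfl

theorem ext_apply {S T : Sequent O} {i j : Iso S T} (h : ∀ c, i.equiv c = j.equiv c) : i = j :=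
  Iso.ext (Equiv.ext h)

/-- A renaming extended by the identity on a new channel. -/
def cons {S T : Sequent O} (b : Bool) (x : O) (i : Iso S T) : Iso (S.cons b x) (T.cons b x) :=
  ⟨Equiv.optionCongr i.equiv, by rintro (_ | c) <;> simp, by rintro (_ | c) <;> simp⟩

/-- Two renamings side by side. -/
def append {S S' T T' : Sequent O} (i : Iso S S') (j : Iso T T') :
    Iso (S.append T) (S'.append T') :=
  ⟨Equiv.sumCongr i.equiv j.equiv, by rintro (c | c) <;> simp, by rintro (c | c) <;> simp⟩

/-- Exchange of two groups of channels. -/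
def comm (S T : Sequent O) : Iso (S.append T) (T.append S) :=
  ⟨Equiv.sumComm _ _, by rintro (c | c) <;> rfl, by rintro (c | c) <;> rfl⟩

/-- Re-bracketing of three groups of channels. -/
def assoc (S T U : Sequent O) : Iso ((S.append T).append U) (S.append (T.append U)) :=
  ⟨Equiv.sumAssoc _ _ _, by rintro ((c | c) | c) <;> rfl, by rintro ((c | c) | c) <;> rfl⟩

/-- Exchange of two new channels. -/
def consCons (b : Bool) (x : O) (b' : Bool) (x' : O) (S : Sequent O) :
    Iso ((S.cons b' x').cons b x) ((S.cons b x).cons b' x') :=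
  ⟨⟨fun c => match c with
      | none => some none
      | some none => none
      | some (some c) => some (some c),
    fun c => match c with
      | none => some none
      | some none => none
      | some (some c) => some (some c),
    by rintro (_ | _ | c) <;> rfl, by rintro (_ | _ | c) <;> rfl⟩,
    by rintro (_ | _ | c) <;> rfl, by rintro (_ | _ | c) <;> rfl⟩

/-- A new channel of the second of two groups, as a new channel of both together. -/
def appendCons (b : Bool) (x : O) (S T : Sequent O) :
    Iso (S.append (T.cons b x)) ((S.append T).cons b x) :=
  ⟨⟨fun c => match c with
      | .inl c => some (.inl c)
      | .inr none => none
      | .inr (some c) => some (.inr c),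
    fun c => match c with
      | none => .inr none
      | some (.inl c) => .inl c
      | some (.inr c) => .inr (some c),
    by rintro (c | _ | c) <;> rfl, by rintro (_ | c | c) <;> rfl⟩,
    by rintro (c | _ | c) <;> rfl, by rintro (c | _ | c) <;> rfl⟩

/-- A new channel of the first of two groups, as a new channel of both together. -/
def consAppend (b : Bool) (x : O) (S T : Sequent O) :
    Iso ((S.cons b x).append T) ((S.append T).cons b x) :=
  ⟨⟨fun c => match c with
      | .inr c => some (.inr c)
      | .inl none => none
      | .inl (some c) => some (.inl c),
    fun c => match c with
      | none => .inl none
      | some (.inl c) => .inl (some c)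
      | some (.inr c) => .inr c,
    by rintro ((_ | c) | c) <;> rfl, by rintro (_ | c | c) <;> rfl⟩,
    by rintro ((_ | c) | c) <;> rfl, by rintro ((_ | c) | c) <;> rfl⟩

/-- A new channel, as a group of its own. -/
def consSingle (b : Bool) (x : O) (S : Sequent O) : Iso (S.cons b x) (S.append (single b x)) :=
  ⟨⟨fun c => match c with
      | none => .inr ()
      | some c => .inl c,
    fun c => match c with
      | .inr () => none
      | .inl c => some c,
    by rintro (_ | c) <;> rfl, by rintro (c | c) <;> rfl⟩,
    by rintro (_ | c) <;> rfl, by rintro (_ | c) <;> rfl⟩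

/-- A renaming that takes the channel `c` to `d`, after replacement of the objects at both. The
proof of `i.equiv c = d` is an argument, so that `d` can be written in simplified form. -/
noncomputable def set {S T : Sequent O} (i : Iso S T) {c : S.Chan} {d : T.Chan}
    (h : i.equiv c = d) (x : O) : Iso (S.set c x) (T.set d x) :=
  ⟨i.equiv, i.pol_eq, fun (e : S.Chan) => by
    subst h
    by_cases h : e = c
    · rw [h]; exact (set_ty_self _ _ _).trans (set_ty_self _ _ _).symm
    · exact (set_ty_ne T (fun h' => h (i.equiv.injective h')) _).trans
        ((i.ty_eq e).trans (set_ty_ne S h _).symm)⟩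

/-- Replacement at an old channel commutes with adding a new one. -/
noncomputable def setConsSome (b : Bool) (x : O) (S : Sequent O) (c : S.Chan) (y : O) :
    Iso ((S.cons b x).set (some c) y) ((S.set c y).cons b x) :=
  ⟨Equiv.refl _, fun _ => rfl, fun d => by
    rcases d with _ | d
    · exact (set_ty_ne (S.cons b x) (c := some c) (d := none) (by simp) _).symm
    · by_cases h : (d : S.Chan) = c
      · rw [h]; exact (set_ty_self S _ _).trans (set_ty_self (S.cons b x) _ _).symm
      · exact (set_ty_ne S h _).trans (set_ty_ne (S.cons b x) (c := some c) (d := some d)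
          (by simpa using h) _).symm⟩

/-- Replacement at the new channel `none` changes only its object. -/
noncomputable def setConsNone (b : Bool) (x : O) (S : Sequent O) {y y' : O} (h : y = y') :
    Iso ((S.cons b x).set none y) (S.cons b y') :=
  ⟨Equiv.refl _, fun _ => rfl, fun d => by
    subst h
    rcases d with _ | d
    · exact (set_ty_self (S.cons b x) _ _).symm
    · exact (set_ty_ne (S.cons b x) (c := none) (d := some d) (by simp) _).symm⟩

/-- Replacement in the first of two groups of channels. -/
noncomputable def setAppendLeft (S T : Sequent O) (c : S.Chan) (x : O) :
    Iso ((S.set c x).append T) ((S.append T).set (.inl c) x) :=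
  ⟨Equiv.refl _, fun _ => rfl, fun d => by
    rcases d with d | d
    · by_cases h : (d : S.Chan) = c
      · rw [h]; exact (set_ty_self (S.append T) _ _).trans (set_ty_self S _ _).symm
      · exact (set_ty_ne (S.append T) (c := .inl c) (d := .inl d)
          (by simpa using h) _).trans (set_ty_ne S h _).symm
    · exact set_ty_ne (S.append T) (c := .inl c) (d := .inr d) (by simp) _⟩

/-- Replacement in the second of two groups of channels. -/
noncomputable def setAppendRight (S T : Sequent O) (c : T.Chan) (x : O) :
    Iso (S.append (T.set c x)) ((S.append T).set (.inr c) x) :=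
  ⟨Equiv.refl _, fun _ => rfl, fun d => by
    rcases d with d | d
    · exact set_ty_ne (S.append T) (c := .inr c) (d := .inl d) (by simp) _
    · by_cases h : (d : T.Chan) = c
      · rw [h]; exact (set_ty_self (S.append T) _ _).trans (set_ty_self T _ _).symm
      · exact (set_ty_ne (S.append T) (c := .inr c) (d := .inr d)
          (by simpa using h) _).trans (set_ty_ne T h _).symm⟩

/-- A renaming of the images under a map of objects. -/
def map {O' : Type w} (F : O → O') {S T : Sequent O} (i : Iso S T) : Iso (S.map F) (T.map F) :=
  ⟨i.equiv, i.pol_eq, fun c => congrArg F (i.ty_eq c)⟩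

/-- The image of a sequent with a new channel. -/
def mapCons {O' : Type w} (F : O → O') (b : Bool) (x : O) (S : Sequent O) :
    Iso ((S.cons b x).map F) ((S.map F).cons b (F x)) :=
  ⟨Equiv.refl _, fun _ => rfl, by rintro (_ | c) <;> rfl⟩

/-- The image of two groups of channels. -/
def mapAppend {O' : Type w} (F : O → O') (S T : Sequent O) :
    Iso ((S.append T).map F) ((S.map F).append (T.map F)) :=
  ⟨Equiv.refl _, fun _ => rfl, by rintro (c | c) <;> rfl⟩

end Iso

/-- In the sequent with two channels, both of object `z`, both objects are replaced by `x`, one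
after the other. -/
noncomputable def Iso.setPair (b b' : Bool) (z x : O) {c₀ c₁ : Option Unit}
    (h : ∀ d, d = c₀ ∨ d = c₁) :
    Iso ((single b x).cons b' x) ((((single b z).cons b' z).set c₀ x).set c₁ x) :=
  ⟨Equiv.refl _, fun _ => rfl, fun d => by
    change ((((single b z).cons b' z).set c₀ x).set c₁ x).ty d = _
    by_cases hd : (d : Option Unit) = c₁
    · rw [hd]; exact (set_ty_self _ _ _).trans (by cases c₁ <;> rfl)
    · refine (set_ty_ne (((single b z).cons b' z).set c₀ x) hd _).trans ?_
      obtain rfl : d = c₀ := (h d).resolve_right hd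
      exact (set_ty_self _ _ _).trans (by cases d <;> rfl)⟩

/-- Replacement of the only object of a sequent. -/
noncomputable def Iso.setSingle (b : Bool) (z x : O) :
    Iso (single b x) ((single b z).set () x) :=
  ⟨Equiv.refl _, fun _ => rfl, fun _ => set_ty_self (single b z) () x⟩

/-- A sequent all of whose entries are in the image of `F` is the image of a sequent. -/
theorem exists_eq_map {O' : Type w} (F : O → O') (S : Sequent O') (h : ∀ c, ∃ x, S.ty c = F x) :
    ∃ R : Sequent O, S = R.map F := by
  obtain ⟨C, pol, ty⟩ := S
  have hty : ∃ r : C → O, ty = F ∘ r :=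
    ⟨fun c => (h c).choose, funext fun c => (h c).choose_spec⟩
  obtain ⟨r, rfl⟩ := hty
  exact ⟨⟨C, pol, r⟩, rfl⟩

/-- A renaming of the images under an injective map of objects comes from a renaming. -/
def Iso.ofMap {O' : Type w} {F : O → O'} (hF : Function.Injective F) {R S : Sequent O}
    (i : (R.map F).Iso (S.map F)) : R.Iso S :=
  ⟨i.equiv, i.pol_eq, fun c => hF (i.ty_eq c)⟩

/-! ### Arrangements of a sequent -/

/-- An arrangement of the channels of polarity `false` of a sequent into a string `ctx false`, and
of those of polarity `true` into a string `ctx true`: it turns the one-sided sequent into an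
ordered two-sided one. -/
structure Arr (S : Sequent O) where
  ctx : Bool → Ctx O
  chan : ∀ b, (ctx b).Chan → S.Chan
  inj : ∀ b, Function.Injective (chan b)
  surj : ∀ b c, S.pol c = b → ∃ a, chan b a = c
  pol_chan : ∀ b a, S.pol (chan b a) = b
  ty_chan : ∀ b a, S.ty (chan b a) = (ctx b).ty a

attribute [simp] Arr.pol_chan Arr.ty_chan

namespace Arr

instance (S : Sequent O) : Nonempty S.Arr :=
  ⟨{ ctx := fun b => ⟨Nat.card {c // S.pol c = b},
       fun a => S.ty ((Finite.equivFin {c // S.pol c = b}).symm a).1⟩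
     chan := fun b a => ((Finite.equivFin {c // S.pol c = b}).symm a).1
     inj := fun _ _ _ h => (Finite.equivFin _).symm.injective (Subtype.ext h)
     surj := fun _ c h => ⟨Finite.equivFin _ ⟨c, h⟩, by simp⟩
     pol_chan := fun _ a => ((Finite.equivFin _).symm a).2
     ty_chan := fun _ _ => rfl }⟩

/-- The arrangement transported along a renaming. -/
abbrev comap {S T : Sequent O} (i : S.Iso T) (p : T.Arr) : S.Arr where
  ctx := p.ctx
  chan b a := i.equiv.symm (p.chan b a)
  inj b := i.equiv.symm.injective.comp (p.inj b)
  surj b c h := by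
    obtain ⟨a, ha⟩ := p.surj b (i.equiv c) (by simpa using h)
    exact ⟨a, by simp [ha]⟩
  pol_chan b a := by rw [← i.pol_eq]; simp
  ty_chan b a := by rw [← i.ty_eq]; simp

/-- The permutation between two arrangements of the same sequent. -/
noncomputable def iso {S : Sequent O} (p q : S.Arr) (b : Bool) : (p.ctx b).Iso (q.ctx b) where
  equiv :=
    { toFun := fun a => (q.surj b (p.chan b a) (p.pol_chan b a)).choose
      invFun := fun a => (p.surj b (q.chan b a) (q.pol_chan b a)).choose
      left_inv := fun a => p.inj b <| by
        rw [(p.surj b (q.chan b _) (q.pol_chan b _)).choose_spec,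
          (q.surj b (p.chan b _) (p.pol_chan b _)).choose_spec]
      right_inv := fun a => q.inj b <| by
        rw [(q.surj b (p.chan b _) (p.pol_chan b _)).choose_spec,
          (p.surj b (q.chan b _) (q.pol_chan b _)).choose_spec] }
  ty_eq a := by
    have h := (q.surj b (p.chan b a) (by rw [Arr.pol_chan])).choose_spec
    simp only [Equiv.coe_fn_mk]
    rw [← q.ty_chan, h, p.ty_chan]

@[simp] theorem chan_iso {S : Sequent O} (p q : S.Arr) (b : Bool) (a : (p.ctx b).Chan) :
    q.chan b ((p.iso q b).equiv a) = p.chan b a :=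
  (q.surj b (p.chan b a) (by rw [Arr.pol_chan])).choose_spec

theorem iso_unique {S : Sequent O} (p q : S.Arr) (b : Bool) {σ τ : (p.ctx b).Iso (q.ctx b)}
    (hσ : ∀ a, q.chan b (σ.equiv a) = p.chan b a) (hτ : ∀ a, q.chan b (τ.equiv a) = p.chan b a) :
    σ = τ :=
  Ctx.Iso.ext_apply fun a => q.inj b ((hσ a).trans (hτ a).symm)

open Ctx in
/-- An arrangement of `S` followed by one of `T`. -/
abbrev append {S T : Sequent O} (p : S.Arr) (q : T.Arr) : (S.append T).Arr where
  ctx b := p.ctx b ⊹ q.ctx b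
  chan b a := Sum.map (p.chan b) (q.chan b) ((sumEquiv _ _).symm a)
  inj b := (Sum.map_injective.2 ⟨p.inj b, q.inj b⟩).comp (sumEquiv _ _).symm.injective
  surj b c h := by
    rcases c with c | c
    · obtain ⟨a, rfl⟩ := p.surj b c h
      exact ⟨inl _ a, by simp⟩
    · obtain ⟨a, rfl⟩ := q.surj b c h
      exact ⟨inr _ a, by simp⟩
  pol_chan b a := by
    induction a using append_cases <;> simp
  ty_chan b a := by
    induction a using append_cases <;> simp

open Ctx in
@[simp] theorem append_chan_inl {S T : Sequent O} (p : S.Arr) (q : T.Arr) (b : Bool)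
    (a : (p.ctx b).Chan) : (p.append q).chan b (inl (q.ctx b) a) = .inl (p.chan b a) := by
  simp

open Ctx in
@[simp] theorem append_chan_inr {S T : Sequent O} (p : S.Arr) (q : T.Arr) (b : Bool)
    (a : (q.ctx b).Chan) : (p.append q).chan b (inr (p.ctx b) a) = .inr (q.chan b a) := by
  simp

open Ctx in
/-- The new channel is placed last in the codomain, where `cut` expects it. By
`Bool.rec` both contexts reduce to their values. -/
abbrev consTrue {S : Sequent O} (x : O) (p : S.Arr) : (S.cons true x).Arr where
  ctx := Bool.rec (p.ctx false) (p.ctx true ⊹ Ctx.single x)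
  chan := Bool.rec (fun a => some (p.chan false a))
    (fun a => Sum.elim (fun a => some (p.chan true a)) (fun _ => none) ((sumEquiv _ _).symm a))
  inj := Bool.rec (fun a a' h => p.inj false (Option.some.inj h)) (by
    intro a a' h
    induction a using append_cases <;> induction a' using append_cases <;> simp at h
    · rw [p.inj _ h]
    · exact congrArg _ (Subsingleton.elim (α := Fin 1) _ _))
  surj := by
    rintro (_ | _) (_ | c) h
    · simp at h
    · obtain ⟨a, rfl⟩ := p.surj _ c h
      exact ⟨a, rfl⟩
    · exact ⟨inr _ (pt x), by simp⟩
    · obtain ⟨a, rfl⟩ := p.surj _ c h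
      exact ⟨inl _ a, by simp⟩
  pol_chan := Bool.rec (fun a => by simp) (fun a => by induction a using append_cases <;> simp)
  ty_chan := Bool.rec (fun a => by simp) (fun a => by induction a using append_cases <;> simp)

open Ctx in
/-- The new channel is placed first in the domain, where `cut` expects it. -/
abbrev consFalse {S : Sequent O} (x : O) (p : S.Arr) : (S.cons false x).Arr where
  ctx := Bool.rec (Ctx.single x ⊹ p.ctx false) (p.ctx true)
  chan := Bool.rec
    (fun a => Sum.elim (fun _ => none) (fun a => some (p.chan false a)) ((sumEquiv _ _).symm a))
    (fun a => some (p.chan true a))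
  inj := Bool.rec (by
    intro a a' h
    induction a using append_cases <;> induction a' using append_cases <;> simp at h
    · exact congrArg _ (Subsingleton.elim (α := Fin 1) _ _)
    · rw [p.inj _ h]) (fun a a' h => p.inj true (Option.some.inj h))
  surj := by
    rintro (_ | _) (_ | c) h
    · exact ⟨inl _ (pt x), by simp⟩
    · obtain ⟨a, rfl⟩ := p.surj _ c h
      exact ⟨inr _ a, by simp⟩
    · simp at h
    · obtain ⟨a, rfl⟩ := p.surj _ c h
      exact ⟨a, rfl⟩
  pol_chan := Bool.rec (fun a => by induction a using append_cases <;> simp) (fun a => by simp)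
  ty_chan := Bool.rec (fun a => by induction a using append_cases <;> simp) (fun a => by simp)

section
open Ctx

variable {S : Sequent O} (x : O) (p : S.Arr)

@[simp] theorem consTrue_chan_false (a : (p.ctx false).Chan) :
    (p.consTrue x).chan false a = some (p.chan false a) := rfl

@[simp] theorem consTrue_chan_inl (a : (p.ctx true).Chan) :
    (p.consTrue x).chan true (inl (Ctx.single x) a) = some (p.chan true a) := by
  simp

@[simp] theorem consTrue_chan_inr (a : (Ctx.single x).Chan) :
    (p.consTrue x).chan true (inr (p.ctx true) a) = none := by
  simp

@[simp] theorem consFalse_chan_true (a : (p.ctx true).Chan) :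
    (p.consFalse x).chan true a = some (p.chan true a) := rfl

@[simp] theorem consFalse_chan_inr (a : (p.ctx false).Chan) :
    (p.consFalse x).chan false (inr (Ctx.single x) a) = some (p.chan false a) := by
  simp

@[simp] theorem consFalse_chan_inl (a : (Ctx.single x).Chan) :
    (p.consFalse x).chan false (inl (p.ctx false) a) = none := by
  simp

end

/-- The same arrangement, after replacement of an object in the domain. -/
abbrev setFalse {S : Sequent O} (p : S.Arr) (c : S.Chan) (a : (p.ctx false).Chan)
    (ha : p.chan false a = c) (x : O) : (S.set c x).Arr where
  ctx := Bool.rec ((p.ctx false).set a x) (p.ctx true)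
  chan := Bool.rec (p.chan false) (p.chan true)
  inj := Bool.rec (p.inj false) (p.inj true)
  surj := Bool.rec (p.surj false) (p.surj true)
  pol_chan := Bool.rec (p.pol_chan false) (p.pol_chan true)
  ty_chan := by
    subst ha
    rintro (_ | _) (d : (p.ctx _).Chan)
    · by_cases h : d = a
      · rw [h]; exact (set_ty_self S _ _).trans (Ctx.set_ty_self _ _ _).symm
      · exact (set_ty_ne S (fun h' => h (p.inj _ h')) _).trans
          ((p.ty_chan _ _).trans (Ctx.set_ty_ne _ h _).symm)
    · refine (set_ty_ne S (fun h' => ?_) _).trans (p.ty_chan _ _)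
      have := congrArg S.pol h'
      simp at this

/-- The same arrangement, after replacement of an object in the codomain. -/
abbrev setTrue {S : Sequent O} (p : S.Arr) (c : S.Chan) (a : (p.ctx true).Chan)
    (ha : p.chan true a = c) (x : O) : (S.set c x).Arr where
  ctx := Bool.rec (p.ctx false) ((p.ctx true).set a x)
  chan := Bool.rec (p.chan false) (p.chan true)
  inj := Bool.rec (p.inj false) (p.inj true)
  surj := Bool.rec (p.surj false) (p.surj true)
  pol_chan := Bool.rec (p.pol_chan false) (p.pol_chan true)
  ty_chan := by
    subst ha
    rintro (_ | _) (d : (p.ctx _).Chan)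
    · refine (set_ty_ne S (fun h' => ?_) _).trans (p.ty_chan _ _)
      have := congrArg S.pol h'
      simp at this
    · by_cases h : d = a
      · rw [h]; exact (set_ty_self S _ _).trans (Ctx.set_ty_self _ _ _).symm
      · exact (set_ty_ne S (fun h' => h (p.inj _ h')) _).trans
          ((p.ty_chan _ _).trans (Ctx.set_ty_ne _ h _).symm)

/-- The same arrangement of the image of the sequent under a map of objects. -/
abbrev map {O' : Type w} (F : O → O') {S : Sequent O} (p : S.Arr) : (S.map F).Arr where
  ctx b := (p.ctx b).map F
  chan := p.chan
  inj := p.inj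
  surj := p.surj
  pol_chan := p.pol_chan
  ty_chan b a := congrArg F (p.ty_chan b a)

/-- The channels of a sequent are those of its domain and those of its codomain. -/
noncomputable def chanEquiv {S : Sequent O} (p : S.Arr) :
    (p.ctx false).Chan ⊕ (p.ctx true).Chan ≃ S.Chan :=
  Equiv.ofBijective (Sum.elim (p.chan false) (p.chan true)) <| by
    constructor
    · rintro (a | a) (a' | a') h
      · exact congrArg _ (p.inj _ h)
      · have := congrArg S.pol h
        simp at this
      · have := congrArg S.pol h
        simp at this
      · exact congrArg _ (p.inj _ h)
    · intro c
      rcases (S.pol c).eq_false_or_eq_true with h | h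
      · obtain ⟨a, ha⟩ := p.surj _ c h
        exact ⟨.inr a, ha⟩
      · obtain ⟨a, ha⟩ := p.surj _ c h
        exact ⟨.inl a, ha⟩

/-- The renaming of channels given by permutations between two arrangements. -/
noncomputable def seqIso {S T : Sequent O} (p : S.Arr) (q : T.Arr)
    (σ : (p.ctx false).Iso (q.ctx false)) (τ : (p.ctx true).Iso (q.ctx true)) : S.Iso T where
  equiv := p.chanEquiv.symm.trans ((Equiv.sumCongr σ.equiv τ.equiv).trans q.chanEquiv)
  pol_eq c := by
    obtain ⟨a | a, rfl⟩ := p.chanEquiv.surjective c <;>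
      rw [Equiv.trans_apply, Equiv.symm_apply_apply]
    · exact (q.pol_chan false _).trans (p.pol_chan false a).symm
    · exact (q.pol_chan true _).trans (p.pol_chan true a).symm
  ty_eq c := by
    obtain ⟨a | a, rfl⟩ := p.chanEquiv.surjective c <;>
      rw [Equiv.trans_apply, Equiv.symm_apply_apply]
    · exact ((q.ty_chan false _).trans (σ.ty_eq a)).trans (p.ty_chan false a).symm
    · exact ((q.ty_chan true _).trans (τ.ty_eq a)).trans (p.ty_chan true a).symm

theorem seqIso_chan_false {S T : Sequent O} (p : S.Arr) (q : T.Arr)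
    (σ : (p.ctx false).Iso (q.ctx false)) (τ : (p.ctx true).Iso (q.ctx true))
    (a : (p.ctx false).Chan) :
    (p.seqIso q σ τ).equiv (p.chan false a) = q.chan false (σ.equiv a) :=
  congrArg (fun d => q.chanEquiv (Equiv.sumCongr σ.equiv τ.equiv d))
    (p.chanEquiv.symm_apply_apply (.inl a))

theorem seqIso_chan_true {S T : Sequent O} (p : S.Arr) (q : T.Arr)
    (σ : (p.ctx false).Iso (q.ctx false)) (τ : (p.ctx true).Iso (q.ctx true))
    (a : (p.ctx true).Chan) :
    (p.seqIso q σ τ).equiv (p.chan true a) = q.chan true (τ.equiv a) :=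
  congrArg (fun d => q.chanEquiv (Equiv.sumCongr σ.equiv τ.equiv d))
    (p.chanEquiv.symm_apply_apply (.inr a))

/-- The sequent with the domain `Γ` and the codomain `Δ`, arranged in this way. -/
abbrev ofCtx (Γ Δ : Ctx O) :
    Arr (⟨Γ.Chan ⊕ Δ.Chan, Sum.elim (fun _ => false) (fun _ => true), Sum.elim Γ.ty Δ.ty⟩) where
  ctx := Bool.rec Γ Δ
  chan := Bool.rec Sum.inl Sum.inr
  inj := Bool.rec Sum.inl_injective Sum.inr_injective
  surj := by
    rintro (_ | _) (c | c) h
    · exact ⟨c, rfl⟩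
    · simp at h
    · simp at h
    · exact ⟨c, rfl⟩
  pol_chan := Bool.rec (fun _ => rfl) (fun _ => rfl)
  ty_chan := Bool.rec (fun _ => rfl) (fun _ => rfl)

/-- The arrangement `x ⊢ x` of two channels of opposite polarity. -/
abbrev pair {b b' : Bool} (hb : b' = !b) (x : O) : Arr ((single b x).cons b' x) where
  ctx _ := Ctx.single x
  chan c _ := if c = b then some () else none
  inj _ _ _ _ := Subsingleton.elim (α := Fin 1) _ _
  surj := by
    subst hb
    rintro c (_ | c) h
    · exact ⟨Ctx.pt x, by subst h; simp⟩
    · exact ⟨Ctx.pt x, by subst h; simp⟩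
  pol_chan c a := by subst hb; cases b <;> cases c <;> rfl
  ty_chan c a := by cases b <;> cases c <;> rfl

/-- The arrangement of a single channel: one side is empty. -/
abbrev single (b : Bool) (x : O) : Arr (Sequent.single b x) where
  ctx b' := if b' = b then Ctx.single x else Ctx.nil
  chan _ _ := ()
  inj b' := by
    by_cases h : b' = b
    · subst h; rw [if_pos rfl]; intro _ _ _; exact Subsingleton.elim (α := Fin 1) _ _
    · rw [if_neg h]; intro a; exact Fin.elim0 a
  surj b' c h := by
    subst h; rw [if_pos rfl]; exact ⟨Ctx.pt x, rfl⟩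
  pol_chan b' a := by
    cases b <;> cases b' <;> first | rfl | exact Fin.elim0 a
  ty_chan b' a := by
    cases b <;> cases b' <;> first | rfl | exact Fin.elim0 a

end Arr

end Sequent

open Ctx (inl inr append_cases)

/-! ### Polymorphisms on unordered channels -/

namespace PolyData

/-- The part of the axioms of a symmetric polycategory that concerns the permutations: the action
is functorial and the cut is equivariant. -/
class Equivariant (P : PolyData.{u, w}) : Prop where
  act_refl : ∀ {Γ Δ : Ctx P.Obj} (f : P.Hom Γ Δ), P.act (.refl Γ) (.refl Δ) f = f
  act_act : ∀ {Γ Γ' Γ'' Δ Δ' Δ'' : Ctx P.Obj} (σ : Γ.Iso Γ') (σ' : Γ'.Iso Γ'')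
    (τ : Δ.Iso Δ') (τ' : Δ'.Iso Δ'') (f : P.Hom Γ Δ),
    P.act σ' τ' (P.act σ τ f) = P.act (σ.trans σ') (τ.trans τ') f
  cut_act : ∀ {Γ₁ Γ₁' Γ₂ Γ₂' Δ₁ Δ₁' Δ₂ Δ₂' : Ctx P.Obj} {x : P.Obj}
    (σ₁ : Γ₁.Iso Γ₁') (τ₁ : Δ₁.Iso Δ₁') (σ₂ : Γ₂.Iso Γ₂') (τ₂ : Δ₂.Iso Δ₂')
    (f : P.Hom Γ₁ (Δ₁ ⊹ Ctx.single x)) (g : P.Hom (Ctx.single x ⊹ Γ₂) Δ₂),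
    P.cut (P.act σ₁ (τ₁.append (.refl (Ctx.single x))) f)
        (P.act ((Ctx.Iso.refl (Ctx.single x)).append σ₂) τ₂ g) =
      P.act (σ₁.append σ₂) (τ₁.append τ₂) (P.cut f g)

theorem IsSymPolycategory.equivariant {P : PolyData.{u, w}} (h : P.IsSymPolycategory) :
    P.Equivariant :=
  ⟨h.act_refl, h.act_act, h.cut_act⟩

/-- A polymorphism on a one-sided sequent: a polymorphism for every arrangement of the channels,
compatible with the action of permutations. Under `Equivariant` it is determined by its value at
one arrangement, which can be prescribed (`ext_at`, `ofVal`). For such families the renamings of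
`act` disappear from the laws, and associativity and both interchange laws become one law. -/
structure Mor (P : PolyData.{u, w}) (S : Sequent P.Obj) where
  val : ∀ p : S.Arr, P.Hom (p.ctx false) (p.ctx true)
  act_val : ∀ (p q : S.Arr) (σ : (p.ctx false).Iso (q.ctx false))
    (τ : (p.ctx true).Iso (q.ctx true)),
    (∀ a, q.chan false (σ.equiv a) = p.chan false a) →
    (∀ a, q.chan true (τ.equiv a) = p.chan true a) → P.act σ τ (val p) = val q

namespace Mor

variable {P : PolyData.{u, w}} {S S' T T' U : Sequent P.Obj}

theorem ext {x y : P.Mor S} (h : ∀ p, x.val p = y.val p) : x = y := by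
  cases x; cases y
  congr
  exact funext h

/-- Renaming of the channels. -/
def ren (i : S.Iso T) (x : P.Mor S) : P.Mor T where
  val p := x.val (p.comap i)
  act_val p q σ τ hσ hτ := x.act_val (p.comap i) (q.comap i) σ τ
    (fun a => congrArg i.equiv.symm (hσ a)) (fun a => congrArg i.equiv.symm (hτ a))

/-- The value of a renamed polymorphism at an arrangement of the new sequent, computed from an
arrangement of the old one. -/
theorem ren_val (i : S.Iso T) (p : S.Arr) (q : T.Arr) (σ : (p.ctx false).Iso (q.ctx false))
    (τ : (p.ctx true).Iso (q.ctx true))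
    (hσ : ∀ a, q.chan false (σ.equiv a) = i.equiv (p.chan false a))
    (hτ : ∀ a, q.chan true (τ.equiv a) = i.equiv (p.chan true a)) (x : P.Mor S) :
    (x.ren i).val q = P.act σ τ (x.val p) :=
  (x.act_val p (q.comap i) σ τ (fun a => (i.equiv.symm_apply_eq).2 (hσ a))
    (fun a => (i.equiv.symm_apply_eq).2 (hτ a))).symm

theorem ext_at (p : S.Arr) {x y : P.Mor S} (h : x.val p = y.val p) : x = y := by
  refine ext fun q => ?_
  rw [← x.act_val p q (p.iso q false) (p.iso q true) (by simp) (by simp), h,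
    y.act_val p q (p.iso q false) (p.iso q true) (by simp) (by simp)]

theorem ext_iff_at (p : S.Arr) {x y : P.Mor S} : x = y ↔ x.val p = y.val p :=
  ⟨fun h => by rw [h], ext_at p⟩

@[simp] theorem ren_ren (i : S.Iso T) (j : T.Iso U) (x : P.Mor S) :
    (x.ren i).ren j = x.ren (i.trans j) := rfl

@[simp] theorem ren_refl (x : P.Mor S) : x.ren (.refl S) = x := rfl

theorem ren_congr {i j : S.Iso T} (h : ∀ c, i.equiv c = j.equiv c) (x : P.Mor S) :
    x.ren i = x.ren j := by
  rw [Sequent.Iso.ext_apply h]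

theorem ren_injective (i : S.Iso T) {x y : P.Mor S} (h : x.ren i = y.ren i) : x = y := by
  have := congrArg (ren i.symm) h
  have e : i.trans i.symm = .refl S := Sequent.Iso.ext_apply (by simp)
  rwa [ren_ren, ren_ren, e, ren_refl, ren_refl] at this

variable [P.Equivariant]

/-- The polymorphism with a given value at one arrangement. -/
noncomputable def ofVal (p : S.Arr) (f : P.Hom (p.ctx false) (p.ctx true)) : P.Mor S where
  val q := P.act (p.iso q false) (p.iso q true) f
  act_val q r σ τ hσ hτ := by
    rw [Equivariant.act_act]
    congr 1
    · exact p.iso_unique r false (by simp [hσ]) (by simp)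
    · exact p.iso_unique r true (by simp [hτ]) (by simp)

@[simp] theorem ofVal_val (p : S.Arr) (f : P.Hom (p.ctx false) (p.ctx true)) :
    (ofVal p f).val p = f := by
  have h b : p.iso p b = .refl _ := p.iso_unique p b (by simp) (by simp)
  change P.act _ _ f = f
  rw [h, h, Equivariant.act_refl]

theorem ofVal_val_of_act (p q : S.Arr) (σ : (p.ctx false).Iso (q.ctx false))
    (τ : (p.ctx true).Iso (q.ctx true)) (hσ : ∀ a, q.chan false (σ.equiv a) = p.chan false a)
    (hτ : ∀ a, q.chan true (τ.equiv a) = p.chan true a) (f : P.Hom (p.ctx false) (p.ctx true)) :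
    (ofVal p f).val q = P.act σ τ f := by
  rw [← (ofVal p f).act_val p q σ τ hσ hτ, ofVal_val]

theorem ofVal_act (p : S.Arr) (q : T.Arr) (σ : (p.ctx false).Iso (q.ctx false))
    (τ : (p.ctx true).Iso (q.ctx true)) (f : P.Hom (p.ctx false) (p.ctx true)) :
    ofVal q (P.act σ τ f) = (ofVal p f).ren (p.seqIso q σ τ) := by
  apply ext_at q
  rw [ofVal_val, ren_val (p.seqIso q σ τ) p q σ τ
    (fun a => (p.seqIso_chan_false q σ τ a).symm) (fun a => (p.seqIso_chan_true q σ τ a).symm),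
    ofVal_val]

/-- The cut of `x` and `y` on their new channels. -/
noncomputable def cut {z : P.Obj} (x : P.Mor (S.cons true z)) (y : P.Mor (T.cons false z)) :
    P.Mor (S.append T) :=
  ofVal ((Classical.arbitrary S.Arr).append (Classical.arbitrary T.Arr))
    (P.cut (x.val (.consTrue z _)) (y.val (.consFalse z _)))

theorem cut_val {z : P.Obj} (x : P.Mor (S.cons true z)) (y : P.Mor (T.cons false z))
    (p : S.Arr) (q : T.Arr) :
    (cut x y).val (p.append q) = P.cut (x.val (p.consTrue z)) (y.val (q.consFalse z)) := by
  have e b (p p' : S.Arr) (q q' : T.Arr) (a) : (p'.append q').chan b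
      (((p.iso p' b).append (q.iso q' b)).equiv a) = (p.append q).chan b a := by
    induction a using append_cases <;> simp
  rw [cut, ofVal_val_of_act _ _ (.append (Sequent.Arr.iso _ p false) (Sequent.Arr.iso _ q false))
    (.append (Sequent.Arr.iso _ p true) (Sequent.Arr.iso _ q true)) (e _ _ _ _ _) (e _ _ _ _ _)]
  refine (Equivariant.cut_act _ _ _ _ _ _).symm.trans ?_
  congr 1
  · exact x.act_val (.consTrue z _) (.consTrue z _) _ _ (by simp [Sequent.Arr.consTrue])
      (fun a => by induction a using append_cases <;> simp)
  · exact y.act_val (.consFalse z _) (.consFalse z _) _ _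
      (fun a => by induction a using append_cases <;> simp) (by simp [Sequent.Arr.consFalse])

/-- The cut of `x` and `y` on their new channels, of opposite polarities, in either direction. -/
noncomputable def scut : ∀ {b b' : Bool} (_ : b' = !b) {z : P.Obj}
    (_ : P.Mor (S.cons b z)) (_ : P.Mor (T.cons b' z)), P.Mor (S.append T)
  | true, _, rfl, _, x, y => cut x y
  | false, _, rfl, _, x, y => (cut y x).ren (.comm T S)

theorem scut_symm {b b' : Bool} (h : b' = !b) (h' : b = !b') {z : P.Obj}
    (x : P.Mor (S.cons b z)) (y : P.Mor (T.cons b' z)) :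
    scut h' y x = (scut h x y).ren (.comm S T) := by
  subst h
  cases b
  · exact (ren_refl _).symm.trans (congrArg (fun i => ren i _)
      (Sequent.Iso.ext_apply (i := .refl (T.append S))
        (j := (Sequent.Iso.comm T S).trans (.comm S T))
        (fun c => by cases c <;> rfl)))
  · rfl

/-- Renaming and then cutting is cutting and then renaming. -/
theorem cut_ren {z : P.Obj} (i : S.Iso S') (j : T.Iso T') (x : P.Mor (S.cons true z))
    (y : P.Mor (T.cons false z)) :
    cut (x.ren (i.cons true z)) (y.ren (j.cons false z)) = (cut x y).ren (i.append j) := by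
  let p := Classical.arbitrary S'.Arr
  let q := Classical.arbitrary T'.Arr
  apply ext_at (p.append q)
  rw [cut_val]
  refine Eq.trans ?_ (Eq.symm ((ren_val _ ((p.comap i).append (q.comap j)) (p.append q)
    (.refl _) (.refl _) (fun a => ?_) (fun a => ?_) _).trans
    ((Equivariant.act_refl _).trans (cut_val _ _ _ _))))
  · congr 1
    · refine (ren_val _ ((p.comap i).consTrue z) (p.consTrue z) (.refl _) (.refl _) (fun a => ?_)
        (fun a => ?_) x).trans (Equivariant.act_refl _)
      · simp [Sequent.Iso.cons]
      · induction a using append_cases <;> simp [Sequent.Iso.cons]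
    · refine (ren_val _ ((q.comap j).consFalse z) (q.consFalse z) (.refl _) (.refl _) (fun a => ?_)
        (fun a => ?_) y).trans (Equivariant.act_refl _)
      · induction a using append_cases <;> simp [Sequent.Iso.cons]
      · simp [Sequent.Iso.cons]
  · induction a using append_cases <;> simp [Sequent.Iso.append]
  · induction a using append_cases <;> simp [Sequent.Iso.append]

theorem scut_ren {b b' : Bool} (h : b' = !b) {z : P.Obj} (i : S.Iso S') (j : T.Iso T')
    (x : P.Mor (S.cons b z)) (y : P.Mor (T.cons b' z)) :
    scut h (x.ren (i.cons b z)) (y.ren (j.cons b' z)) = (scut h x y).ren (i.append j) := by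
  subst h
  cases b
  · change (cut (y.ren (j.cons true z)) (x.ren (i.cons false z))).ren (.comm T' S') =
      ((cut y x).ren (.comm T S)).ren (i.append j)
    rw [cut_ren, ren_ren, ren_ren]
    exact congrArg (fun i => ren i _) (Sequent.Iso.ext_apply (by rintro (c | c) <;> rfl))
  · exact cut_ren i j x y

omit [P.Equivariant] in
theorem ren_cons_refl {b : Bool} {z : P.Obj} (x : P.Mor (S.cons b z)) :
    x.ren (Sequent.Iso.cons b z (.refl S)) = x :=
  (congrArg (fun i => ren i x) (Sequent.Iso.ext_apply (j := .refl _)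
    (by rintro (_ | c) <;> rfl))).trans (ren_refl x)

theorem scut_ren_left {b b' : Bool} (h : b' = !b) {z : P.Obj} (i : S.Iso S')
    (x : P.Mor (S.cons b z)) (y : P.Mor (T.cons b' z)) :
    scut h (x.ren (i.cons b z)) y = (scut h x y).ren (i.append (.refl T)) := by
  rw [← scut_ren, ren_cons_refl]

theorem scut_ren_right {b b' : Bool} (h : b' = !b) {z : P.Obj} (j : T.Iso T')
    (x : P.Mor (S.cons b z)) (y : P.Mor (T.cons b' z)) :
    scut h x (y.ren (j.cons b' z)) = (scut h x y).ren (.append (.refl S) j) := by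
  rw [← scut_ren, ren_cons_refl]

end Mor

end PolyData

/-! ### The laws of a symmetric polycategory on unordered channels -/

namespace PolyData

variable {P : PolyData.{u, w}} [P.Equivariant] {S T U : Sequent P.Obj}

theorem Equivariant.act_eq_iff {Γ Γ' Δ Δ' : Ctx P.Obj} (σ : Γ.Iso Γ') (τ : Δ.Iso Δ')
    (f : P.Hom Γ Δ) (g : P.Hom Γ' Δ') : P.act σ τ f = g ↔ f = P.act σ.symm τ.symm g := by
  have e {Γ Δ : Ctx P.Obj} (σ : Γ.Iso Δ) : σ.trans σ.symm = .refl _ :=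
    Ctx.Iso.ext_apply (by simp)
  have e' {Γ Δ : Ctx P.Obj} (σ : Γ.Iso Δ) : σ.symm.trans σ = .refl _ :=
    Ctx.Iso.ext_apply (by simp)
  constructor
  · rintro rfl
    rw [Equivariant.act_act, e, e, Equivariant.act_refl]
  · rintro rfl
    rw [Equivariant.act_act, e', e', Equivariant.act_refl]

namespace Mor

/-- The associativity law for cuts of `y` with `x` and with `v` on two different channels of `y`.
With the polarities of these channels it is associativity of the cut (`assocAt_true_true`) or one
of the interchange laws (`assocAt_true_false`, `assocAt_false_true`). -/
def AssocAt {b b' c c' : Bool} (hb : b' = !b) (hc : c' = !c) {z t : P.Obj}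
    (x : P.Mor (S.cons b z)) (y : P.Mor ((T.cons c t).cons b' z)) (v : P.Mor (U.cons c' t)) :
    Prop :=
  (scut hc ((scut hb x y).ren (.appendCons c t S T)) v).ren (.assoc S T U) =
    scut hb x ((scut hc (y.ren (.consCons b' z c t T)) v).ren (.consAppend b' z T U))

/-- The associativity law is symmetric in the outer polymorphisms `x` and `v`. -/
theorem assocAt_symm {b b' c c' : Bool} (hb : b' = !b) (hc : c' = !c) (hb' : b = !b')
    (hc' : c = !c') {z t : P.Obj}
    (x : P.Mor (S.cons b z)) (y : P.Mor ((T.cons c t).cons b' z)) (v : P.Mor (U.cons c' t))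
    (h : AssocAt hc' hb' v (y.ren (.consCons b' z c t T)) x) : AssocAt hb hc x y v := by
  have e : (y.ren (.consCons b' z c t T)).ren (.consCons c t b' z T) = y := by
    rw [ren_ren]
    exact (congrArg (fun i => ren i y) (Sequent.Iso.ext_apply (j := .refl _)
      (by rintro (_ | _ | c) <;> rfl))).trans (ren_refl y)
  have e1 : scut hb' ((scut hc' v (y.ren (.consCons b' z c t T))).ren (.appendCons b' z U T)) x =
      (scut hb x ((scut hc (y.ren (.consCons b' z c t T)) v).ren (.consAppend b' z T U))).ren
        ((Sequent.Iso.append (.refl S) (.comm T U)).trans (.comm S (U.append T))) := by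
    rw [scut_symm hc hc', scut_symm hb hb', ← ren_ren, ← scut_ren, ren_cons_refl, ren_ren, ren_ren]
    exact congrArg (fun i => ren _ (scut hb x (ren i _))) (Sequent.Iso.ext_apply
      (by rintro ((_ | c) | c) <;> rfl))
  have e2 : scut hc' v ((scut hb' y x).ren (.consAppend c t T S)) =
      (scut hc ((scut hb x y).ren (.appendCons c t S T)) v).ren
        ((Sequent.Iso.append (.comm S T) (.refl U)).trans (.comm (T.append S) U)) := by
    rw [scut_symm hb hb', scut_symm hc hc', ← ren_ren, ← scut_ren, ren_cons_refl, ren_ren, ren_ren]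
    exact congrArg (fun i => ren _ (scut hc (ren i _) v)) (Sequent.Iso.ext_apply
      (by rintro (c | _ | c) <;> rfl))
  unfold AssocAt at h ⊢
  rw [e, e1, e2, ren_ren] at h
  refine ren_injective ((Sequent.Iso.append (.refl S) (.comm T U)).trans
    ((Sequent.Iso.comm S (U.append T)).trans (.assoc U T S))) ?_
  rw [ren_ren]
  refine Eq.trans ?_ h.symm
  exact congrArg (fun i => ren i _) (Sequent.Iso.ext_apply (by rintro ((c | c) | c) <;> rfl))

/-- If `y` is cut with `x` at its domain and with `v` at its codomain, the associativity law is
associativity of the cut. -/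
theorem assocAt_true_true {z t : P.Obj} (x : P.Mor (S.cons true z))
    (y : P.Mor ((T.cons true t).cons false z)) (v : P.Mor (U.cons false t))
    (p : S.Arr) (q : T.Arr) (r : U.Arr) :
    AssocAt rfl rfl x y v ↔
      P.act (.assoc _ _ _) (.assoc _ _ _) (P.cut (P.act (.refl _) (Ctx.Iso.assoc _ _ _).symm
        (P.cut (x.val (p.consTrue z)) (y.val ((q.consTrue t).consFalse z))))
        (v.val (r.consFalse t))) =
      P.cut (x.val (p.consTrue z)) (P.act (.assoc _ _ _) (.refl _)
        (P.cut (y.val ((q.consTrue t).consFalse z)) (v.val (r.consFalse t)))) := by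
  have e1 : ((scut rfl x y).ren (.appendCons true t S T)).val ((p.append q).consTrue t) =
      P.act (.refl _) (Ctx.Iso.assoc _ _ _).symm
        (P.cut (x.val (p.consTrue z)) (y.val ((q.consTrue t).consFalse z))) := by
    refine (ren_val _ (p.append (q.consTrue t)) ((p.append q).consTrue t)
      (.refl _) (Ctx.Iso.assoc _ _ _).symm (fun a => ?_) (fun a => ?_) _).trans ?_
    · induction a using append_cases <;> simp [Sequent.Iso.appendCons]
    · induction a using append_cases with
      | hl a => simp [Sequent.Iso.appendCons]
      | hr a => induction a using append_cases <;> simp [Sequent.Iso.appendCons]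
    · exact congrArg _ (cut_val _ _ _ _)
  have e2 : (y.ren (.consCons false z true t T)).val ((q.consFalse z).consTrue t) =
      y.val ((q.consTrue t).consFalse z) := by
    refine (ren_val _ ((q.consTrue t).consFalse z) ((q.consFalse z).consTrue t)
      (.refl _) (.refl _) (fun a => ?_) (fun a => ?_) _).trans (Equivariant.act_refl _)
    · induction a using append_cases <;> simp [Sequent.Iso.consCons]
    · induction a using append_cases <;> simp [Sequent.Iso.consCons]
  have e3 : ((scut rfl (y.ren (.consCons false z true t T)) v).ren
      (.consAppend false z T U)).val ((q.append r).consFalse z) =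
      P.act (.assoc _ _ _) (.refl _)
        (P.cut (y.val ((q.consTrue t).consFalse z)) (v.val (r.consFalse t))) := by
    refine (ren_val _ ((q.consFalse z).append r) ((q.append r).consFalse z)
      (.assoc _ _ _) (.refl _) (fun a => ?_) (fun a => ?_) _).trans ?_
    · induction a using append_cases with
      | hr a => simp [Sequent.Iso.consAppend]
      | hl a => induction a using append_cases <;> simp [Sequent.Iso.consAppend]
    · induction a using append_cases <;> simp [Sequent.Iso.consAppend]
    · exact congrArg _ ((cut_val _ _ _ _).trans (by rw [e2]))
  have e4 : ((scut rfl ((scut rfl x y).ren (.appendCons true t S T)) v).ren (.assoc S T U)).val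
      (p.append (q.append r)) = P.act (.assoc _ _ _) (.assoc _ _ _)
      (P.cut (P.act (.refl _) (Ctx.Iso.assoc _ _ _).symm
        (P.cut (x.val (p.consTrue z)) (y.val ((q.consTrue t).consFalse z))))
        (v.val (r.consFalse t))) := by
    refine (ren_val _ ((p.append q).append r) (p.append (q.append r))
      (.assoc _ _ _) (.assoc _ _ _) (fun a => ?_) (fun a => ?_) _).trans ?_
    · induction a using append_cases with
      | hr a => simp [Sequent.Iso.assoc]
      | hl a => induction a using append_cases <;> simp [Sequent.Iso.assoc]
    · induction a using append_cases with
      | hr a => simp [Sequent.Iso.assoc]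
      | hl a => induction a using append_cases <;> simp [Sequent.Iso.assoc]
    · exact congrArg _ ((cut_val _ _ _ _).trans (by rw [e1]))
  have e5 := (cut_val x ((scut rfl (y.ren (.consCons false z true t T)) v).ren
      (.consAppend false z T U)) p (q.append r))
  rw [e3] at e5
  rw [AssocAt, ext_iff_at (p.append (q.append r)), e4]
  exact Eq.congr_right e5

/-- The interchange of two cuts in the domain. -/
theorem assocAt_true_false {z t : P.Obj} (x : P.Mor (S.cons true z))
    (y : P.Mor ((T.cons false t).cons false z)) (v : P.Mor (U.cons true t))
    (p : S.Arr) (q : T.Arr) (r : U.Arr) :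
    AssocAt rfl rfl x y v ↔
      P.act (.leftComm _ _ _) (.leftComm _ _ _) (P.cut (x.val (p.consTrue z))
        (P.act (.leftComm _ _ _) (.refl _) (P.cut (v.val (r.consTrue t))
          (P.act (.leftComm _ _ _) (.refl _) (y.val ((q.consFalse t).consFalse z)))))) =
      P.cut (v.val (r.consTrue t)) (P.act (.leftComm _ _ _) (.refl _)
        (P.cut (x.val (p.consTrue z)) (y.val ((q.consFalse t).consFalse z)))) := by
  have e1 : ((scut rfl x y).ren (.appendCons false t S T)).val ((p.append q).consFalse t) =
      P.act (.leftComm _ _ _) (.refl _)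
        (P.cut (x.val (p.consTrue z)) (y.val ((q.consFalse t).consFalse z))) := by
    refine (ren_val _ (p.append (q.consFalse t)) ((p.append q).consFalse t)
      (.leftComm _ _ _) (.refl _) (fun a => ?_) (fun a => ?_) _).trans ?_
    · induction a using append_cases with
      | hl a => simp [Sequent.Iso.appendCons]
      | hr a => induction a using append_cases <;> simp [Sequent.Iso.appendCons]
    · induction a using append_cases <;> simp [Sequent.Iso.appendCons]
    · exact congrArg _ (cut_val _ _ _ _)
  have e2 : (y.ren (.consCons false z false t T)).val ((q.consFalse z).consFalse t) =
      P.act (.leftComm _ _ _) (.refl _) (y.val ((q.consFalse t).consFalse z)) := by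
    refine ren_val _ ((q.consFalse t).consFalse z) ((q.consFalse z).consFalse t)
      (.leftComm _ _ _) (.refl _) (fun a => ?_) (fun a => ?_) _
    · induction a using append_cases with
      | hl a => simp [Sequent.Iso.consCons]
      | hr a => induction a using append_cases <;> simp [Sequent.Iso.consCons]
    · simp [Sequent.Iso.consCons]
  have e3 : ((scut rfl (y.ren (.consCons false z false t T)) v).ren
      (.consAppend false z T U)).val (((r.append q).comap (.comm T U)).consFalse z) =
      P.act (.leftComm _ _ _) (.refl _) (P.cut (v.val (r.consTrue t))
          (P.act (.leftComm _ _ _) (.refl _) (y.val ((q.consFalse t).consFalse z)))) := by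
    refine (ren_val ((Sequent.Iso.comm _ _).trans (.consAppend false z T U))
      (r.append (q.consFalse z)) (((r.append q).comap (.comm T U)).consFalse z)
      (.leftComm _ _ _) (.refl _) (fun a => ?_) (fun a => ?_) (cut v _)).trans ?_
    · induction a using append_cases with
      | hl a => simp [Sequent.Iso.consAppend, Sequent.Iso.comm, Sequent.Iso.trans]
      | hr a =>
        induction a using append_cases <;>
          simp [Sequent.Iso.consAppend, Sequent.Iso.comm, Sequent.Iso.trans]
    · induction a using append_cases <;>
        simp [Sequent.Iso.consAppend, Sequent.Iso.comm, Sequent.Iso.trans]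
    · exact congrArg _ ((cut_val _ _ _ _).trans (by rw [e2]))
  let i : (S.append (T.append U)).Iso (U.append (S.append T)) :=
    (Sequent.Iso.assoc S T U).symm.trans (.comm _ _)
  have e4 : ((scut rfl ((scut rfl x y).ren (.appendCons false t S T)) v).ren (.assoc S T U)).val
      ((r.append (p.append q)).comap i) =
      P.cut (v.val (r.consTrue t)) (P.act (.leftComm _ _ _) (.refl _)
        (P.cut (x.val (p.consTrue z)) (y.val ((q.consFalse t).consFalse z)))) := by
    refine (ren_val ((Sequent.Iso.comm _ _).trans (.assoc S T U)) (r.append (p.append q))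
      ((r.append (p.append q)).comap i) (.refl _) (.refl _) (fun a => ?_) (fun a => ?_)
      (cut v _)).trans ((Equivariant.act_refl _).trans ((cut_val _ _ _ _).trans (by rw [e1])))
    · rfl
    · rfl
  have e5 : (scut rfl x ((scut rfl (y.ren (.consCons false z false t T)) v).ren
      (.consAppend false z T U))).val ((r.append (p.append q)).comap i) =
      P.act (.leftComm _ _ _) (.leftComm _ _ _) (P.cut (x.val (p.consTrue z))
        (P.act (.leftComm _ _ _) (.refl _) (P.cut (v.val (r.consTrue t))
          (P.act (.leftComm _ _ _) (.refl _) (y.val ((q.consFalse t).consFalse z)))))) := by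
    refine (ren_val (.refl _) (p.append ((r.append q).comap (.comm T U)))
      ((r.append (p.append q)).comap i) (.leftComm _ _ _) (.leftComm _ _ _) (fun a => ?_)
      (fun a => ?_) (cut x _)).trans (congrArg _ ((cut_val _ _ _ _).trans (by rw [e3])))
    · induction a using append_cases with
      | hl a => simp [i, Sequent.Iso.assoc, Sequent.Iso.comm, Sequent.Iso.trans,
            Sequent.Iso.refl, Sequent.Iso.symm]
      | hr a =>
        induction a using append_cases <;>
          simp [i, Sequent.Iso.assoc, Sequent.Iso.comm, Sequent.Iso.trans,
            Sequent.Iso.refl, Sequent.Iso.symm]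
    · induction a using append_cases with
      | hl a => simp [i, Sequent.Iso.assoc, Sequent.Iso.comm, Sequent.Iso.trans,
            Sequent.Iso.refl, Sequent.Iso.symm]
      | hr a =>
        induction a using append_cases <;>
          simp [i, Sequent.Iso.assoc, Sequent.Iso.comm, Sequent.Iso.trans,
            Sequent.Iso.refl, Sequent.Iso.symm]
  rw [AssocAt, ext_iff_at ((r.append (p.append q)).comap i)]
  exact (Eq.congr e4 e5).trans eq_comm

/-- The interchange of two cuts in the codomain. -/
theorem assocAt_false_true {z t : P.Obj} (x : P.Mor (S.cons false z))
    (y : P.Mor ((T.cons true t).cons true z)) (v : P.Mor (U.cons false t))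
    (p : S.Arr) (q : T.Arr) (r : U.Arr) :
    AssocAt rfl rfl x y v ↔
      P.act (.rightComm _ _ _) (.rightComm _ _ _)
      (P.cut (P.act (.refl _) (.rightComm _ _ _)
        (P.cut (P.act (.refl _) (.rightComm _ _ _) (y.val ((q.consTrue t).consTrue z)))
          (v.val (r.consFalse t)))) (x.val (p.consFalse z))) =
      P.cut (P.act (.refl _) (.rightComm _ _ _)
        (P.cut (y.val ((q.consTrue t).consTrue z)) (x.val (p.consFalse z))))
        (v.val (r.consFalse t)) := by
  have e1 : ((scut rfl x y).ren (.appendCons true t S T)).val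
      (((q.append p).comap (.comm S T)).consTrue t) =
      P.act (.refl _) (.rightComm _ _ _)
        (P.cut (y.val ((q.consTrue t).consTrue z)) (x.val (p.consFalse z))) := by
    refine (ren_val ((Sequent.Iso.comm _ _).trans (.appendCons true t S T))
      ((q.consTrue t).append p) (((q.append p).comap (.comm S T)).consTrue t)
      (.refl _) (.rightComm _ _ _) (fun a => ?_) (fun a => ?_) (cut y x)).trans
      (congrArg _ (cut_val _ _ _ _))
    · induction a using append_cases <;>
        simp [Sequent.Iso.appendCons, Sequent.Iso.comm, Sequent.Iso.trans]
    · induction a using append_cases with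
      | hr a => simp [Sequent.Iso.appendCons, Sequent.Iso.comm, Sequent.Iso.trans]
      | hl a =>
        induction a using append_cases <;>
          simp [Sequent.Iso.appendCons, Sequent.Iso.comm, Sequent.Iso.trans]
  have e2 : (y.ren (.consCons true z true t T)).val ((q.consTrue z).consTrue t) =
      P.act (.refl _) (.rightComm _ _ _) (y.val ((q.consTrue t).consTrue z)) := by
    refine ren_val _ ((q.consTrue t).consTrue z) ((q.consTrue z).consTrue t)
      (.refl _) (.rightComm _ _ _) (fun a => ?_) (fun a => ?_) _
    · simp [Sequent.Iso.consCons]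
    · induction a using append_cases with
      | hr a => simp [Sequent.Iso.consCons]
      | hl a => induction a using append_cases <;> simp [Sequent.Iso.consCons]
  have e3 : ((scut rfl (y.ren (.consCons true z true t T)) v).ren
      (.consAppend true z T U)).val ((q.append r).consTrue z) =
      P.act (.refl _) (.rightComm _ _ _)
        (P.cut (P.act (.refl _) (.rightComm _ _ _) (y.val ((q.consTrue t).consTrue z)))
          (v.val (r.consFalse t))) := by
    refine (ren_val (.consAppend true z T U) ((q.consTrue z).append r) ((q.append r).consTrue z)
      (.refl _) (.rightComm _ _ _) (fun a => ?_) (fun a => ?_) _).trans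
      (congrArg _ ((cut_val _ _ _ _).trans (by rw [e2])))
    · induction a using append_cases <;> simp [Sequent.Iso.consAppend]
    · induction a using append_cases with
      | hr a => simp [Sequent.Iso.consAppend]
      | hl a => induction a using append_cases <;> simp [Sequent.Iso.consAppend]
  let i : (S.append (T.append U)).Iso ((T.append S).append U) :=
    (Sequent.Iso.assoc S T U).symm.trans (.append (.comm _ _) (.refl _))
  have e4 : ((scut rfl ((scut rfl x y).ren (.appendCons true t S T)) v).ren (.assoc S T U)).val
      (((q.append p).append r).comap i) =
      P.cut (P.act (.refl _) (.rightComm _ _ _)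
        (P.cut (y.val ((q.consTrue t).consTrue z)) (x.val (p.consFalse z))))
        (v.val (r.consFalse t)) := by
    refine (ren_val (.assoc S T U) (((q.append p).comap (.comm S T)).append r)
      (((q.append p).append r).comap i) (.refl _) (.refl _) (fun a => ?_) (fun a => ?_)
      _).trans ((Equivariant.act_refl _).trans ((cut_val _ _ _ _).trans (by rw [e1])))
    · induction a using append_cases with
      | hr a => simp [i, Sequent.Iso.assoc, Sequent.Iso.comm, Sequent.Iso.append, Sequent.Iso.trans,
            Sequent.Iso.refl, Sequent.Iso.symm]
      | hl a =>
        induction a using append_cases <;>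
          simp [i, Sequent.Iso.assoc, Sequent.Iso.comm, Sequent.Iso.append, Sequent.Iso.trans,
            Sequent.Iso.refl, Sequent.Iso.symm]
    · induction a using append_cases with
      | hr a => simp [i, Sequent.Iso.assoc, Sequent.Iso.comm, Sequent.Iso.append, Sequent.Iso.trans,
            Sequent.Iso.refl, Sequent.Iso.symm]
      | hl a =>
        induction a using append_cases <;>
          simp [i, Sequent.Iso.assoc, Sequent.Iso.comm, Sequent.Iso.append, Sequent.Iso.trans,
            Sequent.Iso.refl, Sequent.Iso.symm]
  have e5 : (scut rfl x ((scut rfl (y.ren (.consCons true z true t T)) v).ren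
      (.consAppend true z T U))).val (((q.append p).append r).comap i) =
      P.act (.rightComm _ _ _) (.rightComm _ _ _)
      (P.cut (P.act (.refl _) (.rightComm _ _ _)
        (P.cut (P.act (.refl _) (.rightComm _ _ _) (y.val ((q.consTrue t).consTrue z)))
          (v.val (r.consFalse t)))) (x.val (p.consFalse z))) := by
    refine (ren_val (Sequent.Iso.comm _ _) ((q.append r).append p)
      (((q.append p).append r).comap i) (.rightComm _ _ _) (.rightComm _ _ _) (fun a => ?_)
      (fun a => ?_) (cut _ x)).trans (congrArg _ ((cut_val _ _ _ _).trans (by rw [e3])))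
    · induction a using append_cases with
      | hr a => simp [i, Sequent.Iso.assoc, Sequent.Iso.comm, Sequent.Iso.append, Sequent.Iso.trans,
            Sequent.Iso.refl, Sequent.Iso.symm]
      | hl a =>
        induction a using append_cases <;>
          simp [i, Sequent.Iso.assoc, Sequent.Iso.comm, Sequent.Iso.append, Sequent.Iso.trans,
            Sequent.Iso.refl, Sequent.Iso.symm]
    · induction a using append_cases with
      | hr a => simp [i, Sequent.Iso.assoc, Sequent.Iso.comm, Sequent.Iso.append, Sequent.Iso.trans,
            Sequent.Iso.refl, Sequent.Iso.symm]
      | hl a =>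
        induction a using append_cases <;>
          simp [i, Sequent.Iso.assoc, Sequent.Iso.comm, Sequent.Iso.append, Sequent.Iso.trans,
            Sequent.Iso.refl, Sequent.Iso.symm]
  rw [AssocAt, ext_iff_at (((q.append p).append r).comap i)]
  exact (Eq.congr e4 e5).trans eq_comm

/-- The identity, on two channels of opposite polarity. -/
noncomputable def one {b b' : Bool} (h : b' = !b) (z : P.Obj) :
    P.Mor ((Sequent.single b z).cons b' z) :=
  ofVal (.pair h z) (P.id z)

/-- The unit law: the cut with an identity is a renaming. -/
def UnitAt {b b' : Bool} (h : b' = !b) {z : P.Obj} (x : P.Mor (S.cons b z)) : Prop :=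
  scut h x (one h z) = x.ren (.consSingle b z S)

theorem unitAt_true {z : P.Obj} (x : P.Mor (S.cons true z)) (p : S.Arr) :
    UnitAt rfl x ↔ P.act (.appendNil _) (.refl _) (P.cut (x.val (p.consTrue z))
      (P.act (Ctx.Iso.appendNil (Ctx.single z)).symm (.refl _) (P.id z))) =
      x.val (p.consTrue z) := by
  have e1 : (one rfl z : P.Mor ((Sequent.single true z).cons false z)).val
      ((Sequent.Arr.single true z).consFalse z) =
      P.act (Ctx.Iso.appendNil (Ctx.single z)).symm (.refl _) (P.id z) := by
    refine ofVal_val_of_act (.pair rfl z) ((Sequent.Arr.single true z).consFalse z)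
      (Ctx.Iso.appendNil (Ctx.single z)).symm (.refl _) (fun a => ?_) (fun a => ?_) (P.id z)
    · exact (congrArg _ (Ctx.Iso.appendNil_symm _ a)).trans
        (Sequent.Arr.consFalse_chan_inl z (.single true z) a)
    · rfl
  have e2 : (x.ren (.consSingle true z S)).val (p.append (.single true z)) =
      P.act (Ctx.Iso.appendNil _).symm (.refl _) (x.val (p.consTrue z)) := by
    refine ren_val _ (p.consTrue z) (p.append (.single true z)) (Ctx.Iso.appendNil _).symm
      (.refl _) (fun a => ?_) (fun a => ?_) x
    · exact (congrArg _ (Ctx.Iso.appendNil_symm _ a)).trans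
        (Sequent.Arr.append_chan_inl p (.single true z) false a)
    · induction a using append_cases with
      | hl a =>
        exact (Sequent.Arr.append_chan_inl p (.single true z) true a).trans
          (by simp [Sequent.Iso.consSingle])
      | hr a =>
        exact (Sequent.Arr.append_chan_inr p (.single true z) true a).trans
          (by simp [Sequent.Iso.consSingle])
  have e3 := cut_val x (one rfl z) p (.single true z)
  rw [e1] at e3
  rw [UnitAt, ext_iff_at (p.append (.single true z)), e2]
  exact (Eq.congr_left e3).trans (Equivariant.act_eq_iff (.appendNil _) (.refl _) _
    (x.val (p.consTrue z))).symm

theorem unitAt_false {z : P.Obj} (x : P.Mor (S.cons false z)) (p : S.Arr) :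
    UnitAt rfl x ↔ P.act (.refl _) (.nilAppend _)
      (P.cut (P.act (.refl _) (Ctx.Iso.nilAppend (Ctx.single z)).symm (P.id z))
        (x.val (p.consFalse z))) = x.val (p.consFalse z) := by
  have e1 : (one rfl z : P.Mor ((Sequent.single false z).cons true z)).val
      ((Sequent.Arr.single false z).consTrue z) =
      P.act (.refl _) (Ctx.Iso.nilAppend (Ctx.single z)).symm (P.id z) := by
    refine ofVal_val_of_act (.pair rfl z) ((Sequent.Arr.single false z).consTrue z)
      (.refl _) (Ctx.Iso.nilAppend (Ctx.single z)).symm (fun a => ?_) (fun a => ?_) (P.id z)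
    · rfl
    · exact (congrArg _ (Ctx.Iso.nilAppend_symm _ a)).trans
        (Sequent.Arr.consTrue_chan_inr z (.single false z) a)
  let q := ((Sequent.Arr.single false z).append p).comap (.comm S (.single false z))
  have e2 : (x.ren (.consSingle false z S)).val q =
      P.act (.refl _) (Ctx.Iso.nilAppend _).symm (x.val (p.consFalse z)) := by
    refine ren_val _ (p.consFalse z) q (.refl _) (Ctx.Iso.nilAppend _).symm
      (fun a => ?_) (fun a => ?_) x
    · induction a using append_cases with
      | hl a =>
        exact (congrArg (Sequent.Iso.comm S (.single false z)).equiv.symm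
          (Sequent.Arr.append_chan_inl (.single false z) p false a)).trans
          (by simp [Sequent.Iso.consSingle, Sequent.Iso.comm])
      | hr a =>
        exact (congrArg (Sequent.Iso.comm S (.single false z)).equiv.symm
          (Sequent.Arr.append_chan_inr (.single false z) p false a)).trans
          (by simp [Sequent.Iso.consSingle, Sequent.Iso.comm])
    · exact (congrArg (fun a => q.chan true a) (Ctx.Iso.nilAppend_symm _ a)).trans
        (congrArg (Sequent.Iso.comm S (.single false z)).equiv.symm
          (Sequent.Arr.append_chan_inr (.single false z) p true a))
  have e3 : (scut rfl x (one rfl z)).val q = P.cut (P.act (.refl _)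
      (Ctx.Iso.nilAppend (Ctx.single z)).symm (P.id z)) (x.val (p.consFalse z)) := by
    refine (ren_val (.comm _ _) ((Sequent.Arr.single false z).append p) q (.refl _) (.refl _)
      (fun a => rfl) (fun a => rfl) (cut (one rfl z) x)).trans
      ((Equivariant.act_refl _).trans ((cut_val _ _ _ _).trans (by rw [e1])))
  rw [UnitAt, ext_iff_at q, e2]
  exact (Eq.congr_left e3).trans (Equivariant.act_eq_iff (.refl _) (.nilAppend _) _
    (x.val (p.consFalse z))).symm

end Mor

end PolyData

/-! ### Comparison with the two-sided laws -/

namespace PolyData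

variable {P : PolyData.{u, w}} [P.Equivariant]

/-- In a symmetric polycategory the associativity law holds for all four choices of polarities. -/
theorem IsSymPolycategory.assocAt (hP : P.IsSymPolycategory) {S T U : Sequent P.Obj}
    {b b' c c' : Bool} (hb : b' = !b) (hc : c' = !c) {z t : P.Obj}
    (x : P.Mor (S.cons b z)) (y : P.Mor ((T.cons c t).cons b' z)) (v : P.Mor (U.cons c' t)) :
    Mor.AssocAt hb hc x y v := by
  subst hb hc
  let p := Classical.arbitrary S.Arr
  let q := Classical.arbitrary T.Arr
  let r := Classical.arbitrary U.Arr
  cases b <;> cases c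
  · exact Mor.assocAt_symm _ _ rfl rfl _ _ _
      ((Mor.assocAt_true_true _ _ _ r q p).2 (hP.assoc _ _ _))
  · exact (Mor.assocAt_false_true _ _ _ p q r).2 (hP.interchange_cod _ _ _)
  · exact (Mor.assocAt_true_false _ _ _ p q r).2 (hP.interchange_dom _ _ _)
  · exact (Mor.assocAt_true_true _ _ _ p q r).2 (hP.assoc _ _ _)

/-- The one-sided laws imply the axioms of a symmetric polycategory. -/
theorem Equivariant.isSymPolycategory
    (hassoc : ∀ {S T U : Sequent P.Obj} (b c : Bool) {z t : P.Obj} (x : P.Mor (S.cons b z))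
      (y : P.Mor ((T.cons c t).cons (!b) z)) (v : P.Mor (U.cons (!c) t)),
      Mor.AssocAt rfl rfl x y v)
    (hunit : ∀ {S : Sequent P.Obj} (b : Bool) {z : P.Obj} (x : P.Mor (S.cons b z)),
      Mor.UnitAt rfl x) : P.IsSymPolycategory where
  act_refl := Equivariant.act_refl
  act_act := Equivariant.act_act
  cut_act := Equivariant.cut_act
  id_cut {Γ Δ z} f := by
    let p := Sequent.Arr.ofCtx Γ Δ
    have h := (Mor.unitAt_false (Mor.ofVal (p.consFalse z) f) p).1 (hunit _ _)
    rwa [Mor.ofVal_val] at h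
  cut_id {Γ Δ z} f := by
    let p := Sequent.Arr.ofCtx Γ Δ
    have h := (Mor.unitAt_true (Mor.ofVal (p.consTrue z) f) p).1 (hunit _ _)
    rwa [Mor.ofVal_val] at h
  assoc {Γ₁ Γ₂ Γ₃ Δ₁ Δ₂ Δ₃ z t} f g k := by
    let p := Sequent.Arr.ofCtx Γ₁ Δ₁
    let q := Sequent.Arr.ofCtx Γ₂ Δ₂
    let r := Sequent.Arr.ofCtx Γ₃ Δ₃
    have h := (Mor.assocAt_true_true (Mor.ofVal (p.consTrue z) f)
      (Mor.ofVal ((q.consTrue t).consFalse z) g) (Mor.ofVal (r.consFalse t) k) p q r).1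
      (hassoc _ _ _ _ _)
    rwa [Mor.ofVal_val, Mor.ofVal_val, Mor.ofVal_val] at h
  interchange_cod {Γ₁ Γ₂ Γ₃ Δ₁ Δ₂ Δ₃ z t} f g k := by
    let p := Sequent.Arr.ofCtx Γ₃ Δ₃
    let q := Sequent.Arr.ofCtx Γ₁ Δ₁
    let r := Sequent.Arr.ofCtx Γ₂ Δ₂
    have h := (Mor.assocAt_false_true (Mor.ofVal (p.consFalse t) k)
      (Mor.ofVal ((q.consTrue z).consTrue t) f) (Mor.ofVal (r.consFalse z) g) p q r).1
      (hassoc _ _ _ _ _)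
    rwa [Mor.ofVal_val, Mor.ofVal_val, Mor.ofVal_val] at h
  interchange_dom {Γ₁ Γ₂ Γ₃ Δ₁ Δ₂ Δ₃ z t} f g k := by
    let p := Sequent.Arr.ofCtx Γ₁ Δ₁
    let q := Sequent.Arr.ofCtx Γ₃ Δ₃
    let r := Sequent.Arr.ofCtx Γ₂ Δ₂
    have h := (Mor.assocAt_true_false (Mor.ofVal (p.consTrue z) f)
      (Mor.ofVal ((q.consFalse t).consFalse z) k) (Mor.ofVal (r.consTrue t) g) p q r).1
      (hassoc _ _ _ _ _)
    rwa [Mor.ofVal_val, Mor.ofVal_val, Mor.ofVal_val] at h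

end PolyData

/-! ### The logical rules on classes of derivations -/

/-- The logical rules, irrespective of the side on which they act: `all X` is the cotuple or the
tuple, with one premise for each `X i`, and `choose X k` is the projection or the injection. -/
inductive Move (O : Type u) : Type (max u 1)
  | all {I : Type} [Finite I] (X : I → Formula O) : Move O
  | choose {I : Type} [Finite I] (X : I → Formula O) (k : I) : Move O

namespace Move

variable {O : Type u}

/-- The formula that a rule introduces, on the side given by the polarity. -/
def main : Move O → Bool → Formula O
  | all X, false => .sum X
  | all X, true => .prod X
  | choose X _, false => .prod X
  | choose X _, true => .sum X

/-- The index set of the premises of a rule. -/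
def Idx : Move O → Type
  | @all _ I _ _ => I
  | choose _ _ => Unit

/-- The formula that replaces the introduced one in a premise. -/
def prem : ∀ m : Move O, m.Idx → Formula O
  | all X => X
  | choose X k => fun _ => X k

instance finite_idx (m : Move O) : Finite m.Idx := by
  cases m
  · assumption
  · exact inferInstanceAs (Finite Unit)

theorem main_ne_atom (m : Move O) (b : Bool) (A : O) :
    m.main b ≠ .atom A := by
  cases m <;> cases b <;> exact fun h => nomatch h

/-- The pairs of an alternative `j` of `m` and an alternative `j'` of `m'` that are
matched when the two moves meet in a cut. -/
inductive Dual : ∀ m m' : Move O, m.Idx → m'.Idx → Prop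
  | all_choose {I : Type} [Finite I] (X : I → Formula O) (k : I) :
    Dual (all X) (choose X k) k ()
  | choose_all {I : Type} [Finite I] (X : I → Formula O) (k : I) :
    Dual (choose X k) (all X) () k

theorem Dual.symm {m m' : Move O} {j : m.Idx} {j' : m'.Idx} (h : Dual m m' j j') :
    Dual m' m j' j := by
  cases h with
  | all_choose X k => exact .choose_all X k
  | choose_all X k => exact .all_choose X k

end Move

namespace Der

variable {𝒜 : SymPolycategory.{u, w}} {Γ Γ' Δ Δ' : Ctx (Formula 𝒜.Obj)}

/-- The rule `m` at a channel of the domain. -/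
def left : ∀ (m : Move 𝒜.Obj) (a : Γ.Chan) (_ : Γ.ty a = m.main false)
    (_ : ∀ j, Der 𝒜 (Γ.set a (m.prem j)) Δ), Der 𝒜 Γ Δ
  | @Move.all _ _ _ X, a, h, f => cotuple a X h f
  | @Move.choose _ _ _ X k, a, h, f => proj a X h k (f ())

/-- The rule `m` at a channel of the codomain. -/
def right : ∀ (m : Move 𝒜.Obj) (a : Δ.Chan) (_ : Δ.ty a = m.main true)
    (_ : ∀ j, Der 𝒜 Γ (Δ.set a (m.prem j))), Der 𝒜 Γ Δ
  | @Move.all _ _ _ X, a, h, f => tuple a X h f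
  | @Move.choose _ _ _ X k, a, h, f => inj a X h k (f ())

theorem ren_left (σ : Γ.Iso Γ') (τ : Δ.Iso Δ') (m : Move 𝒜.Obj) (a : Γ.Chan)
    (h : Γ.ty a = m.main false) (f : ∀ j, Der 𝒜 (Γ.set a (m.prem j)) Δ) :
    ren σ τ (left m a h f) =
      left m (σ.equiv a) ((σ.ty_eq a).trans h) fun j => ren (σ.set a (m.prem j)) τ (f j) := by
  cases m <;> rfl

theorem ren_right (σ : Γ.Iso Γ') (τ : Δ.Iso Δ') (m : Move 𝒜.Obj) (a : Δ.Chan)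
    (h : Δ.ty a = m.main true) (f : ∀ j, Der 𝒜 Γ (Δ.set a (m.prem j))) :
    ren σ τ (right m a h f) =
      right m (τ.equiv a) ((τ.ty_eq a).trans h) fun j => ren σ (τ.set a (m.prem j)) (f j) := by
  cases m <;> rfl

theorem ren_refl (f : Der 𝒜 Γ Δ) : ren (.refl Γ) (.refl Δ) f = f := by
  induction f with
  | ax f σ τ => rfl
  | cotuple a X ha f ih => exact congrArg (cotuple a X ha) (funext ih)
  | tuple a X ha f ih => exact congrArg (tuple a X ha) (funext ih)
  | proj a X ha k f ih => exact congrArg (proj a X ha k) ih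
  | inj a X ha k f ih => exact congrArg (inj a X ha k) ih
  | cut σ τ f g => rfl

theorem ren_ren {Γ'' Δ'' : Ctx (Formula 𝒜.Obj)} (σ : Γ.Iso Γ') (σ' : Γ'.Iso Γ'')
    (τ : Δ.Iso Δ') (τ' : Δ'.Iso Δ'') (f : Der 𝒜 Γ Δ) :
    ren σ' τ' (ren σ τ f) = ren (σ.trans σ') (τ.trans τ') f := by
  induction f generalizing Γ' Δ' Γ'' Δ'' with
  | ax f σ₀ τ₀ => rfl
  | cotuple a X ha f ih => exact congrArg (cotuple _ X _) (funext fun i => ih i _ _ _ _)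
  | tuple a X ha f ih => exact congrArg (tuple _ X _) (funext fun i => ih i _ _ _ _)
  | proj a X ha k f ih => exact congrArg (proj _ X _ k) (ih _ _ _ _)
  | inj a X ha k f ih => exact congrArg (inj _ X _ k) (ih _ _ _ _)
  | cut σ₀ τ₀ f g => rfl

theorem Conv.congr_left (m : Move 𝒜.Obj) (a : Γ.Chan) (h : Γ.ty a = m.main false)
    {f f' : ∀ j, Der 𝒜 (Γ.set a (m.prem j)) Δ} (hf : ∀ j, Conv (f j) (f' j)) :
    Conv (left m a h f) (left m a h f') := by
  cases m with
  | all X => exact .congr_cotuple a X h hf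
  | choose X k => exact .congr_proj a X h k (hf ())

theorem Conv.congr_right (m : Move 𝒜.Obj) (a : Δ.Chan) (h : Δ.ty a = m.main true)
    {f f' : ∀ j, Der 𝒜 Γ (Δ.set a (m.prem j))} (hf : ∀ j, Conv (f j) (f' j)) :
    Conv (right m a h f) (right m a h f') := by
  cases m with
  | all X => exact .congr_tuple a X h hf
  | choose X k => exact .congr_inj a X h k (hf ())

/-- The data of `SigmaPi`, as a reducible definition. -/
abbrev poly (𝒜 : SymPolycategory.{u, w}) : PolyData.{max u 1, max u w 1} where
  Obj := Formula 𝒜.Obj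
  Hom Γ Δ := Quotient (convSetoid 𝒜 Γ Δ)
  id X := Quotient.mk _ (iota X)
  act σ τ := Quotient.map (ren σ τ) fun _ _ h => Conv.congr_ren σ τ h
  cut := Quotient.map₂ comp fun _ _ hf _ _ hg => Conv.congr_cut _ _ hf hg

end Der

namespace SigmaPi

variable {𝒜 : SymPolycategory.{u, w}} {Γ Γ' Δ Δ' : Ctx (Formula 𝒜.Obj)}

/-- The class of a derivation. -/
def mk (f : Der 𝒜 Γ Δ) : (Der.poly 𝒜).Hom Γ Δ := Quotient.mk (Der.convSetoid 𝒜 Γ Δ) f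

theorem mk_surjective : Function.Surjective (mk : Der 𝒜 Γ Δ → (Der.poly 𝒜).Hom Γ Δ) :=
  Quotient.mk_surjective

theorem mk_eq {f g : Der 𝒜 Γ Δ} (h : Der.Conv f g) : mk f = mk g := Quotient.sound h

theorem conv_of_mk_eq {f g : Der 𝒜 Γ Δ} (h : mk f = mk g) : Der.Conv f g := Quotient.exact h

theorem act_mk (σ : Γ.Iso Γ') (τ : Δ.Iso Δ') (f : Der 𝒜 Γ Δ) :
    (Der.poly 𝒜).act σ τ (mk f) = mk (Der.ren σ τ f) := rfl

instance : (Der.poly 𝒜).Equivariant where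
  act_refl f := by
    obtain ⟨f, rfl⟩ := mk_surjective f
    rw [act_mk, Der.ren_refl]
  act_act σ σ' τ τ' f := by
    obtain ⟨f, rfl⟩ := mk_surjective f
    rw [act_mk, act_mk, act_mk, Der.ren_ren]
  cut_act σ₁ τ₁ σ₂ τ₂ f g := by
    obtain ⟨f, rfl⟩ := mk_surjective f
    obtain ⟨g, rfl⟩ := mk_surjective g
    exact mk_eq (.cut_ren _ _ σ₁ τ₁ σ₂ τ₂ f g)

/-- A derivation in a given class. -/
noncomputable def rep (f : (Der.poly 𝒜).Hom Γ Δ) : Der 𝒜 Γ Δ := (mk_surjective f).choose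

@[simp] theorem mk_rep (f : (Der.poly 𝒜).Hom Γ Δ) : mk (rep f) = f := (mk_surjective f).choose_spec

/-- The rule `m` at a channel of the domain, on classes of derivations. -/
noncomputable def left (m : Move 𝒜.Obj) (a : Γ.Chan) (h : Γ.ty a = m.main false)
    (f : ∀ j, (Der.poly 𝒜).Hom (Γ.set a (m.prem j)) Δ) : (Der.poly 𝒜).Hom Γ Δ :=
  mk (Der.left m a h fun j => rep (f j))

/-- The rule `m` at a channel of the codomain, on classes of derivations. -/
noncomputable def right (m : Move 𝒜.Obj) (a : Δ.Chan) (h : Δ.ty a = m.main true)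
    (f : ∀ j, (Der.poly 𝒜).Hom Γ (Δ.set a (m.prem j))) : (Der.poly 𝒜).Hom Γ Δ :=
  mk (Der.right m a h fun j => rep (f j))

theorem left_mk (m : Move 𝒜.Obj) (a : Γ.Chan) (h : Γ.ty a = m.main false)
    (f : ∀ j, Der 𝒜 (Γ.set a (m.prem j)) Δ) :
    left m a h (fun j => mk (f j)) = mk (Der.left m a h f) :=
  mk_eq (.congr_left m a h fun _ => conv_of_mk_eq (mk_rep _))

theorem right_mk (m : Move 𝒜.Obj) (a : Δ.Chan) (h : Δ.ty a = m.main true)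
    (f : ∀ j, Der 𝒜 Γ (Δ.set a (m.prem j))) :
    right m a h (fun j => mk (f j)) = mk (Der.right m a h f) :=
  mk_eq (.congr_right m a h fun _ => conv_of_mk_eq (mk_rep _))

theorem exists_family {ι : Type*} {Γ Δ : ι → Ctx (Formula 𝒜.Obj)}
    (f : ∀ j, (Der.poly 𝒜).Hom (Γ j) (Δ j)) :
    ∃ g : ∀ j, Der 𝒜 (Γ j) (Δ j), f = fun j => mk (g j) :=
  ⟨fun j => rep (f j), funext fun _ => (mk_rep _).symm⟩

theorem act_left (σ : Γ.Iso Γ') (τ : Δ.Iso Δ') (m : Move 𝒜.Obj) (a : Γ.Chan)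
    (h : Γ.ty a = m.main false) (f : ∀ j, (Der.poly 𝒜).Hom (Γ.set a (m.prem j)) Δ) :
    (Der.poly 𝒜).act σ τ (left m a h f) = left m (σ.equiv a) ((σ.ty_eq a).trans h) fun j =>
      (Der.poly 𝒜).act (σ.set a (m.prem j)) τ (f j) := by
  obtain ⟨f, rfl⟩ := exists_family f
  rw [left_mk, act_mk, Der.ren_left, ← left_mk]
  rfl

theorem act_right (σ : Γ.Iso Γ') (τ : Δ.Iso Δ') (m : Move 𝒜.Obj) (a : Δ.Chan)
    (h : Δ.ty a = m.main true) (f : ∀ j, (Der.poly 𝒜).Hom Γ (Δ.set a (m.prem j))) :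
    (Der.poly 𝒜).act σ τ (right m a h f) = right m (τ.equiv a) ((τ.ty_eq a).trans h) fun j =>
      (Der.poly 𝒜).act σ (τ.set a (m.prem j)) (f j) := by
  obtain ⟨f, rfl⟩ := exists_family f
  rw [right_mk, act_mk, Der.ren_right, ← right_mk]
  rfl

section

variable {Γ₁ Γ₂ Δ₁ Δ₂ : Ctx (Formula 𝒜.Obj)} {Z : Formula 𝒜.Obj}

theorem left_cut (m : Move 𝒜.Obj) (a : Γ₁.Chan) (h : Γ₁.ty a = m.main false)
    (f : ∀ j, (Der.poly 𝒜).Hom (Γ₁.set a (m.prem j)) (Δ₁ ⊹ Ctx.single Z))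
    (g : (Der.poly 𝒜).Hom (Ctx.single Z ⊹ Γ₂) Δ₂) :
    (Der.poly 𝒜).cut (left m a h f) g =
      left m (inl Γ₂ a) ((Ctx.append_ty_inl _ _ _).trans h) fun j =>
        (Der.poly 𝒜).act (.setAppendLeft Γ₁ Γ₂ a (m.prem j)) (.refl _)
          ((Der.poly 𝒜).cut (f j) g) := by
  obtain ⟨f, rfl⟩ := exists_family f
  obtain ⟨g, rfl⟩ := mk_surjective g
  rw [left_mk]
  refine (mk_eq ?_).trans (left_mk m _ _
    (fun j => Der.renL (.setAppendLeft Γ₁ Γ₂ a (m.prem j)) (Der.comp (f j) g))).symm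
  cases m with
  | all X => exact .cotuple_cut a X h f g
  | choose X k => exact .proj_cut a X h k (f ()) g

theorem right_cut (m : Move 𝒜.Obj) (b : Δ₁.Chan) (h : Δ₁.ty b = m.main true)
    (f : ∀ j, (Der.poly 𝒜).Hom Γ₁ ((Δ₁ ⊹ Ctx.single Z).set (inl _ b) (m.prem j)))
    (g : (Der.poly 𝒜).Hom (Ctx.single Z ⊹ Γ₂) Δ₂) :
    (Der.poly 𝒜).cut (right m (inl _ b) ((Ctx.append_ty_inl _ _ _).trans h) f) g =
      right m (inl Δ₂ b) ((Ctx.append_ty_inl _ _ _).trans h) fun j =>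
        (Der.poly 𝒜).act (.refl _) (.setAppendLeft Δ₁ Δ₂ b (m.prem j))
          ((Der.poly 𝒜).cut ((Der.poly 𝒜).act (.refl _)
            (Ctx.Iso.setAppendLeft Δ₁ (Ctx.single Z) b (m.prem j)).symm (f j)) g) := by
  obtain ⟨f, rfl⟩ := exists_family f
  obtain ⟨g, rfl⟩ := mk_surjective g
  rw [right_mk]
  refine (mk_eq ?_).trans (right_mk m _ _
    (fun j => Der.renR (.setAppendLeft Δ₁ Δ₂ b (m.prem j))
      (Der.comp (Der.renR (Ctx.Iso.setAppendLeft Δ₁ (Ctx.single Z) b (m.prem j)).symm (f j))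
        g))).symm
  cases m with
  | all X => exact .tuple_cut b X h f g
  | choose X k => exact .inj_cut b X h k (f ()) g

theorem cut_right (m : Move 𝒜.Obj) (b : Δ₂.Chan) (h : Δ₂.ty b = m.main true)
    (f : (Der.poly 𝒜).Hom Γ₁ (Δ₁ ⊹ Ctx.single Z))
    (g : ∀ j, (Der.poly 𝒜).Hom (Ctx.single Z ⊹ Γ₂) (Δ₂.set b (m.prem j))) :
    (Der.poly 𝒜).cut f (right m b h g) =
      right m (inr Δ₁ b) ((Ctx.append_ty_inr _ _ _).trans h) fun j =>
        (Der.poly 𝒜).act (.refl _) (.setAppendRight Δ₁ Δ₂ b (m.prem j))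
          ((Der.poly 𝒜).cut f (g j)) := by
  obtain ⟨g, rfl⟩ := exists_family g
  obtain ⟨f, rfl⟩ := mk_surjective f
  rw [right_mk]
  refine (mk_eq ?_).trans (right_mk m _ _
    (fun j => Der.renR (.setAppendRight Δ₁ Δ₂ b (m.prem j)) (Der.comp f (g j)))).symm
  cases m with
  | all X => exact .cut_tuple b X h f g
  | choose X k => exact .cut_inj b X h k f (g ())

theorem cut_left (m : Move 𝒜.Obj) (a : Γ₂.Chan) (h : Γ₂.ty a = m.main false)
    (f : (Der.poly 𝒜).Hom Γ₁ (Δ₁ ⊹ Ctx.single Z))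
    (g : ∀ j, (Der.poly 𝒜).Hom ((Ctx.single Z ⊹ Γ₂).set (inr _ a) (m.prem j)) Δ₂) :
    (Der.poly 𝒜).cut f (left m (inr _ a) ((Ctx.append_ty_inr _ _ _).trans h) g) =
      left m (inr Γ₁ a) ((Ctx.append_ty_inr _ _ _).trans h) fun j =>
        (Der.poly 𝒜).act (.setAppendRight Γ₁ Γ₂ a (m.prem j)) (.refl _)
          ((Der.poly 𝒜).cut f ((Der.poly 𝒜).act
            (Ctx.Iso.setAppendRight (Ctx.single Z) Γ₂ a (m.prem j)).symm (.refl _) (g j))) := by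
  obtain ⟨g, rfl⟩ := exists_family g
  obtain ⟨f, rfl⟩ := mk_surjective f
  rw [left_mk]
  refine (mk_eq ?_).trans (left_mk m _ _
    (fun j => Der.renL (.setAppendRight Γ₁ Γ₂ a (m.prem j))
      (Der.comp f (Der.renL (Ctx.Iso.setAppendRight (Ctx.single Z) Γ₂ a (m.prem j)).symm
        (g j))))).symm
  cases m with
  | all X => exact .cut_cotuple a X h f g
  | choose X k => exact .cut_proj a X h k f (g ())

/-- A left rule and a right rule that act on the two ends of a cut are reduced to
a cut between premises of these rules. The equalities of `σ` and `τ` with the identity on channels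
allow for any proof that the cut formulas of the premises agree. -/
theorem right_cut_left (m m' : Move 𝒜.Obj) (h : Z = m.main true) (h' : Z = m'.main false) :
    ∃ (X : Formula 𝒜.Obj) (j : m.Idx) (j' : m'.Idx) (_ : Move.Dual m m' j j')
      (_ : m.prem j = X) (_ : m'.prem j' = X),
      ∀ (Γ₁ Γ₂ Δ₁ Δ₂ : Ctx (Formula 𝒜.Obj))
        (σ : ((Ctx.single Z ⊹ Γ₂).set (inl _ (Ctx.pt _)) (m'.prem j')).Iso (Ctx.single X ⊹ Γ₂))
        (τ : ((Δ₁ ⊹ Ctx.single Z).set (inr _ (Ctx.pt _)) (m.prem j)).Iso (Δ₁ ⊹ Ctx.single X))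
        (_ : ∀ c, σ.equiv c = c) (_ : ∀ c, τ.equiv c = c)
        (f : ∀ j, (Der.poly 𝒜).Hom Γ₁ ((Δ₁ ⊹ Ctx.single Z).set (inr _ (Ctx.pt _)) (m.prem j)))
        (g : ∀ j, (Der.poly 𝒜).Hom ((Ctx.single Z ⊹ Γ₂).set (inl _ (Ctx.pt _)) (m'.prem j)) Δ₂),
        (Der.poly 𝒜).cut (right m (inr _ (Ctx.pt _)) ((Ctx.append_ty_inr _ _ _).trans h) f)
            (left m' (inl _ (Ctx.pt _)) ((Ctx.append_ty_inl _ _ _).trans h') g) =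
          (Der.poly 𝒜).cut ((Der.poly 𝒜).act (.refl _) τ (f j))
            ((Der.poly 𝒜).act σ (.refl _) (g j')) := by
  have key {Γ Δ : Ctx (Formula 𝒜.Obj)} {σ σ' : Γ.Iso Δ} (h : ∀ c, σ.equiv c = σ'.equiv c) :
      σ = σ' := Ctx.Iso.ext_apply h
  cases m with
  | all X =>
    cases m' with
    | all X' => cases h.symm.trans h'
    | choose X' k =>
      cases h
      cases h'
      refine ⟨X k, k, (), .all_choose X k, rfl, rfl, fun Γ₁ Γ₂ Δ₁ Δ₂ σ τ hσ hτ f g => ?_⟩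
      obtain rfl : σ = .setFirst _ _ _ :=
        key fun c => (hσ c).trans (Ctx.Iso.setFirst_equiv _ _ _ _).symm
      obtain rfl : τ = .setLast _ _ _ :=
        key fun c => (hτ c).trans (Ctx.Iso.setLast_equiv _ _ _ _).symm
      obtain ⟨f, rfl⟩ := exists_family f
      obtain ⟨g, rfl⟩ := exists_family g
      rw [left_mk, right_mk]
      exact mk_eq (.tuple_cut_proj X k f (g ()))
  | choose X k =>
    cases m' with
    | choose X' k' => cases h.symm.trans h'
    | all X' =>
      cases h
      cases h'
      refine ⟨X k, (), k, .choose_all X k, rfl, rfl, fun Γ₁ Γ₂ Δ₁ Δ₂ σ τ hσ hτ f g => ?_⟩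
      obtain rfl : σ = .setFirst _ _ _ :=
        key fun c => (hσ c).trans (Ctx.Iso.setFirst_equiv _ _ _ _).symm
      obtain rfl : τ = .setLast _ _ _ :=
        key fun c => (hτ c).trans (Ctx.Iso.setLast_equiv _ _ _ _).symm
      obtain ⟨f, rfl⟩ := exists_family f
      obtain ⟨g, rfl⟩ := exists_family g
      rw [left_mk, right_mk]
      exact mk_eq (.inj_cut_cotuple X k (f ()) g)

end

end SigmaPi

/-! ### The logical rules on unordered channels -/

namespace SigmaPi

open PolyData

variable {𝒜 : SymPolycategory.{u, w}} {S T U : Sequent (Formula 𝒜.Obj)}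

/-- The value of `rule` at an arrangement, where the channel `c` lies in the domain or in the
codomain. -/
noncomputable def ruleVal (c : S.Chan) (m : Move 𝒜.Obj) (h : S.ty c = m.main (S.pol c))
    (f : ∀ j, (Der.poly 𝒜).Mor (S.set c (m.prem j))) (p : S.Arr) :
    (Der.poly 𝒜).Hom (p.ctx false) (p.ctx true) :=
  if hc : S.pol c = false then
    left m (p.surj false c hc).choose
      (by rw [← p.ty_chan, (p.surj false c hc).choose_spec, h, hc])
      fun j => (f j).val (p.setFalse c _ (p.surj false c hc).choose_spec (m.prem j))
  else
    have hc : S.pol c = true := by simpa using hc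
    right m (p.surj true c hc).choose
      (by rw [← p.ty_chan, (p.surj true c hc).choose_spec, h, hc])
      fun j => (f j).val (p.setTrue c _ (p.surj true c hc).choose_spec (m.prem j))

theorem ruleVal_false (c : S.Chan) (m : Move 𝒜.Obj) (h : S.ty c = m.main (S.pol c))
    (f : ∀ j, (Der.poly 𝒜).Mor (S.set c (m.prem j))) (p : S.Arr) (a : (p.ctx false).Chan)
    (ha : p.chan false a = c) :
    ruleVal c m h f p = left m a (by rw [← p.ty_chan, ha, h, ← ha, p.pol_chan])
      fun j => (f j).val (p.setFalse c a ha (m.prem j)) := by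
  have hc : S.pol c = false := by rw [← ha, p.pol_chan]
  have e : a = (p.surj false c hc).choose :=
    p.inj _ (ha.trans (p.surj false c hc).choose_spec.symm)
  subst e
  rw [ruleVal, dif_pos hc]

theorem ruleVal_true (c : S.Chan) (m : Move 𝒜.Obj) (h : S.ty c = m.main (S.pol c))
    (f : ∀ j, (Der.poly 𝒜).Mor (S.set c (m.prem j))) (p : S.Arr) (a : (p.ctx true).Chan)
    (ha : p.chan true a = c) :
    ruleVal c m h f p = right m a (by rw [← p.ty_chan, ha, h, ← ha, p.pol_chan])
      fun j => (f j).val (p.setTrue c a ha (m.prem j)) := by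
  have hc : S.pol c = true := by rw [← ha, p.pol_chan]
  have e : a = (p.surj true c hc).choose :=
    p.inj _ (ha.trans (p.surj true c hc).choose_spec.symm)
  subst e
  rw [ruleVal, dif_neg (by simp [hc])]

/-- The rule `m` at the channel `c`, on the side given by the polarity of `c`. -/
noncomputable def rule (c : S.Chan) (m : Move 𝒜.Obj) (h : S.ty c = m.main (S.pol c))
    (f : ∀ j, (Der.poly 𝒜).Mor (S.set c (m.prem j))) : (Der.poly 𝒜).Mor S where
  val := ruleVal c m h f
  act_val p q σ τ hσ hτ := by
    cases hc : S.pol c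
    · obtain ⟨a, ha⟩ := p.surj false c hc
      rw [ruleVal_false c m h f p a ha, ruleVal_false c m h f q (σ.equiv a) ((hσ a).trans ha),
        act_left]
      congr 1
      funext j
      exact (f j).act_val (p.setFalse c a ha _) (q.setFalse c (σ.equiv a) ((hσ a).trans ha) _)
        (σ.set a _) τ hσ hτ
    · obtain ⟨a, ha⟩ := p.surj true c hc
      rw [ruleVal_true c m h f p a ha, ruleVal_true c m h f q (τ.equiv a) ((hτ a).trans ha),
        act_right]
      congr 1
      funext j
      exact (f j).act_val (p.setTrue c a ha _) (q.setTrue c (τ.equiv a) ((hτ a).trans ha) _)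
        σ (τ.set a _) hσ hτ

theorem rule_val_false (c : S.Chan) (m : Move 𝒜.Obj) (h : S.ty c = m.main (S.pol c))
    (f : ∀ j, (Der.poly 𝒜).Mor (S.set c (m.prem j))) (p : S.Arr) (a : (p.ctx false).Chan)
    (ha : p.chan false a = c) :
    (rule c m h f).val p = left m a (by rw [← p.ty_chan, ha, h, ← ha, p.pol_chan])
      fun j => (f j).val (p.setFalse c a ha (m.prem j)) :=
  ruleVal_false c m h f p a ha

theorem rule_val_true (c : S.Chan) (m : Move 𝒜.Obj) (h : S.ty c = m.main (S.pol c))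
    (f : ∀ j, (Der.poly 𝒜).Mor (S.set c (m.prem j))) (p : S.Arr) (a : (p.ctx true).Chan)
    (ha : p.chan true a = c) :
    (rule c m h f).val p = right m a (by rw [← p.ty_chan, ha, h, ← ha, p.pol_chan])
      fun j => (f j).val (p.setTrue c a ha (m.prem j)) :=
  ruleVal_true c m h f p a ha

theorem ren_rule (i : S.Iso T) {c : S.Chan} {d : T.Chan} (hd : i.equiv c = d) (m : Move 𝒜.Obj)
    (h : S.ty c = m.main (S.pol c)) (f : ∀ j, (Der.poly 𝒜).Mor (S.set c (m.prem j))) :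
    (rule c m h f).ren i = rule d m (by rw [← hd, i.ty_eq, i.pol_eq, h])
      fun j => (f j).ren (i.set hd (m.prem j)) := by
  subst hd
  refine Mor.ext fun p => ?_
  rcases (S.pol c).eq_false_or_eq_true.symm with hc | hc
  · obtain ⟨a, ha⟩ := (p.comap i).surj false c hc
    refine (rule_val_false c m h f (p.comap i) a ha).trans ?_
    rw [rule_val_false (i.equiv c) _ _ _ p a (by rw [← ha]; simp)]
    congr 1
    funext j
    exact ((f j).ren_val (i.set rfl (m.prem j)) ((p.comap i).setFalse c a ha _)
      (p.setFalse (i.equiv c) a _ _) (.refl _) (.refl _)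
      (fun a => (i.equiv.apply_symm_apply (p.chan false a)).symm)
      (fun a => (i.equiv.apply_symm_apply (p.chan true a)).symm)).trans
      (Equivariant.act_refl _) |>.symm
  · obtain ⟨a, ha⟩ := (p.comap i).surj true c hc
    refine (rule_val_true c m h f (p.comap i) a ha).trans ?_
    rw [rule_val_true (i.equiv c) _ _ _ p a (by rw [← ha]; simp)]
    congr 1
    funext j
    exact ((f j).ren_val (i.set rfl (m.prem j)) ((p.comap i).setTrue c a ha _)
      (p.setTrue (i.equiv c) a _ _) (.refl _) (.refl _)
      (fun a => (i.equiv.apply_symm_apply (p.chan false a)).symm)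
      (fun a => (i.equiv.apply_symm_apply (p.chan true a)).symm)).trans
      (Equivariant.act_refl _) |>.symm

theorem rule_cut {z : Formula 𝒜.Obj} (c : S.Chan) (m : Move 𝒜.Obj)
    (h : S.ty c = m.main (S.pol c))
    (f : ∀ j, (Der.poly 𝒜).Mor ((S.cons true z).set (some c) (m.prem j)))
    (y : (Der.poly 𝒜).Mor (T.cons false z)) :
    Mor.cut (rule (some c) m h f) y = rule (S := S.append T) (.inl c) m h fun j =>
      (Mor.cut ((f j).ren (.setConsSome true z S c (m.prem j))) y).ren
        (.setAppendLeft S T c (m.prem j)) := by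
  let p := Classical.arbitrary S.Arr
  let q := Classical.arbitrary T.Arr
  apply Mor.ext_at (p.append q)
  rw [Mor.cut_val]
  rcases (S.pol c).eq_false_or_eq_true.symm with hc | hc
  · obtain ⟨a, ha⟩ := p.surj false c hc
    rw [rule_val_false (some c) m h f (p.consTrue z) a (congrArg some ha),
      rule_val_false (Sum.inl c) m h _ (p.append q) (inl _ a) (by simp [ha])]
    refine (left_cut m a (by rw [← p.ty_chan, ha, h, hc]) _ _).trans ?_
    congr 1
    funext j
    symm
    let p₁ := (p.setFalse c a ha (m.prem j)).append q
    let p₂ := (p.append q).setFalse (.inl c) (inl _ a) (by simp [ha]) (m.prem j)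
    refine (Mor.ren_val (P := Der.poly 𝒜) (.setAppendLeft S T c (m.prem j)) p₁ p₂
      (Ctx.Iso.setAppendLeft (p.ctx false) (q.ctx false) a (m.prem j))
      (Ctx.Iso.refl (p.ctx true ⊹ q.ctx true))
      (fun d => ?_) (fun d => ?_) _).trans ?_
    · exact congrArg (fun d => (p.append q).chan false d) (Ctx.Iso.setAppendLeft_equiv _ _ _ _ d)
    · rfl
    · refine congrArg _ ((Mor.cut_val _ _ _ _).trans (congrArg (fun x => (Der.poly 𝒜).cut x _) ?_))
      let p₃ := (p.consTrue z).setFalse (some c) a (congrArg some ha) (m.prem j)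
      let p₄ := (p.setFalse c a ha (m.prem j)).consTrue z
      refine (Mor.ren_val (P := Der.poly 𝒜) (.setConsSome true z S c (m.prem j)) p₃ p₄
        (.refl _) (.refl _) (fun d => ?_)
        (fun d => ?_) (f j)).trans (Equivariant.act_refl _)
      · rfl
      · rfl
  · obtain ⟨a, ha⟩ := p.surj true c hc
    rw [rule_val_true (some c) m h f (p.consTrue z) (inl _ a) (by simp [ha]),
      rule_val_true (Sum.inl c) m h _ (p.append q) (inl _ a) (by simp [ha])]
    refine (right_cut m a (by rw [← p.ty_chan, ha, h, hc]) _ _).trans ?_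
    congr 1
    funext j
    symm
    let p₁ := (p.setTrue c a ha (m.prem j)).append q
    let p₂ := (p.append q).setTrue (.inl c) (inl _ a) (by simp [ha]) (m.prem j)
    refine (Mor.ren_val (P := Der.poly 𝒜) (.setAppendLeft S T c (m.prem j)) p₁ p₂
      (Ctx.Iso.refl (p.ctx false ⊹ q.ctx false))
      (Ctx.Iso.setAppendLeft (p.ctx true) (q.ctx true) a (m.prem j))
      (fun d => ?_) (fun d => ?_) _).trans ?_
    · rfl
    · exact congrArg (fun d => (p.append q).chan true d) (Ctx.Iso.setAppendLeft_equiv _ _ _ _ d)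
    · refine congrArg _ ((Mor.cut_val _ _ _ _).trans (congrArg (fun x => (Der.poly 𝒜).cut x _) ?_))
      let p₃ := (p.consTrue z).setTrue (some c) (inl _ a) (by simp [ha]) (m.prem j)
      let p₄ := (p.setTrue c a ha (m.prem j)).consTrue z
      refine (Mor.ren_val (P := Der.poly 𝒜) (.setConsSome true z S c (m.prem j)) p₃ p₄
        (.refl _)
        (Ctx.Iso.setAppendLeft (p.ctx true) (Ctx.single z) a (m.prem j)).symm (fun d => ?_)
        (fun d => ?_) (f j))
      · rfl
      · exact congrArg (fun d => (p.consTrue z).chan true d)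
          ((Equiv.symm_apply_eq _).2 (Ctx.Iso.setAppendLeft_equiv _ _ _ _ _).symm)

theorem cut_rule {z : Formula 𝒜.Obj} (c : T.Chan) (m : Move 𝒜.Obj)
    (h : T.ty c = m.main (T.pol c)) (x : (Der.poly 𝒜).Mor (S.cons true z))
    (f : ∀ j, (Der.poly 𝒜).Mor ((T.cons false z).set (some c) (m.prem j))) :
    Mor.cut x (rule (some c) m h f) = rule (S := S.append T) (.inr c) m h fun j =>
      (Mor.cut x ((f j).ren (.setConsSome false z T c (m.prem j)))).ren
        (.setAppendRight S T c (m.prem j)) := by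
  let p := Classical.arbitrary S.Arr
  let q := Classical.arbitrary T.Arr
  apply Mor.ext_at (p.append q)
  rw [Mor.cut_val]
  rcases (T.pol c).eq_false_or_eq_true.symm with hc | hc
  · obtain ⟨a, ha⟩ := q.surj false c hc
    rw [rule_val_false (some c) m h f (q.consFalse z) (inr _ a) (by simp [ha]),
      rule_val_false (Sum.inr c) m h _ (p.append q) (inr _ a) (by simp [ha])]
    refine (cut_left m a (by rw [← q.ty_chan, ha, h, hc]) _ _).trans ?_
    congr 1
    funext j
    symm
    let p₁ := p.append (q.setFalse c a ha (m.prem j))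
    let p₂ := (p.append q).setFalse (.inr c) (inr _ a) (by simp [ha]) (m.prem j)
    refine (Mor.ren_val (P := Der.poly 𝒜) (.setAppendRight S T c (m.prem j)) p₁ p₂
      (Ctx.Iso.setAppendRight (p.ctx false) (q.ctx false) a (m.prem j))
      (Ctx.Iso.refl (p.ctx true ⊹ q.ctx true))
      (fun d => ?_) (fun d => ?_) _).trans ?_
    · exact congrArg (fun d => (p.append q).chan false d) (Ctx.Iso.setAppendRight_equiv _ _ _ _ d)
    · rfl
    · refine congrArg _ ((Mor.cut_val _ _ _ _).trans (congrArg (fun y => (Der.poly 𝒜).cut _ y) ?_))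
      let p₃ := (q.consFalse z).setFalse (some c) (inr _ a) (by simp [ha]) (m.prem j)
      let p₄ := (q.setFalse c a ha (m.prem j)).consFalse z
      refine (Mor.ren_val (P := Der.poly 𝒜) (.setConsSome false z T c (m.prem j)) p₃ p₄
        (Ctx.Iso.setAppendRight (Ctx.single z) (q.ctx false) a (m.prem j)).symm
        (.refl _) (fun d => ?_) (fun d => ?_) (f j))
      · exact congrArg (fun d => (q.consFalse z).chan false d)
          ((Equiv.symm_apply_eq _).2 (Ctx.Iso.setAppendRight_equiv _ _ _ _ _).symm)
      · rfl
  · obtain ⟨a, ha⟩ := q.surj true c hc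
    rw [rule_val_true (some c) m h f (q.consFalse z) a (congrArg some ha),
      rule_val_true (Sum.inr c) m h _ (p.append q) (inr _ a) (by simp [ha])]
    refine (cut_right m a (by rw [← q.ty_chan, ha, h, hc]) _ _).trans ?_
    congr 1
    funext j
    symm
    let p₁ := p.append (q.setTrue c a ha (m.prem j))
    let p₂ := (p.append q).setTrue (.inr c) (inr _ a) (by simp [ha]) (m.prem j)
    refine (Mor.ren_val (P := Der.poly 𝒜) (.setAppendRight S T c (m.prem j)) p₁ p₂
      (Ctx.Iso.refl (p.ctx false ⊹ q.ctx false))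
      (Ctx.Iso.setAppendRight (p.ctx true) (q.ctx true) a (m.prem j))
      (fun d => ?_) (fun d => ?_) _).trans ?_
    · rfl
    · exact congrArg (fun d => (p.append q).chan true d) (Ctx.Iso.setAppendRight_equiv _ _ _ _ d)
    · refine congrArg _ ((Mor.cut_val _ _ _ _).trans (congrArg (fun y => (Der.poly 𝒜).cut _ y) ?_))
      let p₃ := (q.consFalse z).setTrue (some c) a (congrArg some ha) (m.prem j)
      let p₄ := (q.setTrue c a ha (m.prem j)).consFalse z
      refine (Mor.ren_val (P := Der.poly 𝒜) (.setConsSome false z T c (m.prem j)) p₃ p₄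
        (.refl _) (.refl _) (fun d => ?_)
        (fun d => ?_) (f j)).trans (Equivariant.act_refl _)
      · rfl
      · rfl

/-- A rule of the left premise at another channel than that of the cut moves below the cut. -/
theorem scut_rule_left {b b' : Bool} (hb : b' = !b) {z : Formula 𝒜.Obj} (c : S.Chan)
    (m : Move 𝒜.Obj) (h : S.ty c = m.main (S.pol c))
    (f : ∀ j, (Der.poly 𝒜).Mor ((S.cons b z).set (some c) (m.prem j)))
    (y : (Der.poly 𝒜).Mor (T.cons b' z)) :
    Mor.scut hb (rule (S := S.cons b z) (some c) m h f) y =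
      rule (S := S.append T) (.inl c) m h fun j =>
        (Mor.scut hb ((f j).ren (.setConsSome b z S c (m.prem j))) y).ren
          (.setAppendLeft S T c (m.prem j)) := by
  subst hb
  cases b
  · refine (congrArg _ (cut_rule c m h y f)).trans ((ren_rule _ rfl _ _ _).trans ?_)
    refine congrArg (rule (S := S.append T) (.inl c) m h) (funext fun j => ?_)
    exact Mor.ren_congr (i := .trans (.setAppendRight T S c (m.prem j))
      (Sequent.Iso.set (.comm T S) (c := .inr c) rfl (m.prem j)))
      (j := .trans (.comm T (S.set c (m.prem j))) (.setAppendLeft S T c (m.prem j)))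
      (fun d => by cases d <;> rfl)
      (Mor.cut y ((f j).ren (.setConsSome false z S c (m.prem j))))
  · exact rule_cut c m h f y

/-- A rule of the right premise at another channel than that of the cut moves below the cut. -/
theorem scut_rule_right {b b' : Bool} (hb : b' = !b) {z : Formula 𝒜.Obj} (c : T.Chan)
    (m : Move 𝒜.Obj) (h : T.ty c = m.main (T.pol c)) (x : (Der.poly 𝒜).Mor (S.cons b z))
    (f : ∀ j, (Der.poly 𝒜).Mor ((T.cons b' z).set (some c) (m.prem j))) :
    Mor.scut hb x (rule (S := T.cons b' z) (some c) m h f) =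
      rule (S := S.append T) (.inr c) m h fun j =>
        (Mor.scut hb x ((f j).ren (.setConsSome b' z T c (m.prem j)))).ren
          (.setAppendRight S T c (m.prem j)) := by
  subst hb
  cases b
  · refine (congrArg _ (rule_cut c m h f x)).trans ((ren_rule _ rfl _ _ _).trans ?_)
    refine congrArg (rule (S := S.append T) (.inr c) m h) (funext fun j => ?_)
    exact Mor.ren_congr (i := .trans (.setAppendLeft T S c (m.prem j))
      (Sequent.Iso.set (.comm T S) (c := .inl c) rfl (m.prem j)))
      (j := .trans (.comm (T.set c (m.prem j)) S) (.setAppendRight S T c (m.prem j)))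
      (fun d => by cases d <;> rfl)
      (Mor.cut ((f j).ren (.setConsSome true z T c (m.prem j))) x)
  · exact cut_rule c m h x f

theorem cut_principal (m m' : Move 𝒜.Obj) {z : Formula 𝒜.Obj} (h : z = m.main true)
    (h' : z = m'.main false) :
    ∃ (X : Formula 𝒜.Obj) (j : m.Idx) (j' : m'.Idx) (_ : Move.Dual m m' j j')
      (e : m.prem j = X) (e' : m'.prem j' = X),
      ∀ (S T : Sequent (Formula 𝒜.Obj))
        (f : ∀ j, (Der.poly 𝒜).Mor ((S.cons true z).set none (m.prem j)))
        (g : ∀ j, (Der.poly 𝒜).Mor ((T.cons false z).set none (m'.prem j))),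
        Mor.cut (rule (S := S.cons true z) none m h f) (rule (S := T.cons false z) none m' h' g) =
          Mor.cut ((f j).ren (.setConsNone true z S e))
            ((g j').ren (.setConsNone false z T e')) := by
  obtain ⟨X, j, j', d, e, e', H⟩ := right_cut_left m m' h h'
  refine ⟨X, j, j', d, e, e', fun S T f g => ?_⟩
  let p := Classical.arbitrary S.Arr
  let q := Classical.arbitrary T.Arr
  apply Mor.ext_at (p.append q)
  rw [Mor.cut_val, Mor.cut_val,
    rule_val_true none m h f (p.consTrue z) (inr _ (Ctx.pt z)) (by simp),
    rule_val_false none m' h' g (q.consFalse z) (inl _ (Ctx.pt z)) (by simp)]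
  refine (H _ _ _ _ (.setFirstOfEq _ _ e') (.setLastOfEq _ _ e) (fun _ => rfl) (fun _ => rfl)
    _ _).trans ?_
  congr 1
  · let p' := (p.consTrue z).setTrue none (inr _ (Ctx.pt z)) (by simp) (m.prem j)
    exact (Mor.ren_val (P := Der.poly 𝒜) (.setConsNone true z S e) p' (p.consTrue X)
      (.refl _) (.setLastOfEq _ _ e) (fun _ => rfl) (fun _ => rfl) (f j)).symm
  · let q' := (q.consFalse z).setFalse none (inl _ (Ctx.pt z)) (by simp) (m'.prem j')
    exact (Mor.ren_val (P := Der.poly 𝒜) (.setConsNone false z T e') q' (q.consFalse X)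
      (.setFirstOfEq _ _ e') (.refl _) (fun _ => rfl) (fun _ => rfl) (g j')).symm

/-- Two rules that act on the two ends of a cut are reduced to a cut between matching premises.
The choice of the premises depends on the rules only. -/
theorem scut_principal {b b' : Bool} (hb : b' = !b) (m m' : Move 𝒜.Obj) {z : Formula 𝒜.Obj}
    (h : z = m.main b) (h' : z = m'.main b') :
    ∃ (X : Formula 𝒜.Obj) (j : m.Idx) (j' : m'.Idx) (_ : Move.Dual m m' j j')
      (e : m.prem j = X) (e' : m'.prem j' = X),
      ∀ (S T : Sequent (Formula 𝒜.Obj))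
        (f : ∀ j, (Der.poly 𝒜).Mor ((S.cons b z).set none (m.prem j)))
        (g : ∀ j, (Der.poly 𝒜).Mor ((T.cons b' z).set none (m'.prem j))),
        Mor.scut hb (rule (S := S.cons b z) none m h f) (rule (S := T.cons b' z) none m' h' g) =
          Mor.scut hb ((f j).ren (.setConsNone b z S e)) ((g j').ren (.setConsNone b' z T e')) := by
  subst hb
  cases b
  · obtain ⟨X, j, j', d, e, e', H⟩ := cut_principal m' m h' h
    exact ⟨X, j', j, d.symm, e', e, fun S T f g =>
      congrArg (Mor.ren (P := Der.poly 𝒜) (Sequent.Iso.comm T S)) (H T S g f)⟩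
  · exact cut_principal m m' h h'

end SigmaPi

/-! ### Cut elimination -/

namespace SigmaPi

open PolyData Sequent

variable {𝒜 : SymPolycategory.{u, w}} {S T U : Sequent (Formula 𝒜.Obj)}

instance : 𝒜.toPolyData.Equivariant := 𝒜.isSymPolycategory.equivariant

section Axioms

variable {R R' : Sequent 𝒜.Obj}

/-- The image of a polymorphism of `𝒜`, given by the axiom rule. -/
noncomputable def ofBase (x : 𝒜.Mor R) : (Der.poly 𝒜).Mor (R.map Formula.atom) :=
  Mor.ofVal ((Classical.arbitrary R.Arr).map Formula.atom)
    (mk (.ax (x.val (Classical.arbitrary R.Arr)) (.refl _) (.refl _)))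

theorem ofBase_val (x : 𝒜.Mor R) (p : R.Arr) :
    (ofBase x).val (p.map Formula.atom) = mk (.ax (x.val p) (.refl _) (.refl _)) := by
  let q := Classical.arbitrary R.Arr
  have h := Mor.ofVal_val_of_act (P := Der.poly 𝒜) (q.map Formula.atom) (p.map Formula.atom)
    ((q.iso p false).map _) ((q.iso p true).map _) (fun a => q.chan_iso p false a)
    (fun a => q.chan_iso p true a) (mk (.ax (x.val q) (.refl _) (.refl _)))
  refine h.trans ?_
  rw [← x.act_val q p (q.iso p false) (q.iso p true) (by simp) (by simp)]
  exact (mk_eq (.ax_act (x.val q) (q.iso p false) (q.iso p true) (.refl _) (.refl _))).symm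

theorem ofBase_ren (i : R.Iso R') (x : 𝒜.Mor R) :
    ofBase (x.ren i) = (ofBase x).ren (i.map Formula.atom) := by
  let p := Classical.arbitrary R'.Arr
  apply Mor.ext_at (p.map Formula.atom)
  exact (ofBase_val _ _).trans (ofBase_val x (p.comap i)).symm

theorem ofBase_cut {z : 𝒜.Obj} (x : 𝒜.Mor (R.cons true z)) (y : 𝒜.Mor (R'.cons false z)) :
    Mor.cut ((ofBase x).ren (.mapCons _ true z R)) ((ofBase y).ren (.mapCons _ false z R')) =
      (ofBase (Mor.cut x y)).ren (.mapAppend _ R R') := by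
  let p := Classical.arbitrary R.Arr
  let q := Classical.arbitrary R'.Arr
  have e1 : ((ofBase x).ren (.mapCons _ true z R)).val ((p.map Formula.atom).consTrue (.atom z)) =
      mk (.ax (x.val (p.consTrue z)) (.refl _) ((Ctx.Iso.mapAppend _ (p.ctx true)
        (Ctx.single z)).trans ((Ctx.Iso.refl _).append (Ctx.Iso.mapSingle _ z)))) := by
    refine (Mor.ren_val (P := Der.poly 𝒜) (.mapCons _ true z R) ((p.consTrue z).map _)
      ((p.map Formula.atom).consTrue (.atom z)) (.refl _) ((Ctx.Iso.mapAppend _ (p.ctx true)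
        (Ctx.single z)).trans ((Ctx.Iso.refl _).append (Ctx.Iso.mapSingle _ z)))
        (fun a => rfl) (fun a => ?_) (ofBase x)).trans (congrArg _ (ofBase_val _ _))
    change ((p.map Formula.atom).consTrue (.atom z)).chan true (((Ctx.Iso.refl _).append
      (Ctx.Iso.mapSingle _ z)).equiv ((Ctx.Iso.mapAppend Formula.atom (p.ctx true)
        (Ctx.single z)).equiv a)) = (p.consTrue z).chan true a
    induction a using append_cases with
    | hl a =>
      rw [Ctx.Iso.mapAppend_equiv_inl, Ctx.Iso.append_equiv_inl, Arr.consTrue_chan_inl]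
      exact (Arr.consTrue_chan_inl _ _ _).symm
    | hr a =>
      rw [Ctx.Iso.mapAppend_equiv_inr, Ctx.Iso.append_equiv_inr, Arr.consTrue_chan_inr]
      exact (Arr.consTrue_chan_inr z p a).symm
  have e2 : ((ofBase y).ren (.mapCons _ false z R')).val
      ((q.map Formula.atom).consFalse (.atom z)) =
      mk (.ax (y.val (q.consFalse z)) ((Ctx.Iso.mapAppend _ (Ctx.single z)
        (q.ctx false)).trans ((Ctx.Iso.mapSingle _ z).append (Ctx.Iso.refl _))) (.refl _)) := by
    refine (Mor.ren_val (P := Der.poly 𝒜) (.mapCons _ false z R') ((q.consFalse z).map _)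
      ((q.map Formula.atom).consFalse (.atom z)) ((Ctx.Iso.mapAppend _ (Ctx.single z)
        (q.ctx false)).trans ((Ctx.Iso.mapSingle _ z).append (Ctx.Iso.refl _))) (.refl _)
        (fun a => ?_) (fun a => rfl) (ofBase y)).trans (congrArg _ (ofBase_val _ _))
    change ((q.map Formula.atom).consFalse (.atom z)).chan false (((Ctx.Iso.mapSingle _ z).append
      (Ctx.Iso.refl _)).equiv ((Ctx.Iso.mapAppend Formula.atom (Ctx.single z)
        (q.ctx false)).equiv a)) = (q.consFalse z).chan false a
    induction a using append_cases with
    | hl a =>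
      rw [Ctx.Iso.mapAppend_equiv_inl, Ctx.Iso.append_equiv_inl, Arr.consFalse_chan_inl]
      exact (Arr.consFalse_chan_inl z q a).symm
    | hr a =>
      rw [Ctx.Iso.mapAppend_equiv_inr, Ctx.Iso.append_equiv_inr, Arr.consFalse_chan_inr]
      exact (Arr.consFalse_chan_inr _ _ _).symm
  have e (b : Bool) (a : ((p.ctx b ⊹ q.ctx b).map Formula.atom).Chan) :
      ((p.map Formula.atom).append (q.map Formula.atom)).chan b
        ((Ctx.Iso.mapAppend Formula.atom (p.ctx b) (q.ctx b)).equiv a) =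
      (p.append q).chan b a := by
    change (p.ctx b ⊹ q.ctx b).Chan at a
    induction a using append_cases with
    | hl a =>
      rw [Ctx.Iso.mapAppend_equiv_inl, Arr.append_chan_inl]
      exact (Arr.append_chan_inl p q b a).symm
    | hr a =>
      rw [Ctx.Iso.mapAppend_equiv_inr, Arr.append_chan_inr]
      exact (Arr.append_chan_inr p q b a).symm
  apply Mor.ext_at ((p.map Formula.atom).append (q.map Formula.atom))
  rw [Mor.cut_val, e1, e2]
  refine (mk_eq (.essential _ _)).trans (Eq.symm ?_)
  refine (Mor.ren_val (P := Der.poly 𝒜) (.mapAppend _ R R') ((p.append q).map _)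
    ((p.map Formula.atom).append (q.map Formula.atom)) (.mapAppend _ _ _) (.mapAppend _ _ _)
    (fun a => ?_) (fun a => ?_) _).trans ?_
  · exact e false a
  · exact e true a
  · rw [ofBase_val, Mor.cut_val]
    rfl

theorem ofBase_scut {b b' : Bool} (hb : b' = !b) {z : 𝒜.Obj} (x : 𝒜.Mor (R.cons b z))
    (y : 𝒜.Mor (R'.cons b' z)) :
    Mor.scut hb ((ofBase x).ren (.mapCons _ b z R)) ((ofBase y).ren (.mapCons _ b' z R')) =
      (ofBase (Mor.scut hb x y)).ren (.mapAppend _ R R') := by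
  subst hb
  cases b
  · refine (congrArg (Mor.ren (P := Der.poly 𝒜) (Sequent.Iso.comm _ _)) (ofBase_cut y x)).trans
      (Eq.trans ?_ (congrArg (Mor.ren (P := Der.poly 𝒜) (.mapAppend _ R R'))
        (ofBase_ren (.comm _ _) (Mor.cut y x))).symm)
    rw [Mor.ren_ren, Mor.ren_ren]
    exact Mor.ren_congr (fun c => by cases c <;> rfl) _
  · exact ofBase_cut x y

/-- A renamed polymorphism of `𝒜` can be written with any other renaming from a sequent of
atoms. -/
theorem exists_ofBase_ren (x : 𝒜.Mor R) (i : (R.map Formula.atom).Iso S)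
    (k : (R'.map Formula.atom).Iso S) : ∃ x' : 𝒜.Mor R', (ofBase x).ren i = (ofBase x').ren k := by
  refine ⟨x.ren (.ofMap (fun _ _ h => Formula.atom.inj h) (i.trans k.symm)), ?_⟩
  rw [ofBase_ren, Mor.ren_ren]
  exact Mor.ren_congr (fun c => (k.equiv.apply_symm_apply _).symm) _

end Axioms

/-- The morphisms represented by a cut-free derivation with at most `n` logical rules on each
branch. -/
inductive CutFree : ∀ (_ : ℕ) {S : Sequent (Formula 𝒜.Obj)}, (Der.poly 𝒜).Mor S → Prop
  | ax (n : ℕ) {S : Sequent (Formula 𝒜.Obj)} {R : Sequent 𝒜.Obj}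
      (i : (R.map Formula.atom).Iso S) (x : 𝒜.Mor R) : CutFree n ((ofBase x).ren i)
  | rule {n : ℕ} {S : Sequent (Formula 𝒜.Obj)} (c : S.Chan) (m : Move 𝒜.Obj)
      (h : S.ty c = m.main (S.pol c)) (f : ∀ j, (Der.poly 𝒜).Mor (S.set c (m.prem j)))
      (hf : ∀ j, CutFree n (f j)) : CutFree (n + 1) (SigmaPi.rule c m h f)

namespace CutFree

theorem mono {n k : ℕ} (hn : n ≤ k) {x : (Der.poly 𝒜).Mor S} (hx : CutFree n x) :
    CutFree k x := by
  induction hx generalizing k with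
  | ax n i x => exact .ax k i x
  | rule c m h f hf ih =>
    obtain ⟨k, rfl⟩ : ∃ k', k = k' + 1 := ⟨k - 1, by omega⟩
    exact .rule c m h f fun j => ih j (by omega)

theorem ren {n : ℕ} {x : (Der.poly 𝒜).Mor S} (hx : CutFree n x) (i : S.Iso T) :
    CutFree n (x.ren i) := by
  induction hx generalizing T with
  | ax n j x => exact .ax n (j.trans i) x
  | rule c m h f hf ih =>
    rw [ren_rule i rfl]
    exact .rule _ m _ _ fun j => ih j _

theorem exists_atom {R : Sequent 𝒜.Obj} (i : (R.map Formula.atom).Iso S) (c : S.Chan) :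
    ∃ A, S.ty c = .atom A :=
  ⟨R.ty (i.equiv.symm c), by
    have := i.ty_eq (i.equiv.symm c)
    rwa [Equiv.apply_symm_apply] at this⟩

theorem exists_eq_atom_of_cons {R : Sequent 𝒜.Obj} {b : Bool} {z : Formula 𝒜.Obj}
    (i : (R.map Formula.atom).Iso (S.cons b z)) :
    (∃ A, z = .atom A) ∧ ∃ R' : Sequent 𝒜.Obj, S = R'.map Formula.atom :=
  ⟨exists_atom i none, Sequent.exists_eq_map _ _ fun c => exists_atom i (some c)⟩

/-- Cut elimination: the cut of cut-free morphisms is cut free. The bounds on the heights add up,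
since each reduction step lowers the height of a premise. -/
theorem scut {b b' : Bool} (hb : b' = !b) {z : Formula 𝒜.Obj} {n k l : ℕ} (hl : n + k ≤ l)
    {x : (Der.poly 𝒜).Mor (S.cons b z)} {y : (Der.poly 𝒜).Mor (T.cons b' z)}
    (hx : CutFree n x) (hy : CutFree k y) : CutFree l (Mor.scut hb x y) := by
  induction l using Nat.strong_induction_on generalizing S T z n k with
  | _ l ih =>
  cases hx with
  | @rule n _ c m h f hf =>
    obtain ⟨l, rfl⟩ : ∃ l', l = l' + 1 := ⟨l - 1, by omega⟩
    cases c with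
    | some c =>
      rw [scut_rule_left hb c m h f y]
      exact .rule _ m _ _ fun j => (ih l (by omega) (by omega) ((hf j).ren _) hy).ren _
    | none =>
      cases hy with
      | ax _ i y =>
        obtain ⟨A, hA⟩ := exists_atom i none
        exact absurd (h.symm.trans hA) (m.main_ne_atom _ _)
      | @rule k _ c' m' h' g hg =>
        cases c' with
        | some c =>
          rw [scut_rule_right hb c m' h' _ g]
          exact .rule _ m' _ _ fun j =>
            (ih l (by omega) (by omega) (.rule _ m h f hf) ((hg j).ren _)).ren _
        | none =>
          obtain ⟨X, j, j', -, e, e', H⟩ := scut_principal hb m m' h h'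
          refine (H S T f g).symm ▸ ?_
          exact (ih l (by omega) (by omega) ((hf j).ren _) ((hg j').ren _)).mono (by omega)
  | ax _ i x =>
    cases hy with
    | @rule k _ c' m' h' g hg =>
      obtain ⟨l, rfl⟩ : ∃ l', l = l' + 1 := ⟨l - 1, by omega⟩
      cases c' with
      | some c =>
        rw [scut_rule_right hb c m' h' _ g]
        exact .rule _ m' _ _ fun j =>
          (ih l (by omega) (by omega) (.ax n i x) ((hg j).ren _)).ren _
      | none =>
        obtain ⟨A, hA⟩ := exists_atom i none
        exact absurd (h'.symm.trans hA) (m'.main_ne_atom _ _)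
    | ax _ i' y =>
      obtain ⟨⟨A, rfl⟩, R, rfl⟩ := exists_eq_atom_of_cons i
      obtain ⟨-, R', rfl⟩ := exists_eq_atom_of_cons i'
      obtain ⟨x', hx⟩ := exists_ofBase_ren x i (.mapCons _ b A R)
      obtain ⟨y', hy⟩ := exists_ofBase_ren y i' (.mapCons _ b' A R')
      rw [hx, hy, ofBase_scut]
      exact .ax _ _ _

end CutFree

theorem ofVal_left (p : S.Arr) (m : Move 𝒜.Obj) (a : (p.ctx false).Chan)
    (h : (p.ctx false).ty a = m.main false)
    (f : ∀ j, (Der.poly 𝒜).Hom ((p.ctx false).set a (m.prem j)) (p.ctx true)) :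
    Mor.ofVal p (left m a h f) = rule (p.chan false a) m (by rw [p.ty_chan, h, p.pol_chan])
      fun j => Mor.ofVal (p.setFalse _ a rfl (m.prem j)) (f j) := by
  apply Mor.ext_at p
  rw [Mor.ofVal_val, rule_val_false _ _ _ _ p a rfl]
  congr 1
  funext j
  exact (Mor.ofVal_val (P := Der.poly 𝒜) (p.setFalse _ a rfl (m.prem j)) (f j)).symm

theorem ofVal_right (p : S.Arr) (m : Move 𝒜.Obj) (a : (p.ctx true).Chan)
    (h : (p.ctx true).ty a = m.main true)
    (f : ∀ j, (Der.poly 𝒜).Hom (p.ctx false) ((p.ctx true).set a (m.prem j))) :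
    Mor.ofVal p (right m a h f) = rule (p.chan true a) m (by rw [p.ty_chan, h, p.pol_chan])
      fun j => Mor.ofVal (p.setTrue _ a rfl (m.prem j)) (f j) := by
  apply Mor.ext_at p
  rw [Mor.ofVal_val, rule_val_true _ _ _ _ p a rfl]
  congr 1
  funext j
  exact (Mor.ofVal_val (P := Der.poly 𝒜) (p.setTrue _ a rfl (m.prem j)) (f j)).symm

end SigmaPi

namespace SigmaPi

open PolyData Sequent

variable {𝒜 : SymPolycategory.{u, w}} {S T U : Sequent (Formula 𝒜.Obj)}


section

variable {Γ Δ : Ctx (Formula 𝒜.Obj)}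

/-- The class of `f`, on every arrangement of its channels, is cut free. -/
def CutElim (f : Der 𝒜 Γ Δ) : Prop :=
  ∀ {S : Sequent (Formula 𝒜.Obj)} (p : S.Arr) (σ : Γ.Iso (p.ctx false)) (τ : Δ.Iso (p.ctx true)),
    ∃ n, CutFree n (Mor.ofVal p ((Der.poly 𝒜).act σ τ (mk f)))

theorem CutElim.ax {A B : Ctx 𝒜.Obj} (f : 𝒜.Hom A B) (σ₀ : (A.map Formula.atom).Iso Γ)
    (τ₀ : (B.map Formula.atom).Iso Δ) : CutElim (.ax f σ₀ τ₀) := by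
  intro S p σ τ
  let q := Arr.ofCtx A B
  have e : Mor.ofVal (P := Der.poly 𝒜) (q.map Formula.atom) (mk (.ax f (.refl _) (.refl _))) =
      ofBase (Mor.ofVal q f) := by
    apply Mor.ext_at (q.map Formula.atom)
    rw [ofBase_val, Mor.ofVal_val, Mor.ofVal_val]
  refine ⟨0, ?_⟩
  change CutFree 0 (Mor.ofVal p ((Der.poly 𝒜).act (σ₀.trans σ) (τ₀.trans τ)
    (mk (.ax f (.refl _) (.refl _)))))
  rw [Mor.ofVal_act (P := Der.poly 𝒜) (q.map Formula.atom) p, e]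
  exact .ax 0 _ _

theorem CutElim.left (m : Move 𝒜.Obj) (a : Γ.Chan) (h : Γ.ty a = m.main false)
    (f : ∀ j, Der 𝒜 (Γ.set a (m.prem j)) Δ) (hf : ∀ j, CutElim (f j)) :
    CutElim (Der.left m a h f) := by
  intro S p σ τ
  rw [← left_mk, act_left, ofVal_left]
  choose n hn using fun j => hf j (p.setFalse _ (σ.equiv a) rfl (m.prem j)) (σ.set a _) τ
  obtain ⟨N, hN⟩ := Finite.exists_le n
  exact ⟨N + 1, .rule _ _ _ _ fun j => (hn j).mono (hN j)⟩

theorem CutElim.right (m : Move 𝒜.Obj) (a : Δ.Chan) (h : Δ.ty a = m.main true)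
    (f : ∀ j, Der 𝒜 Γ (Δ.set a (m.prem j))) (hf : ∀ j, CutElim (f j)) :
    CutElim (Der.right m a h f) := by
  intro S p σ τ
  rw [← right_mk, act_right, ofVal_right]
  choose n hn using fun j => hf j (p.setTrue _ (τ.equiv a) rfl (m.prem j)) σ (τ.set a _)
  obtain ⟨N, hN⟩ := Finite.exists_le n
  exact ⟨N + 1, .rule _ _ _ _ fun j => (hn j).mono (hN j)⟩

theorem CutElim.cut {Γ₁ Γ₂ Δ₁ Δ₂ : Ctx (Formula 𝒜.Obj)} {Z : Formula 𝒜.Obj}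
    (σ₀ : (Γ₁ ⊹ Γ₂).Iso Γ) (τ₀ : (Δ₁ ⊹ Δ₂).Iso Δ) (f : Der 𝒜 Γ₁ (Δ₁ ⊹ Ctx.single Z))
    (g : Der 𝒜 (Ctx.single Z ⊹ Γ₂) Δ₂) (hf : CutElim f) (hg : CutElim g) :
    CutElim (.cut σ₀ τ₀ f g) := by
  intro S p σ τ
  let q := Arr.ofCtx Γ₁ Δ₁
  let r := Arr.ofCtx Γ₂ Δ₂
  obtain ⟨n, hn⟩ := hf (q.consTrue Z) (.refl _) (.refl _)
  obtain ⟨k, hk⟩ := hg (r.consFalse Z) (.refl _) (.refl _)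
  have e : Mor.ofVal (P := Der.poly 𝒜) (q.append r) (mk (.comp f g)) =
      Mor.cut (Mor.ofVal (q.consTrue Z) (mk f)) (Mor.ofVal (r.consFalse Z) (mk g)) := by
    apply Mor.ext_at (q.append r)
    rw [Mor.cut_val, Mor.ofVal_val, Mor.ofVal_val, Mor.ofVal_val]
    rfl
  rw [Equivariant.act_refl] at hn hk
  refine ⟨n + k, ?_⟩
  change CutFree (n + k) (Mor.ofVal p ((Der.poly 𝒜).act (σ₀.trans σ) (τ₀.trans τ)
    (mk (.comp f g))))
  rw [Mor.ofVal_act (P := Der.poly 𝒜) (q.append r) p, e]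
  exact (CutFree.scut rfl le_rfl hn hk).ren _

theorem cutElim (f : Der 𝒜 Γ Δ) : CutElim f := by
  induction f with
  | ax f σ τ => exact CutElim.ax f σ τ
  | cotuple a X ha f ih => exact CutElim.left (.all X) a ha f ih
  | tuple a X ha f ih => exact CutElim.right (.all X) a ha f ih
  | proj a X ha k f ih => exact CutElim.left (.choose X k) a ha (fun _ => f) fun _ => ih
  | inj a X ha k f ih => exact CutElim.right (.choose X k) a ha (fun _ => f) fun _ => ih
  | cut σ τ f g ihf ihg => exact CutElim.cut σ τ f g ihf ihg

theorem exists_cutFree (x : (Der.poly 𝒜).Mor S) : ∃ n, CutFree n x := by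
  let p := Classical.arbitrary S.Arr
  obtain ⟨f, hf⟩ := mk_surjective (x.val p)
  obtain ⟨n, hn⟩ := cutElim f p (.refl _) (.refl _)
  refine ⟨n, ?_⟩
  rw [Equivariant.act_refl, hf] at hn
  have e : Mor.ofVal p (x.val p) = x := Mor.ext_at p (Mor.ofVal_val (P := Der.poly 𝒜) p (x.val p))
  rwa [e] at hn

end

/-! ### Associativity and interchange -/

section

variable {b b' c c' : Bool} (hb : b' = !b) (hc : c' = !c) {z t : Formula 𝒜.Obj}

/-- Both sides of the associativity law commute with a rule of `x` away from the cut. -/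
theorem assocAt_rule_left (s : S.Chan) (m : Move 𝒜.Obj) (h : S.ty s = m.main (S.pol s))
    (f : ∀ j, (Der.poly 𝒜).Mor ((S.cons b z).set (some s) (m.prem j)))
    (y : (Der.poly 𝒜).Mor ((T.cons c t).cons b' z)) (v : (Der.poly 𝒜).Mor (U.cons c' t))
    (H : ∀ j, Mor.AssocAt hb hc ((f j).ren (.setConsSome b z S s (m.prem j))) y v) :
    Mor.AssocAt hb hc (rule (S := S.cons b z) (some s) m h f) y v := by
  have e₁ : (Mor.scut hb (rule (S := S.cons b z) (some s) m h f) y).ren (.appendCons c t S T) =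
      rule (S := (S.append T).cons c t) (some (.inl s)) m h fun j =>
        ((Mor.scut hb ((f j).ren (.setConsSome b z S s (m.prem j))) y).ren
          (.setAppendLeft S (T.cons c t) s (m.prem j))).ren
            ((Iso.appendCons c t S T).set (c := .inl s) (d := some (.inl s)) rfl (m.prem j)) :=
    (congrArg (Mor.ren (P := Der.poly 𝒜) _) (scut_rule_left hb s m h f y)).trans
      (ren_rule _ rfl _ _ _)
  have e₂ := (congrArg (fun w => Mor.ren (P := Der.poly 𝒜) (.assoc S T U) (Mor.scut hc w v))
    e₁).trans ((congrArg (Mor.ren (P := Der.poly 𝒜) (.assoc S T U))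
    (scut_rule_left (S := S.append T) hc (.inl s) m h _ v)).trans (ren_rule _ rfl _ _ _))
  refine e₂.trans (Eq.trans ?_ (scut_rule_left hb s m h f _).symm)
  refine congrArg (rule (S := S.append (T.append U)) (.inl s) m h) (funext fun j => ?_)
  rw [← H j]
  generalize Mor.scut hb ((f j).ren (.setConsSome b z S s (m.prem j))) y = w
  have e : ((w.ren (.setAppendLeft S (T.cons c t) s (m.prem j))).ren
      ((Iso.appendCons c t S T).set (c := .inl s) (d := some (.inl s)) rfl (m.prem j))).ren
        (.setConsSome c t (S.append T) (.inl s) (m.prem j)) =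
      (w.ren (.appendCons c t (S.set s (m.prem j)) T)).ren
        (.cons c t (.setAppendLeft S T s (m.prem j))) := by
    rw [Mor.ren_ren, Mor.ren_ren, Mor.ren_ren]
    refine Mor.ren_congr (fun d => ?_) _
    rcases d with d | _ | d <;> rfl
  rw [e, Mor.scut_ren_left, Mor.ren_ren, Mor.ren_ren, Mor.ren_ren]
  refine Mor.ren_congr (fun d => ?_) _
  rcases d with (d | d) | d <;> rfl

/-- Both sides of the associativity law commute with a rule of `y` away from both cuts. -/
theorem assocAt_rule_middle (s : T.Chan) (m : Move 𝒜.Obj) (h : T.ty s = m.main (T.pol s))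
    (x : (Der.poly 𝒜).Mor (S.cons b z))
    (f : ∀ j, (Der.poly 𝒜).Mor (((T.cons c t).cons b' z).set (some (some s)) (m.prem j)))
    (v : (Der.poly 𝒜).Mor (U.cons c' t))
    (H : ∀ j, Mor.AssocAt hb hc x ((f j).ren (.trans
      (.setConsSome b' z (T.cons c t) (some s) (m.prem j))
      (.cons b' z (.setConsSome c t T s (m.prem j))))) v) :
    Mor.AssocAt hb hc x (rule (S := (T.cons c t).cons b' z) (some (some s)) m h f) v := by
  -- the rule moves below the outer cut of the left-hand side
  have e₁ : (Mor.scut hb x (rule (S := (T.cons c t).cons b' z) (some (some s)) m h f)).ren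
        (.appendCons c t S T) =
      rule (S := (S.append T).cons c t) (some (.inr s)) m h fun j =>
        ((Mor.scut hb x ((f j).ren (.setConsSome b' z (T.cons c t) (some s) (m.prem j)))).ren
          (.setAppendRight S (T.cons c t) (some s) (m.prem j))).ren
            ((Iso.appendCons c t S T).set (c := .inr (some s)) (d := some (.inr s)) rfl
              (m.prem j)) :=
    (congrArg (Mor.ren (P := Der.poly 𝒜) _)
      (scut_rule_right (T := T.cons c t) hb (some s) m h x f)).trans (ren_rule _ rfl _ _ _)
  have e₂ := (congrArg (fun w => Mor.ren (P := Der.poly 𝒜) (.assoc S T U) (Mor.scut hc w v))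
    e₁).trans ((congrArg (Mor.ren (P := Der.poly 𝒜) (.assoc S T U))
    (scut_rule_left (S := S.append T) hc (.inr s) m h _ v)).trans (ren_rule _ rfl _ _ _))
  -- the rule moves below the outer cut of the right-hand side
  have e₃ : (rule (S := (T.cons c t).cons b' z) (some (some s)) m h f).ren
        (.consCons b' z c t T) =
      rule (S := (T.cons b' z).cons c t) (some (some s)) m h fun j =>
        (f j).ren ((Iso.consCons b' z c t T).set (c := some (some s)) (d := some (some s)) rfl
          (m.prem j)) :=
    ren_rule _ rfl _ _ _
  have e₄ := (congrArg (fun w => Mor.ren (P := Der.poly 𝒜) (.consAppend b' z T U)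
    (Mor.scut hc w v)) e₃).trans ((congrArg (Mor.ren (P := Der.poly 𝒜) (.consAppend b' z T U))
    (scut_rule_left (S := T.cons b' z) hc (some s) m h _ v)).trans (ren_rule _ rfl _ _ _))
  have e₅ := (congrArg (fun w => Mor.scut hb x w) e₄).trans
    (scut_rule_right (T := T.append U) hb (.inl s) m h x _)
  refine e₂.trans (Eq.trans ?_ e₅.symm)
  refine congrArg (rule (S := S.append (T.append U)) (.inr (.inl s)) m h) (funext fun j => ?_)
  have Hj := H j
  unfold Mor.AssocAt at Hj
  have e₆ : (((Mor.scut hb x ((f j).ren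
        (.setConsSome b' z (T.cons c t) (some s) (m.prem j)))).ren
          (.setAppendRight S (T.cons c t) (some s) (m.prem j))).ren
            ((Iso.appendCons c t S T).set (c := .inr (some s)) (d := some (.inr s)) rfl
              (m.prem j))).ren (.setConsSome c t (S.append T) (.inr s) (m.prem j)) =
      ((Mor.scut hb x ((f j).ren (.trans (.setConsSome b' z (T.cons c t) (some s) (m.prem j))
        (.cons b' z (.setConsSome c t T s (m.prem j)))))).ren
          (.appendCons c t S (T.set s (m.prem j)))).ren
            (.cons c t (.setAppendRight S T s (m.prem j))) := by
    rw [← Mor.ren_ren (P := Der.poly 𝒜) (.setConsSome b' z (T.cons c t) (some s) (m.prem j)),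
      Mor.scut_ren_right, Mor.ren_ren, Mor.ren_ren, Mor.ren_ren, Mor.ren_ren]
    refine Mor.ren_congr (fun d => ?_) _
    rcases d with d | _ | d <;> rfl
  have e₇ : ((f j).ren (.trans (.setConsSome b' z (T.cons c t) (some s) (m.prem j))
        (.cons b' z (.setConsSome c t T s (m.prem j))))).ren
          (.consCons b' z c t (T.set s (m.prem j))) =
      (((f j).ren ((Iso.consCons b' z c t T).set (c := some (some s)) (d := some (some s)) rfl
        (m.prem j))).ren (.setConsSome c t (T.cons b' z) (some s) (m.prem j))).ren
          (.cons c t (.setConsSome b' z T s (m.prem j))) := by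
    rw [Mor.ren_ren, Mor.ren_ren, Mor.ren_ren]
    refine Mor.ren_congr (fun d => ?_) _
    rcases d with _ | _ | d <;> rfl
  rw [e₇, Mor.scut_ren_left] at Hj
  rw [e₆, Mor.scut_ren_left]
  generalize Mor.scut hc (((f j).ren ((Iso.consCons b' z c t T).set (c := some (some s))
    (d := some (some s)) rfl (m.prem j))).ren
      (.setConsSome c t (T.cons b' z) (some s) (m.prem j))) v = w at Hj ⊢
  have e₈ : ((w.ren (.setAppendLeft (T.cons b' z) U (some s) (m.prem j))).ren
        ((Iso.consAppend b' z T U).set (c := .inl (some s)) (d := some (.inl s)) rfl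
          (m.prem j))).ren (.setConsSome b' z (T.append U) (.inl s) (m.prem j)) =
      ((w.ren (.append (.setConsSome b' z T s (m.prem j)) (.refl U))).ren
        (.consAppend b' z (T.set s (m.prem j)) U)).ren
          (.cons b' z (.setAppendLeft T U s (m.prem j))) := by
    rw [Mor.ren_ren, Mor.ren_ren, Mor.ren_ren, Mor.ren_ren]
    refine Mor.ren_congr (fun d => ?_) _
    rcases d with (_ | d) | d <;> rfl
  refine Eq.trans ?_ (congrArg (fun w => Mor.ren (P := Der.poly 𝒜)
    (.setAppendRight S (T.append U) (.inl s) (m.prem j)) (Mor.scut hb x w)) e₈.symm)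
  rw [Mor.scut_ren_right, ← Hj, Mor.ren_ren, Mor.ren_ren, Mor.ren_ren, Mor.ren_ren]
  refine Mor.ren_congr (fun d => ?_) _
  rcases d with (d | d) | d <;> rfl

/-- If the rules of `x` and `y` meet in a cut, the associativity law reduces to matching
premises. -/
theorem assocAt_principal (m m' : Move 𝒜.Obj) (h : z = m.main b) (h' : z = m'.main b')
    (f : ∀ j, (Der.poly 𝒜).Mor ((S.cons b z).set none (m.prem j)))
    (g : ∀ j, (Der.poly 𝒜).Mor (((T.cons c t).cons b' z).set none (m'.prem j)))
    (v : (Der.poly 𝒜).Mor (U.cons c' t))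
    (H : ∀ X j j' (e : m.prem j = X) (e' : m'.prem j' = X),
      Mor.AssocAt hb hc ((f j).ren (.setConsNone b z S e))
        ((g j').ren (.setConsNone b' z (T.cons c t) e')) v) :
    Mor.AssocAt hb hc (rule (S := S.cons b z) none m h f)
      (rule (S := (T.cons c t).cons b' z) none m' h' g) v := by
  obtain ⟨X, j, j', -, e, e', hcut⟩ := scut_principal hb m m' h h'
  have e₁ : (rule (S := (T.cons c t).cons b' z) none m' h' g).ren (.consCons b' z c t T) =
      rule (S := (T.cons b' z).cons c t) (some none) m' h' fun j =>
        (g j).ren ((Iso.consCons b' z c t T).set (c := none) (d := some none) rfl (m'.prem j)) :=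
    ren_rule _ rfl _ _ _
  have e₂ := (congrArg (fun w => Mor.ren (P := Der.poly 𝒜) (.consAppend b' z T U)
    (Mor.scut hc w v)) e₁).trans ((congrArg (Mor.ren (P := Der.poly 𝒜) (.consAppend b' z T U))
    (scut_rule_left (S := T.cons b' z) hc none m' h' _ v)).trans (ren_rule _ rfl _ _ _))
  have e₃ := (congrArg (fun w => Mor.scut hb (rule (S := S.cons b z) none m h f) w) e₂).trans
    (hcut S (T.append U) f _)
  have e₄ := congrArg (fun w => Mor.ren (P := Der.poly 𝒜) (.assoc S T U)
    (Mor.scut hc (w.ren (.appendCons c t S T)) v)) (hcut S (T.cons c t) f g)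
  refine e₄.trans (Eq.trans ?_ e₃.symm)
  refine (H X j j' e e').trans (congrArg (fun w => Mor.scut hb _ w) ?_)
  have e₅ : (((g j').ren ((Iso.consCons b' z c t T).set (c := none) (d := some none) rfl
        (m'.prem j'))).ren (.setConsSome c t (T.cons b' z) none (m'.prem j'))).ren
          (.cons c t (.setConsNone b' z T e')) =
      ((g j').ren (.setConsNone b' z (T.cons c t) e')).ren (.consCons b' X c t T) := by
    rw [Mor.ren_ren, Mor.ren_ren, Mor.ren_ren]
    refine Mor.ren_congr (fun d => ?_) _
    rcases d with _ | _ | d <;> rfl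
  rw [← e₅, Mor.scut_ren_left]
  generalize Mor.scut hc (((g j').ren ((Iso.consCons b' z c t T).set (c := none) (d := some none)
    rfl (m'.prem j'))).ren (.setConsSome c t (T.cons b' z) none (m'.prem j'))) v = w
  have e₆ : (w.ren (.append (.setConsNone b' z T e') (.refl U))).ren (.consAppend b' X T U) =
      ((w.ren (.setAppendLeft (T.cons b' z) U none (m'.prem j'))).ren
        ((Iso.consAppend b' z T U).set (c := .inl none) (d := none) rfl (m'.prem j'))).ren
          (.setConsNone b' z (T.append U) e') := by
    rw [Mor.ren_ren, Mor.ren_ren, Mor.ren_ren]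
    refine Mor.ren_congr (fun d => ?_) _
    rcases d with (_ | d) | d <;> rfl
  exact e₆

/-- For axioms the associativity law is that of `𝒜`. -/
theorem assocAt_ofBase {R R' R'' : Sequent 𝒜.Obj} {A B : 𝒜.Obj} (x : 𝒜.Mor (R.cons b A))
    (y : 𝒜.Mor ((R'.cons c B).cons b' A)) (v : 𝒜.Mor (R''.cons c' B)) :
    Mor.AssocAt hb hc ((ofBase x).ren (.mapCons _ b A R))
      ((ofBase y).ren (.trans (.mapCons _ b' A (R'.cons c B))
        (.cons b' (Formula.atom A) (.mapCons _ c B R'))))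
      ((ofBase v).ren (.mapCons _ c' B R'')) := by
  have h := 𝒜.isSymPolycategory.assocAt hb hc x y v
  unfold Mor.AssocAt at h ⊢
  have e₁ : (Mor.scut hb ((ofBase x).ren (.mapCons _ b A R)) ((ofBase y).ren
      (.trans (.mapCons _ b' A (R'.cons c B))
        (.cons b' (Formula.atom A) (.mapCons _ c B R'))))).ren
          (.appendCons c (Formula.atom B) (R.map _) (R'.map _)) =
      ((ofBase ((Mor.scut hb x y).ren (.appendCons c B R R'))).ren (.mapCons _ c B _)).ren
        (.cons c (Formula.atom B) (.mapAppend Formula.atom R R')) := by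
    rw [← Mor.ren_ren (P := Der.poly 𝒜) (.mapCons _ b' A (R'.cons c B)), Mor.scut_ren_right,
      ofBase_scut, ofBase_ren,
      Mor.ren_ren, Mor.ren_ren, Mor.ren_ren, Mor.ren_ren]
    refine Mor.ren_congr (fun d => ?_) _
    rcases d with d | _ | d <;> rfl
  have e₂ : ((ofBase y).ren (.trans (.mapCons _ b' A (R'.cons c B))
        (.cons b' (Formula.atom A) (.mapCons _ c B R')))).ren
          (.consCons b' (Formula.atom A) c (Formula.atom B) (R'.map _)) =
      ((ofBase (y.ren (.consCons b' A c B R'))).ren (.mapCons _ c B _)).ren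
        (.cons c (Formula.atom B) (.mapCons Formula.atom b' A R')) := by
    rw [ofBase_ren, Mor.ren_ren, Mor.ren_ren, Mor.ren_ren]
    refine Mor.ren_congr (fun d => ?_) _
    rcases d with _ | _ | d <;> rfl
  rw [e₁, e₂, Mor.scut_ren_left, Mor.scut_ren_left, ofBase_scut, ofBase_scut]
  have e₃ : ((((ofBase (Mor.scut hc (y.ren (.consCons b' A c B R')) v)).ren
        (.mapAppend _ (R'.cons b' A) R''))).ren
          (.append (.mapCons Formula.atom b' A R') (.refl (R''.map Formula.atom)))).ren
            (.consAppend b' (Formula.atom A) (R'.map _) (R''.map _)) =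
      ((ofBase ((Mor.scut hc (y.ren (.consCons b' A c B R')) v).ren (.consAppend b' A R' R''))).ren
        (.mapCons _ b' A _)).ren
          (.cons b' (Formula.atom A) (.mapAppend Formula.atom R' R'')) := by
    rw [ofBase_ren, Mor.ren_ren, Mor.ren_ren, Mor.ren_ren, Mor.ren_ren]
    refine Mor.ren_congr (fun d => ?_) _
    rcases d with (_ | d) | d <;> rfl
  rw [e₃, Mor.scut_ren_right, ofBase_scut, ← h, ofBase_ren, Mor.ren_ren, Mor.ren_ren, Mor.ren_ren,
    Mor.ren_ren]
  refine Mor.ren_congr (fun d => ?_) _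
  rcases d with (d | d) | d <;> rfl

/-- The associativity law for cut-free morphisms, by induction on the sum of their heights. -/
theorem CutFree.assocAt {n k l N : ℕ} (hN : n + k + l ≤ N)
    {x : (Der.poly 𝒜).Mor (S.cons b z)} {y : (Der.poly 𝒜).Mor ((T.cons c t).cons b' z)}
    {v : (Der.poly 𝒜).Mor (U.cons c' t)} (hx : CutFree n x) (hy : CutFree k y)
    (hv : CutFree l v) : Mor.AssocAt hb hc x y v := by
  have not_atom {S : Sequent (Formula 𝒜.Obj)} {R : Sequent 𝒜.Obj}
      (i : (R.map Formula.atom).Iso S) (c : S.Chan) (m : Move 𝒜.Obj) (b : Bool) :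
      S.ty c ≠ m.main b := by
    obtain ⟨A, hA⟩ := CutFree.exists_atom i c
    exact fun h => m.main_ne_atom b A (h.symm.trans hA)
  -- a rule of `v` is treated as a rule of `x`, by the symmetry of the law
  induction N using Nat.strong_induction_on generalizing S T U z t n k l b b' c c' with
  | _ N ih =>
  have hb' : b = !b' := by cases b <;> cases b' <;> first | rfl | cases hb
  have hc' : c = !c' := by cases c <;> cases c' <;> first | rfl | cases hc
  cases hy with
  | @rule k _ s m' h' g hg =>
    cases s with
    | none =>
      cases hx with
      | ax _ i x => exact absurd h' (not_atom i none m' _)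
      | @rule n _ s m h f hf =>
        cases s with
        | none =>
          exact assocAt_principal hb hc m m' h h' f g v fun X j j' e e' =>
            ih (N - 1) (by omega) hb hc (by omega) ((hf j).ren _) ((hg j').ren _) hv
        | some s =>
          exact assocAt_rule_left hb hc s m h f _ v fun j =>
            ih (N - 1) (by omega) hb hc (by omega) ((hf j).ren _) (.rule _ m' h' g hg) hv
    | some s =>
      cases s with
      | none =>
        have e := ren_rule (.consCons b' z c t T) (c := some none) (d := none) rfl m' h' g
        refine Mor.assocAt_symm hb hc hb' hc' _ _ _ ?_
        rw [e]
        cases hv with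
        | ax _ i v => exact absurd h' (not_atom i none m' _)
        | @rule l _ s m h f hf =>
          cases s with
          | none =>
            exact assocAt_principal hc' hb' m m' h h' f _ x fun X j j' e e' =>
              ih (N - 1) (by omega) hc' hb' (by omega) ((hf j).ren _) (((hg j').ren _).ren _) hx
          | some s =>
            exact assocAt_rule_left hc' hb' s m h f _ x fun j =>
              ih (N - 1) (by omega) hc' hb' (by omega) ((hf j).ren _)
                (.rule _ m' _ _ fun j => (hg j).ren _) hx
      | some s =>
        exact assocAt_rule_middle hb hc s m' h' x g v fun j =>
          ih (N - 1) (by omega) hb hc (by omega) hx ((hg j).ren _) hv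
  | @ax _ _ R' i' y =>
    cases hx with
    | @rule n _ s m h f hf =>
      cases s with
      | none => exact absurd h (not_atom i' none m _)
      | some s =>
        exact assocAt_rule_left hb hc s m h f _ v fun j =>
          ih (N - 1) (by omega) hb hc (by omega) ((hf j).ren _) (.ax k i' y) hv
    | @ax _ _ R i x =>
      cases hv with
      | @rule l _ s m h f hf =>
        cases s with
        | none => exact absurd h (not_atom i' (some none) m _)
        | some s =>
          refine Mor.assocAt_symm hb hc hb' hc' _ _ _ ?_
          exact assocAt_rule_left hc' hb' s m h f _ _ fun j =>
            ih (N - 1) (by omega) hc' hb' (by omega) ((hf j).ren _) ((CutFree.ax k i' y).ren _)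
              (.ax n i x)
      | @ax _ _ R'' i'' v =>
        obtain ⟨⟨A, rfl⟩, Q, rfl⟩ := CutFree.exists_eq_atom_of_cons i
        obtain ⟨⟨B, rfl⟩, Q'', rfl⟩ := CutFree.exists_eq_atom_of_cons i''
        obtain ⟨Q', rfl⟩ := Sequent.exists_eq_map Formula.atom T fun c =>
          CutFree.exists_atom i' (some (some c))
        obtain ⟨x', hx⟩ := exists_ofBase_ren x i (.mapCons _ b A Q)
        obtain ⟨y', hy⟩ := exists_ofBase_ren y i' (.trans (.mapCons _ b' A (Q'.cons c B))
          (.cons b' (Formula.atom A) (.mapCons _ c B Q')))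
        obtain ⟨v', hv⟩ := exists_ofBase_ren v i'' (.mapCons _ c' B Q'')
        rw [hx, hy, hv]
        exact assocAt_ofBase hb hc x' y' v'

end

end SigmaPi

/-! ### Units -/

namespace SigmaPi

open PolyData Sequent

variable {𝒜 : SymPolycategory.{u, w}} {S T U : Sequent (Formula 𝒜.Obj)} {b b' : Bool}

/-- The identity of a sum or product is obtained from the identities of its components by
choosing a component on one side and then quantifying over all of them on the other. The channel
`c₀` is the one on the side `β` of the second of these rules, and `c₁` is the other one. -/
theorem one_eq_rule (hb : b' = !b) {I : Type} [Finite I] (X : I → Formula 𝒜.Obj) (β : Bool)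
    {z : Formula 𝒜.Obj} (hz : z = (Move.all X).main β) {c₀ c₁ : Option Unit}
    (h₀ : ((Sequent.single b z).cons b' z).pol c₀ = β)
    (h₁ : ((Sequent.single b z).cons b' z).pol c₁ = !β)
    (e₀ : ((Sequent.single b z).cons b' z).ty c₀ =
      (Move.all X).main (((Sequent.single b z).cons b' z).pol c₀))
    (e₁ : ∀ i, (((Sequent.single b z).cons b' z).set c₀ (X i)).ty c₁ =
      (Move.choose X i).main (((Sequent.single b z).cons b' z).pol c₁))
    (hc : ∀ d, d = c₀ ∨ d = c₁) :
    (Mor.one hb z : (Der.poly 𝒜).Mor _) = rule c₀ (.all X) e₀ fun i =>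
      rule (S := ((Sequent.single b z).cons b' z).set c₀ (X i)) c₁ (.choose X i) (e₁ i)
        fun _ => (Mor.one (P := Der.poly 𝒜) hb (X i)).ren (.setPair b b' z (X i) hc) := by
  subst hz
  let p := Arr.pair hb ((Move.all X).main β)
  have ha (c : Bool) (d : Option Unit)
      (hd : ((Sequent.single b ((Move.all X).main β)).cons b' ((Move.all X).main β)).pol d = c) :
      p.chan c (Ctx.pt _) = d := by
    subst hb
    cases b <;> cases c <;> rcases d with _ | d <;> first | rfl | cases hd
  apply Mor.ext_at p
  cases β
  · refine Eq.trans ?_ (rule_val_false (S := (Sequent.single b _).cons b' _) c₀ (.all X) e₀ _ p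
      (Ctx.pt _) (ha _ _ h₀)).symm
    refine (Mor.ofVal_val (P := Der.poly 𝒜) p _).trans ((left_mk (.all X) (Ctx.pt _) rfl
      _).symm.trans (congrArg (left (.all X) (Ctx.pt _) rfl) (funext fun (i : I) => ?_)))
    let p' := p.setFalse c₀ (Ctx.pt _) (ha _ _ h₀) (X i)
    refine Eq.trans ?_ (rule_val_true (S := ((Sequent.single b _).cons b' _).set c₀ (X i)) c₁
      (.choose X i) (e₁ i) _ p' (Ctx.pt _) (ha _ _ h₁)).symm
    refine (right_mk (.choose X i) (Ctx.pt _) rfl (fun _ => Der.ren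
      (Ctx.Iso.setSingle _ (X i)).symm (Ctx.Iso.setSingle _ (X i)).symm
        (Der.iota (X i)))).symm.trans (congrArg (right (.choose X i) (Ctx.pt _) rfl)
          (funext fun _ => ?_))
    let p'' := p'.setTrue c₁ (Ctx.pt _) (ha _ _ h₁) (X i)
    refine Eq.symm ((Mor.ren_val (P := Der.poly 𝒜) (.setPair b b' _ (X i) hc)
      (.pair hb (X i)) p'' (Ctx.Iso.setSingle _ (X i)).symm (Ctx.Iso.setSingle _ (X i)).symm
      (fun _ => rfl) (fun _ => rfl) _).trans ?_)
    exact congrArg ((Der.poly 𝒜).act _ _) (Mor.ofVal_val (P := Der.poly 𝒜) (.pair hb (X i)) _)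
  · refine Eq.trans ?_ (rule_val_true (S := (Sequent.single b _).cons b' _) c₀ (.all X) e₀ _ p
      (Ctx.pt _) (ha _ _ h₀)).symm
    refine (Mor.ofVal_val (P := Der.poly 𝒜) p _).trans ((right_mk (.all X) (Ctx.pt _) rfl
      _).symm.trans (congrArg (right (.all X) (Ctx.pt _) rfl) (funext fun (i : I) => ?_)))
    let p' := p.setTrue c₀ (Ctx.pt _) (ha _ _ h₀) (X i)
    refine Eq.trans ?_ (rule_val_false (S := ((Sequent.single b _).cons b' _).set c₀ (X i)) c₁
      (.choose X i) (e₁ i) _ p' (Ctx.pt _) (ha _ _ h₁)).symm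
    refine (left_mk (.choose X i) (Ctx.pt _) rfl (fun _ => Der.ren
      (Ctx.Iso.setSingle _ (X i)).symm (Ctx.Iso.setSingle _ (X i)).symm
        (Der.iota (X i)))).symm.trans (congrArg (left (.choose X i) (Ctx.pt _) rfl)
          (funext fun _ => ?_))
    let p'' := p'.setFalse c₁ (Ctx.pt _) (ha _ _ h₁) (X i)
    refine Eq.symm ((Mor.ren_val (P := Der.poly 𝒜) (.setPair b b' _ (X i) hc)
      (.pair hb (X i)) p'' (Ctx.Iso.setSingle _ (X i)).symm (Ctx.Iso.setSingle _ (X i)).symm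
      (fun _ => rfl) (fun _ => rfl) _).trans ?_)
    exact congrArg ((Der.poly 𝒜).act _ _) (Mor.ofVal_val (P := Der.poly 𝒜) (.pair hb (X i)) _)

/-- For an atom the unit law is one of the cut-elimination reductions. -/
theorem unitAt_atom (hb : b' = !b) (A : 𝒜.Obj) (x : (Der.poly 𝒜).Mor (S.cons b (.atom A))) :
    Mor.UnitAt hb x := by
  subst hb
  let p := Classical.arbitrary S.Arr
  cases b
  · refine (Mor.unitAt_false x p).2 ?_
    obtain ⟨f, hf⟩ := mk_surjective (x.val (p.consFalse (.atom A)))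
    rw [← hf]
    refine (congrArg ((Der.poly 𝒜).act _ _) (mk_eq (.one_cut f))).trans ?_
    exact (Equivariant.act_eq_iff (P := Der.poly 𝒜) _ _ _ _).2 rfl
  · refine (Mor.unitAt_true x p).2 ?_
    obtain ⟨f, hf⟩ := mk_surjective (x.val (p.consTrue (.atom A)))
    rw [← hf]
    refine (congrArg ((Der.poly 𝒜).act _ _) (mk_eq (.cut_one f))).trans ?_
    exact (Equivariant.act_eq_iff (P := Der.poly 𝒜) _ _ _ _).2 rfl

theorem unitAt_rule_some (hb : b' = !b) {z : Formula 𝒜.Obj} (s : S.Chan) (m : Move 𝒜.Obj)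
    (h : S.ty s = m.main (S.pol s))
    (f : ∀ j, (Der.poly 𝒜).Mor ((S.cons b z).set (some s) (m.prem j)))
    (H : ∀ j, Mor.UnitAt hb ((f j).ren (.setConsSome b z S s (m.prem j)))) :
    Mor.UnitAt hb (rule (S := S.cons b z) (some s) m h f) := by
  unfold Mor.UnitAt at H ⊢
  refine (scut_rule_left hb s m h f _).trans (Eq.trans ?_
    (ren_rule (.consSingle b z S) (c := some s) (d := .inl s) rfl m h f).symm)
  refine congrArg (rule (S := S.append (.single b z)) (.inl s) m h) (funext fun j => ?_)
  rw [H j, Mor.ren_ren, Mor.ren_ren]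
  refine Mor.ren_congr (fun d => ?_) _
  rcases d with _ | d <;> rfl

/-- The unit law for a rule at the channel of the cut. This rule is recovered from one of the two
rules of the identity (`one_eq_rule`): the other one cancels against it, by `scut_principal`. -/
theorem unitAt_rule_none (hb : b' = !b) {z : Formula 𝒜.Obj} {I : Type} [Finite I]
    (X : I → Formula 𝒜.Obj) (β : Bool) (hz : z = (Move.all X).main β) (m : Move 𝒜.Obj)
    (h : z = m.main b) (f : ∀ j, (Der.poly 𝒜).Mor ((S.cons b z).set none (m.prem j)))
    (H : ∀ i (y : (Der.poly 𝒜).Mor (S.cons b (X i))), Mor.UnitAt hb y) :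
    Mor.UnitAt hb (rule (S := S.cons b z) none m h f) := by
  unfold Mor.UnitAt at H ⊢
  by_cases hβ : β = b
  · subst hβ
    have e₁ (i : I) : (((Sequent.single β z).cons b' z).set (some ()) (X i)).ty none =
        (Move.choose X i).main b' := by
      refine (set_ty_ne ((Sequent.single β z).cons b' z) (by simp) _).trans (hz.trans ?_)
      subst hb
      cases β <;> rfl
    rw [one_eq_rule hb X β hz (c₀ := some ()) (c₁ := none) rfl hb hz e₁
      (by rintro (_ | _) <;> simp)]
    refine (scut_rule_right (T := .single β z) hb () (.all X) hz _ _).trans ?_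
    have hm : m = .all X := by
      subst hz
      cases m <;> cases β <;> cases h <;> rfl
    subst hm
    refine Eq.trans ?_ (ren_rule (.consSingle β z S) (c := none) (d := .inr ()) rfl _ h f).symm
    refine congrArg (rule (S := S.append (.single β z)) (.inr ()) (.all X) hz)
      (funext fun (i : I) => ?_)
    have h' : z = (Move.choose X i).main b' := by
      subst hb hz
      cases β <;> rfl
    obtain ⟨Y, j, j', d, e, e', hcut⟩ := scut_principal hb (.all X) (.choose X i) hz h'
    cases d
    change X i = Y at e
    subst e
    change X i = X i at e'
    have e₂ := ren_rule (.setConsSome b' z (.single β z) () (X i)) (c := none) (d := none) rfl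
      (.choose X i) (e₁ i) fun _ => (Mor.one (P := Der.poly 𝒜) hb (X i)).ren
        (.setPair β b' z (X i) (c₀ := some ()) (c₁ := none) (by rintro (_ | _) <;> simp))
    refine (congrArg (fun w => Mor.ren (P := Der.poly 𝒜)
      (.setAppendRight S (.single β z) () (X i)) (Mor.scut hb _ w)) e₂).trans ?_
    refine (congrArg (Mor.ren (P := Der.poly 𝒜)
      (.setAppendRight S (.single β z) () (X i))) (hcut S _ f _)).trans ?_
    have e₃ : (((Mor.one (P := Der.poly 𝒜) hb (X i)).ren
        (.setPair β b' z (X i) (c₀ := some ()) (c₁ := none) (by rintro (_ | _) <;> simp))).ren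
          ((Iso.setConsSome b' z (.single β z) () (X i)).set (c := none) (d := none) rfl
            (X i))).ren (.setConsNone b' z ((Sequent.single β z).set () (X i)) e') =
        (Mor.one hb (X i)).ren (.cons b' (X i) (.setSingle β z (X i))) := by
      rw [Mor.ren_ren, Mor.ren_ren]
      refine Mor.ren_congr (fun d => ?_) _
      rcases d with _ | d <;> rfl
    refine (congrArg (fun w => Mor.ren (P := Der.poly 𝒜)
      (.setAppendRight S (.single β z) () (X i)) (Mor.scut hb ((f i).ren
        (.setConsNone β z S rfl)) w)) e₃).trans ?_
    have key (y : (Der.poly 𝒜).Mor ((S.cons β z).set none (X i))) :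
        (Mor.scut hb (y.ren (.setConsNone β z S rfl)) ((Mor.one (P := Der.poly 𝒜) hb (X i)).ren
          (.cons b' (X i) (.setSingle β z (X i))))).ren
            (.setAppendRight S (.single β z) () (X i)) =
        y.ren ((Iso.consSingle β z S).set (c := none) (d := .inr ()) rfl (X i)) := by
      rw [Mor.scut_ren_right, H i, Mor.ren_ren, Mor.ren_ren, Mor.ren_ren]
      refine Mor.ren_congr (fun d => ?_) _
      rcases d with _ | d <;> rfl
    exact key (f i)
  · obtain rfl : β = b' := by
      subst hb
      cases b <;> cases β <;> first | rfl | exact absurd rfl hβ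
    have e₁ (i : I) : (((Sequent.single b z).cons β z).set none (X i)).ty (some ()) =
        (Move.choose X i).main b := by
      refine (set_ty_ne ((Sequent.single b z).cons β z) (by simp) _).trans (hz.trans ?_)
      subst hb
      cases b <;> rfl
    have hb' : b = !β := by
      subst hb
      cases b <;> rfl
    rw [one_eq_rule hb X β hz (c₀ := none) (c₁ := some ()) rfl hb' hz e₁
      (by rintro (_ | _) <;> simp)]
    obtain ⟨Y, j, j', d, e, e', hcut⟩ := scut_principal hb m (.all X) h hz
    refine (hcut S (.single b z) f _).trans ?_
    obtain ⟨i, rfl⟩ : ∃ i : I, m = .choose X i := by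
      cases d
      exact ⟨_, rfl⟩
    have hj : i = j' := by
      cases d
      rfl
    subst hj
    change X i = Y at e
    subst e
    change X i = X i at e'
    refine (congrArg (fun w => Mor.scut hb _ w) (ren_rule
      (.setConsNone β z (.single b z) (y := X i) (y' := X i) rfl) (c := some ()) (d := some ()) rfl
      (.choose X i) (e₁ i) _)).trans ?_
    refine (scut_rule_right (T := .single b z) hb () (.choose X i) h _ _).trans ?_
    refine Eq.trans ?_ (ren_rule (.consSingle b z S) (c := none) (d := .inr ()) rfl _ h f).symm
    refine congrArg (rule (S := S.append (.single b z)) (.inr ()) (.choose X i) h)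
      (funext fun _ => ?_)
    have e₃ : (((Mor.one (P := Der.poly 𝒜) hb (X i)).ren
        (.setPair b β z (X i) (c₀ := none) (c₁ := some ()) (by rintro (_ | _) <;> simp))).ren
          ((Iso.setConsNone β z (.single b z) (y := X i) (y' := X i) rfl).set (c := some ())
            (d := some ()) rfl (X i))).ren (.setConsSome β (X i) (.single b z) () (X i)) =
        (Mor.one hb (X i)).ren (.cons β (X i) (.setSingle b z (X i))) := by
      rw [Mor.ren_ren, Mor.ren_ren]
      refine Mor.ren_congr (fun d => ?_) _
      rcases d with _ | d <;> rfl
    have key (y : (Der.poly 𝒜).Mor ((S.cons b z).set none (X i))) :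
        (Mor.scut hb (y.ren (.setConsNone b z S rfl)) ((Mor.one (P := Der.poly 𝒜) hb (X i)).ren
          (.cons β (X i) (.setSingle b z (X i))))).ren
            (.setAppendRight S (.single b z) () (X i)) =
        y.ren ((Iso.consSingle b z S).set (c := none) (d := .inr ()) rfl (X i)) := by
      rw [Mor.scut_ren_right, H i, Mor.ren_ren, Mor.ren_ren, Mor.ren_ren]
      refine Mor.ren_congr (fun d => ?_) _
      rcases d with _ | d <;> rfl
    refine Eq.trans ?_ (key (f ()))
    exact congrArg (fun w => Mor.ren (P := Der.poly 𝒜)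
      (.setAppendRight S (.single b z) () (X i)) (Mor.scut hb ((f ()).ren
        (.setConsNone b z S rfl)) w)) e₃

theorem CutFree.unitAt (hb : b' = !b) {z : Formula 𝒜.Obj} {I : Type} [Finite I]
    (X : I → Formula 𝒜.Obj) (β : Bool) (hz : z = (Move.all X).main β)
    (H : ∀ i (S : Sequent (Formula 𝒜.Obj)) (y : (Der.poly 𝒜).Mor (S.cons b (X i))),
      Mor.UnitAt hb y) {n : ℕ} {x : (Der.poly 𝒜).Mor (S.cons b z)} (hx : CutFree n x) :
    Mor.UnitAt hb x := by
  induction n generalizing S with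
  | zero =>
    cases hx with
    | ax _ i x =>
      obtain ⟨A, hA⟩ := CutFree.exists_atom i none
      exact absurd (hz.symm.trans hA) (Move.main_ne_atom _ _ _)
  | succ n ih =>
    cases hx with
    | ax _ i x =>
      obtain ⟨A, hA⟩ := CutFree.exists_atom i none
      exact absurd (hz.symm.trans hA) (Move.main_ne_atom _ _ _)
    | rule s m h f hf =>
      cases s with
      | none => exact unitAt_rule_none hb X β hz m h f fun i y => H i S y
      | some s => exact unitAt_rule_some hb s m h f fun j => ih ((hf j).ren _)

theorem unitAt (hb : b' = !b) (z : Formula 𝒜.Obj) (S : Sequent (Formula 𝒜.Obj))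
    (x : (Der.poly 𝒜).Mor (S.cons b z)) : Mor.UnitAt hb x := by
  induction z generalizing S with
  | atom A => exact unitAt_atom hb A x
  | sum X ih =>
    obtain ⟨n, hn⟩ := exists_cutFree x
    exact hn.unitAt hb X false rfl ih
  | prod X ih =>
    obtain ⟨n, hn⟩ := exists_cutFree x
    exact hn.unitAt hb X true rfl ih

end SigmaPi

theorem mainTheorem7 (𝒜 : SymPolycategory.{u, w}) : (SigmaPi 𝒜).IsSymPolycategory := by
  -- `Der.poly 𝒜` is `SigmaPi 𝒜` by definition
  change (Der.poly 𝒜).IsSymPolycategory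
  refine PolyData.Equivariant.isSymPolycategory ?_ ?_
  · intro S T U b c z t x y v
    obtain ⟨n, hn⟩ := SigmaPi.exists_cutFree x
    obtain ⟨k, hk⟩ := SigmaPi.exists_cutFree y
    obtain ⟨l, hl⟩ := SigmaPi.exists_cutFree v
    exact hn.assocAt rfl rfl le_rfl hk hl
  · intro S b z x
    exact SigmaPi.unitAt rfl z S x
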